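/- Let $N\ge 2$ be an integer, $1<p<N$ and $\alpha\ge 0$. Put $p_\alpha^*=\frac{p(N+\alpha)}{N-p}$ and $$U_\alpha(x)=\frac{C_{N,p,\alpha}}{\bigl(1+|x|^{\frac{p+\alpha}{p-1}}\bigr)^{\frac{N-p}{p+\alpha}}},\qquad C_{N,p,\alpha}=\Bigl((N+\alpha)\bigl(\tfrac{N-p}{p-1}\bigr)^{p-1}\Bigr)^{\frac{N-p}{p(p+\alpha)}},\qquad x\in\mathbb R^N .$$ Let $D^{1,p}(\mathbb R^N)$ be the space of all $v\in L^{Np/(N-p)}(\mathbb R^N)$ with weak gradient $\nabla v\in L^p(\mathbb R^N)$ (functions being identified when they agree almost everywhere). Let $S_\alpha$ be the vector space of all $v\in D^{1,p}(\mathbb R^N)$ that are weak solutions on $\mathbb R^N$ of the equation $$-\operatorname{div}\bigl(|\nabla U_\alpha|^{p-2}\nabla v\bigr)-(p-2)\operatorname{div}\bigl(|\nabla U_\alpha|^{p-4}(\nabla U_\alpha\cdot\nabla v)\nabla U_\alpha\bigr)=(p_\alpha^*-1)|x|^\alpha U_\alpha^{p_\alpha^*-2}v ,$$ that is, such that for every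 $\eta\in C_c^\infty(\mathbb R^N)$ both integrals below converge absolutely and $$\int_{\mathbb R^N}\Bigl(|\nabla U_\alpha|^{p-2}\,\nabla v\cdot\nabla\eta+(p-2)|\nabla U_\alpha|^{p-4}(\nabla U_\alpha\cdot\nabla v)(\nabla U_\alpha\cdot\nabla\eta)\Bigr)dx=\int_{\mathbb R^N}(p_\alpha^*-1)|x|^\alpha U_\alpha^{p_\alpha^*-2}\,v\,\eta\,dx .$$ For integers $k\ge 1$ set $$\alpha(k)=\frac{p\sqrt{(N+p-2)^2+4(k-1)(p-1)(k+N-1)}-p(N+p-2)}{2(p-1)},\qquad d_k=\frac{(N+2k-2)\,(N+k-3)!}{(N-2)!\,k!},$$ and $$Z(x)=\frac{(p-1)-|x|^{\frac{p+\alpha}{p-1}}}{\bigl(1+|x|^{\frac{p+\alpha}{p-1}}\bigr)^{\frac{N+\alpha}{p+\alpha}}} .$$ (i) If $\alpha>0$ and $\alpha\ne\alpha(k)$ for every integer $k\ge1$, then $S_\alpha$ has dimension $1$ and is spanned by $Z$. (ii) If $\alpha=\alpha(k)$ for some integer $k\ge 1$, then the space of homogeneous harmonic polynomials of degree $k$ on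 $\mathbb R^N$ has dimension $d_k$, the space $S_\alpha$ has dimension $1+d_k$, and for every basis $\Phi_{k,1},\dots,\Phi_{k,d_k}$ of that space of polynomials $S_\alpha$ is spanned by $Z$ together with the functions $$Z_{k,i}(x)=\frac{|x|^{\frac{p+\alpha}{p(p-1)}}\;\Phi_{k,i}\bigl(\tfrac{x}{|x|}\bigr)}{\bigl(1+|x|^{\frac{p+\alpha}{p-1}}\bigr)^{\frac{N+\alpha}{p+\alpha}}},\qquad i=1,\dots,d_k .$$ -/

import Mathlib

open MeasureTheory
open scoped ContDiff Nat

/-- The Euclidean space of dimension `N`, with its Euclidean norm and Lebesgue measure. -/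
abbrev HenonSpace (N : ℕ) : Type := EuclideanSpace ℝ (Fin N)

namespace Henon

/-- `η` is a test function, i.e. `η ∈ C_c^∞(ℝ^N)`. -/
def IsTest {N : ℕ} (η : HenonSpace N → ℝ) : Prop :=
  ContDiff ℝ ∞ η ∧ HasCompactSupport η

/-- `G` is the weak (distributional) gradient of `v` on `ℝ^N`. -/
def IsWeakGradient {N : ℕ} (v : HenonSpace N → ℝ) (G : HenonSpace N → HenonSpace N) : Prop :=
  LocallyIntegrable v ∧ LocallyIntegrable G ∧
    ∀ η : HenonSpace N → ℝ, IsTest η →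
      ∫ x, v x • gradient η x = -∫ x, η x • G x

/-- `v` belongs to `D^{1,p}(ℝ^N)` and `G` is its weak gradient: `v` is in `L^{Np/(N-p)}` and its
weak gradient is in `L^p`. For `1 < p < N` this is the completion of `C_c^∞(ℝ^N)` in the norm
`‖∇v‖_{L^p}`, realized as a space of functions. -/
structure MemD1p {N : ℕ} (p : ℝ) (v : HenonSpace N → ℝ) (G : HenonSpace N → HenonSpace N) :
    Prop where
  memLp : MemLp v (ENNReal.ofReal (N * p / (N - p))) volume
  memLp_grad : MemLp G (ENNReal.ofReal p) volume
  isWeakGradient : IsWeakGradient v G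

/-- The critical exponent `p_α^* = p (N + α) / (N - p)`. -/
noncomputable def pStar (N : ℕ) (p α : ℝ) : ℝ := p * (N + α) / (N - p)

/-- The constant `C_{N,p,α}`. -/
noncomputable def bubbleConst (N : ℕ) (p α : ℝ) : ℝ :=
  ((N + α) * (((N : ℝ) - p) / (p - 1)) ^ (p - 1)) ^ (((N : ℝ) - p) / (p * (p + α)))

/-- The radial solution `U_α` of the critical Hénon equation. -/
noncomputable def bubble (N : ℕ) (p α : ℝ) (x : HenonSpace N) : ℝ :=
  bubbleConst N p α / (1 + ‖x‖ ^ ((p + α) / (p - 1))) ^ (((N : ℝ) - p) / (p + α))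

/-- `|∇U|^{p-2} ∇v·∇η + (p-2) |∇U|^{p-4} (∇U·∇v) (∇U·∇η)`, where `U = U_α`, at the point `x`,
for the values `g = ∇v(x)` and `h = ∇η(x)`. -/
noncomputable def linForm {N : ℕ} (p α : ℝ) (x g h : HenonSpace N) : ℝ :=
  ‖gradient (bubble N p α) x‖ ^ (p - 2) * inner ℝ g h
    + (p - 2) * ‖gradient (bubble N p α) x‖ ^ (p - 4)
      * inner ℝ (gradient (bubble N p α) x) g * inner ℝ (gradient (bubble N p α) x) h

/-- The zeroth order term `(p_α^* - 1) |x|^α U_α^{p_α^* - 2}` of the linearized equation. -/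
noncomputable def linPotential {N : ℕ} (p α : ℝ) (x : HenonSpace N) : ℝ :=
  (pStar N p α - 1) * ‖x‖ ^ α * bubble N p α x ^ (pStar N p α - 2)

/-- The function `v`, with weak gradient `G`, is a weak solution on all of `ℝ^N` of the equation
`-div(|∇U|^{p-2} ∇v) - (p-2) div(|∇U|^{p-4} (∇U·∇v) ∇U) = (p_α^* - 1) |x|^α U^{p_α^* - 2} v`
linearized at `U = U_α`. Both integrals are required to converge absolutely for every test
function. -/
def SolvesLinearized {N : ℕ} (p α : ℝ) (v : HenonSpace N → ℝ)
    (G : HenonSpace N → HenonSpace N) : Prop :=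
  ∀ η : HenonSpace N → ℝ, IsTest η →
    Integrable (fun x => linForm p α x (G x) (gradient η x)) ∧
    Integrable (fun x => linPotential p α x * v x * η x) ∧
    ∫ x, linForm p α x (G x) (gradient η x) = ∫ x, linPotential p α x * v x * η x

section Linearity

variable {N : ℕ} {p α : ℝ}

lemma linForm_add (x g₁ g₂ h : HenonSpace N) :
    linForm p α x (g₁ + g₂) h = linForm p α x g₁ h + linForm p α x g₂ h := by
  simp only [linForm, inner_add_left, inner_add_right]; ring

lemma linForm_smul (c : ℝ) (x g h : HenonSpace N) :
    linForm p α x (c • g) h = c * linForm p α x g h := by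
  simp only [linForm, real_inner_smul_left, real_inner_smul_right]; ring

lemma IsTest.gradient_continuous {η : HenonSpace N → ℝ} (hη : IsTest η) :
    Continuous (gradient η) := by
  unfold gradient
  exact (InnerProductSpace.toDual ℝ (HenonSpace N)).symm.continuous.comp
    (hη.1.continuous_fderiv (by simp))

lemma IsTest.gradient_hasCompactSupport {η : HenonSpace N → ℝ} (hη : IsTest η) :
    HasCompactSupport (gradient η) := by
  have h := hη.2.fderiv (𝕜 := ℝ)
  exact h.comp_left (g := (InnerProductSpace.toDual ℝ (HenonSpace N)).symm) (by simp)

lemma IsWeakGradient.zero : IsWeakGradient (N := N) 0 0 := by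
  refine ⟨locallyIntegrable_zero, locallyIntegrable_zero, fun η _ => by simp⟩

lemma IsWeakGradient.add {v w : HenonSpace N → ℝ} {G H : HenonSpace N → HenonSpace N}
    (hv : IsWeakGradient v G) (hw : IsWeakGradient w H) :
    IsWeakGradient (v + w) (G + H) := by
  refine ⟨hv.1.add hw.1, hv.2.1.add hw.2.1, fun η hη => ?_⟩
  have e1 := hv.2.2 η hη
  have e2 := hw.2.2 η hη
  have i1 : Integrable fun x => v x • gradient η x :=
    hv.1.integrable_smul_right_of_hasCompactSupport hη.gradient_continuous
      hη.gradient_hasCompactSupport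
  have i2 : Integrable fun x => w x • gradient η x :=
    hw.1.integrable_smul_right_of_hasCompactSupport hη.gradient_continuous
      hη.gradient_hasCompactSupport
  have j1 : Integrable fun x => η x • G x :=
    hv.2.1.integrable_smul_left_of_hasCompactSupport hη.1.continuous hη.2
  have j2 : Integrable fun x => η x • H x :=
    hw.2.1.integrable_smul_left_of_hasCompactSupport hη.1.continuous hη.2
  simp only [Pi.add_apply, add_smul, smul_add]
  rw [integral_add i1 i2, integral_add j1 j2, e1, e2, neg_add]

lemma IsWeakGradient.smul (c : ℝ) {v : HenonSpace N → ℝ} {G : HenonSpace N → HenonSpace N}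
    (hv : IsWeakGradient v G) : IsWeakGradient (c • v) (c • G) := by
  refine ⟨hv.1.smul c, hv.2.1.smul c, fun η hη => ?_⟩
  have e1 := hv.2.2 η hη
  simp only [Pi.smul_apply, smul_assoc, smul_comm _ c]
  rw [integral_smul, integral_smul, e1, smul_neg]

lemma IsWeakGradient.congr {v w : HenonSpace N → ℝ} {G : HenonSpace N → HenonSpace N}
    (hv : IsWeakGradient v G) (h : v =ᵐ[volume] w) : IsWeakGradient w G := by
  refine ⟨hv.1.congr h, hv.2.1, fun η hη => ?_⟩
  rw [← hv.2.2 η hη]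
  refine integral_congr_ae ?_
  filter_upwards [h] with x hx
  rw [hx]

lemma MemD1p.congr {v w : HenonSpace N → ℝ} {G : HenonSpace N → HenonSpace N}
    (hv : MemD1p p v G) (h : v =ᵐ[volume] w) : MemD1p p w G :=
  ⟨hv.1.ae_eq h, hv.2, hv.3.congr h⟩

lemma SolvesLinearized.congr {v w : HenonSpace N → ℝ} {G : HenonSpace N → HenonSpace N}
    (hv : SolvesLinearized p α v G) (h : v =ᵐ[volume] w) : SolvesLinearized p α w G := by
  intro η hη
  obtain ⟨a, b, c⟩ := hv η hη
  have e : (fun x => linPotential p α x * v x * η x) =ᵐ[volume]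
      fun x => linPotential p α x * w x * η x := by
    filter_upwards [h] with x hx
    rw [hx]
  exact ⟨a, b.congr e, c.trans (integral_congr_ae e)⟩

lemma MemD1p.add {v w : HenonSpace N → ℝ} {G H : HenonSpace N → HenonSpace N}
    (hv : MemD1p p v G) (hw : MemD1p p w H) : MemD1p p (v + w) (G + H) :=
  ⟨hv.1.add hw.1, hv.2.add hw.2, hv.3.add hw.3⟩

lemma MemD1p.smul (c : ℝ) {v : HenonSpace N → ℝ} {G : HenonSpace N → HenonSpace N}
    (hv : MemD1p p v G) : MemD1p p (c • v) (c • G) :=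
  ⟨hv.1.const_smul c, hv.2.const_smul c, hv.3.smul c⟩

lemma SolvesLinearized.add {v w : HenonSpace N → ℝ} {G H : HenonSpace N → HenonSpace N}
    (hv : SolvesLinearized p α v G) (hw : SolvesLinearized p α w H) :
    SolvesLinearized p α (v + w) (G + H) := by
  intro η hη
  obtain ⟨a, b, c⟩ := hv η hη
  obtain ⟨a', b', c'⟩ := hw η hη
  simp only [Pi.add_apply, linForm_add, mul_add, add_mul]
  exact ⟨a.add a', b.add b', by rw [integral_add a a', integral_add b b', c, c']⟩

lemma SolvesLinearized.smul (c : ℝ) {v : HenonSpace N → ℝ} {G : HenonSpace N → HenonSpace N}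
    (hv : SolvesLinearized p α v G) : SolvesLinearized p α (c • v) (c • G) := by
  intro η hη
  obtain ⟨a, b, e⟩ := hv η hη
  have h : (fun x => linPotential p α x * (c • v) x * η x)
      = fun x => c * (linPotential p α x * v x * η x) := by
    funext x; simp only [Pi.smul_apply, smul_eq_mul]; ring
  rw [h]
  simp only [Pi.smul_apply, linForm_smul]
  exact ⟨a.const_mul c, b.const_mul c, by rw [integral_const_mul, integral_const_mul, e]⟩

end Linearity

/-- The space of solutions in `D^{1,p}(ℝ^N)` of the equation linearized at `U_α`
(functions are identified when they agree almost everywhere). -/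
def solutionSpace (N : ℕ) (p α : ℝ) : Submodule ℝ (HenonSpace N →ₘ[volume] ℝ) where
  carrier := {v | ∃ G : HenonSpace N → HenonSpace N, MemD1p p v G ∧ SolvesLinearized p α v G}
  zero_mem' := by
    have h : (0 : HenonSpace N → ℝ) =ᵐ[volume] ((0 : HenonSpace N →ₘ[volume] ℝ)) :=
      AEEqFun.coeFn_zero.symm
    have h1 : MemD1p (N := N) p 0 0 :=
      ⟨MemLp.zero, MemLp.zero, IsWeakGradient.zero⟩
    have h2 : SolvesLinearized (N := N) p α 0 0 := by
      intro η _
      simp [linForm]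
    exact ⟨0, h1.congr h, h2.congr h⟩
  add_mem' := by
    rintro v w ⟨G, hG, sG⟩ ⟨H, hH, sH⟩
    have h := (AEEqFun.coeFn_add v w).symm
    exact ⟨G + H, (hG.add hH).congr h, (sG.add sH).congr h⟩
  smul_mem' := by
    rintro c v ⟨G, hG, sG⟩
    have h := (AEEqFun.coeFn_smul c v).symm
    exact ⟨c • G, (hG.smul c).congr h, (sG.smul c).congr h⟩

/-- The critical values `α(k)` of the parameter. -/
noncomputable def alphaCrit (N : ℕ) (p : ℝ) (k : ℕ) : ℝ :=
  (p * √(((N : ℝ) + p - 2) ^ 2 + 4 * ((k : ℝ) - 1) * (p - 1) * ((k : ℝ) + N - 1))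
    - p * ((N : ℝ) + p - 2)) / (2 * (p - 1))

/-- The space of real homogeneous harmonic polynomials of degree `k` in `N` variables. -/
noncomputable def harmonicPoly (N k : ℕ) : Submodule ℝ (MvPolynomial (Fin N) ℝ) :=
  MvPolynomial.homogeneousSubmodule (Fin N) ℝ k ⊓
    LinearMap.ker (∑ i : Fin N,
      (MvPolynomial.pderiv i : Derivation ℝ (MvPolynomial (Fin N) ℝ) _).toLinearMap ∘ₗ
        (MvPolynomial.pderiv i : Derivation ℝ (MvPolynomial (Fin N) ℝ) _).toLinearMap)

/-- The number `(N+2k-2) (N+k-3)! / ((N-2)! k!)`, used for `N ≥ 2` and `k ≥ 1`, where the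
subtractions do not truncate and the division is exact. -/
def harmonicDim (N k : ℕ) : ℕ :=
  (N + 2 * k - 2) * (N + k - 3)! / ((N - 2)! * k !)

/-- `Z(x) = ((p-1) - |x|^{(p+α)/(p-1)}) / (1 + |x|^{(p+α)/(p-1)})^{(N+α)/(p+α)}`. -/
noncomputable def radialZ (N : ℕ) (p α : ℝ) (x : HenonSpace N) : ℝ :=
  ((p - 1) - ‖x‖ ^ ((p + α) / (p - 1))) /
    (1 + ‖x‖ ^ ((p + α) / (p - 1))) ^ (((N : ℝ) + α) / (p + α))

/-- `|x|^{(p+α)/(p(p-1))} Φ(x/|x|) / (1 + |x|^{(p+α)/(p-1)})^{(N+α)/(p+α)}`,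
for a polynomial `Φ`. -/
noncomputable def angularZ (N : ℕ) (p α : ℝ) (Φ : MvPolynomial (Fin N) ℝ) (x : HenonSpace N) : ℝ :=
  ‖x‖ ^ ((p + α) / (p * (p - 1))) * MvPolynomial.eval (fun i => x i / ‖x‖) Φ /
    (1 + ‖x‖ ^ ((p + α) / (p - 1))) ^ (((N : ℝ) + α) / (p + α))

lemma measurable_radialZ (N : ℕ) (p α : ℝ) : Measurable (radialZ N p α) := by
  unfold radialZ; fun_prop

lemma measurable_angularZ (N : ℕ) (p α : ℝ) (Φ : MvPolynomial (Fin N) ℝ) :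
    Measurable (angularZ N p α Φ) := by
  have h : Measurable fun x : HenonSpace N => MvPolynomial.eval (fun i => x i / ‖x‖) Φ := by
    refine (MvPolynomial.continuous_eval Φ).measurable.comp ?_
    fun_prop
  unfold angularZ; fun_prop

/-- The class of `radialZ` modulo almost everywhere equality. -/
noncomputable def radialZClass (N : ℕ) (p α : ℝ) : HenonSpace N →ₘ[volume] ℝ :=
  AEEqFun.mk (radialZ N p α) (measurable_radialZ N p α).aestronglyMeasurable

/-- The class of `angularZ` modulo almost everywhere equality. -/
noncomputable def angularZClass (N : ℕ) (p α : ℝ) (Φ : MvPolynomial (Fin N) ℝ) :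
    HenonSpace N →ₘ[volume] ℝ :=
  AEEqFun.mk (angularZ N p α Φ) (measurable_angularZ N p α Φ).aestronglyMeasurable

end Henon

/-!
The linearized operator commutes with rotations, so its kernel is found by separation of variables.
In the variable `τ = log |x|^{(p+α)/(p-1)}` the gradient of `U`, the weight `|∇U|^{p-2}` and the
potential are explicit functions of `τ` (`linForm_eq`, `linPotential_eq`). If `v` is a solution and
`H` a homogeneous harmonic polynomial of degree `k`, the coefficient `f(τ)` of `v` along `H` is a
weak, hence classical, solution on the line (`exists_isModeSolution`) of
`(ω f')' = ω (Λ - V) f`, where `ω` and `V` do not depend on `k` and `Λ` is a multiple of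
`k (k + N - 2)`.

For `k ≥ 1`, i.e. `Λ > 0`, the equation is rigid. Let `M = e^{τ/p} (1 + e^τ)^{-β}`, the positive
solution for the value `Λ*` that corresponds to the functions `Z_{k,i}`. The multiple
`m = f' - (M'/M) f` of the derivative of `f / M` satisfies an equation in which the zeroth order
coefficient is the positive constant `Λ`, so that `(ω m n)' = ω (n² + Λ m²)` with `n` essentially
`m'` (`IsModeSolution.hasDerivAt_quot_energy`). If `ω m n` tends to zero along sequences at both
ends, then `m = 0` (`IsModeSolution.quot_eq_zero`): `f` is a multiple of `M`, and it is zero unless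
`Λ = Λ*`, which means `α = α(k)` (`eq_alphaCrit_iff`).

The behaviour at the ends is where the hypotheses on `v` enter. By the energy identity
`(ω f f')' = ω (f'² + (Λ - V) f²)` the function `f f'` has a sign near each end, and with the good
sign `ω (f² + f'²)` comes arbitrarily close to zero (`IsModeSolution.exists_small_atBot`,
`IsModeSolution.exists_small_atTop`). With the bad sign `|f|` grows towards the end. At infinity
this contradicts `v ∈ L^{Np/(N-p)}`, in the form of the bound `IsModeCoeff.meanBound` for local
means. At the origin it does so if `p ≥ 2`. If `p < 2` the bound is not enough, and the equation
tested with functions equal to `H` near the origin is used: the flux of `v` through small spheres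
tends to zero (`IsModeCoeff.tendsto_flux`), and the form is integrable. Since `r^k` is a subsolution
near the origin for `p < 2`, the Wronskian of `f` with it would stay away from zero. For `k = 0` the
Wronskian with the explicit radial solution `Z` is constant, and it is zero by the same limit
(`IsModeSolution.exists_eq_radialMode`).

A function all of whose coefficients vanish is zero, since polynomials are sums of products
`|x|^{2j} H` and are dense in the continuous functions (`ae_eq_zero_of_forall_mode_eq_zero`). So the
solution space embeds in `ℝ` or, if `α = α(k)`, in `ℝ × (H_k)*`, with `H_k` the harmonic polynomials
of degree `k`; their dimension is computed from the surjectivity of the Laplacian on polynomials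
(`finrank_harmonicPoly`). Conversely, `Z` and `Z_{k,i}` are solutions: they solve the equation away
from the origin, and the singularity there is removable for the divergence theorem
(`integral_inner_gradient_of_singular`, `solvesLinearized_modeFn`). They are linearly independent
(`eq_zero_of_radialZ_add_angularZ_eq_zero`), and equality of dimensions gives the spanning
statements.
-/

namespace Henon

open Filter Topology

/-! ### Homogeneous harmonic polynomials -/

section Harmonic

open MvPolynomial

/-- The Laplacian on polynomials in `N` variables. -/
noncomputable def polyLaplacian (N : ℕ) : MvPolynomial (Fin N) ℝ →ₗ[ℝ] MvPolynomial (Fin N) ℝ :=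
  ∑ i : Fin N,
    (pderiv i : Derivation ℝ (MvPolynomial (Fin N) ℝ) _).toLinearMap ∘ₗ
      (pderiv i : Derivation ℝ (MvPolynomial (Fin N) ℝ) _).toLinearMap

/-- The polynomial `|x|² = ∑ xᵢ²`. -/
noncomputable def polyNormSq (N : ℕ) : MvPolynomial (Fin N) ℝ := ∑ i : Fin N, X i ^ 2

variable {N : ℕ}

lemma polyLaplacian_apply (q : MvPolynomial (Fin N) ℝ) :
    polyLaplacian N q = ∑ i : Fin N, pderiv i (pderiv i q) := by
  simp [polyLaplacian, LinearMap.sum_apply]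

lemma mem_harmonicPoly {k : ℕ} {q : MvPolynomial (Fin N) ℝ} :
    q ∈ harmonicPoly N k ↔ q.IsHomogeneous k ∧ polyLaplacian N q = 0 := Iff.rfl

lemma polyNormSq_isHomogeneous : (polyNormSq N).IsHomogeneous 2 :=
  IsHomogeneous.sum _ _ _ fun i _ => isHomogeneous_X_pow i 2

lemma pderiv_polyNormSq (i : Fin N) : pderiv i (polyNormSq N) = 2 * X i := by
  classical
  simp only [polyNormSq, map_sum, pderiv_pow, pderiv_X]
  rw [Finset.sum_eq_single i]
  · simp
  · intro j _ hj
    simp [hj.symm]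
  · simp

lemma polyLaplacian_isHomogeneous {k : ℕ} {q : MvPolynomial (Fin N) ℝ}
    (hq : q.IsHomogeneous k) : (polyLaplacian N q).IsHomogeneous (k - 2) := by
  rw [polyLaplacian_apply]
  exact IsHomogeneous.sum _ _ _ fun i _ => by
    simpa [Nat.sub_sub] using (hq.pderiv (i := i)).pderiv (i := i)

lemma polyLaplacian_eq_zero_of_degree_lt_two {k : ℕ} (hk : k < 2) {q : MvPolynomial (Fin N) ℝ}
    (hq : q.IsHomogeneous k) : polyLaplacian N q = 0 := by
  rw [polyLaplacian_apply]
  refine Finset.sum_eq_zero fun i _ => ?_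
  have h : (pderiv i q).IsHomogeneous 0 := by
    have := hq.pderiv (i := i)
    rwa [show k - 1 = 0 by omega] at this
  rw [← totalDegree_zero_iff_isHomogeneous, totalDegree_eq_zero_iff_eq_C] at h
  rw [h, pderiv_C]

lemma polyLaplacian_normSq_mul {d : ℕ} {q : MvPolynomial (Fin N) ℝ} (hq : q.IsHomogeneous d) :
    polyLaplacian N (polyNormSq N * q) =
      (2 * N + 4 * d : ℝ) • q + polyNormSq N * polyLaplacian N q := by
  have h1 : ∀ i : Fin N, pderiv i (pderiv i (polyNormSq N * q)) =
      2 * q + 4 * (X i * pderiv i q) + polyNormSq N * pderiv i (pderiv i q) := by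
    intro i
    have h2 : pderiv i (2 : MvPolynomial (Fin N) ℝ) = 0 := by
      rw [← map_ofNat (C : ℝ →+* MvPolynomial (Fin N) ℝ) 2, pderiv_C]
    simp only [pderiv_mul, map_add, pderiv_polyNormSq, h2, pderiv_X_self]
    ring
  rw [polyLaplacian_apply, polyLaplacian_apply, Finset.sum_congr rfl fun i _ => h1 i,
    Finset.sum_add_distrib, Finset.sum_add_distrib, ← Finset.mul_sum, ← Finset.mul_sum,
    ← Finset.mul_sum, hq.sum_X_mul_pderiv]
  simp only [Finset.sum_const, Finset.card_univ, Fintype.card_fin, smul_eq_C_mul, nsmul_eq_mul,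
    map_add, map_mul, map_ofNat, map_natCast]
  ring

/-- The identity `Δ(|x|^{2j+2} h) = 2 (j+1) (N + 2m + 2j) |x|^{2j} h` for `h` harmonic and
homogeneous of degree `m`. -/
lemma exists_polyLaplacian_normSq_pow (hN : 1 ≤ N) {m : ℕ} {h : MvPolynomial (Fin N) ℝ}
    (hh : h ∈ harmonicPoly N m) (j : ℕ) :
    ∃ c : ℝ, 0 < c ∧
      polyLaplacian N (polyNormSq N ^ (j + 1) * h) = c • (polyNormSq N ^ j * h) := by
  have hN' : (1 : ℝ) ≤ N := by exact_mod_cast hN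
  induction j with
  | zero =>
    refine ⟨2 * N + 4 * m, by positivity, ?_⟩
    simp [polyLaplacian_normSq_mul hh.1, (mem_harmonicPoly.1 hh).2]
  | succ j ih =>
    obtain ⟨c, hc, e⟩ := ih
    have hd : (polyNormSq N ^ (j + 1) * h).IsHomogeneous (2 * (j + 1) + m) :=
      (polyNormSq_isHomogeneous.pow (j + 1)).mul hh.1
    refine ⟨2 * N + 4 * (2 * (j + 1) + m : ℕ) + c, by positivity, ?_⟩
    rw [pow_succ' _ (j + 1), mul_assoc, polyLaplacian_normSq_mul hd, e]
    simp only [smul_eq_C_mul, map_add, map_mul]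
    ring

/-- The span of the products `|x|^{2j} h` of degree `k` with `h` homogeneous and harmonic. -/
noncomputable def harmonicSpan (N k : ℕ) : Submodule ℝ (MvPolynomial (Fin N) ℝ) :=
  Submodule.span ℝ {q | ∃ j m : ℕ, ∃ h ∈ harmonicPoly N m, m + 2 * j = k ∧
    q = polyNormSq N ^ j * h}

lemma harmonicSpan_le_homogeneous (N k : ℕ) :
    harmonicSpan N k ≤ homogeneousSubmodule (Fin N) ℝ k := by
  refine Submodule.span_le.2 ?_
  rintro _ ⟨j, m, h, hh, rfl, rfl⟩
  have := (polyNormSq_isHomogeneous.pow j).mul hh.1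
  rwa [add_comm] at this

/-- The Laplacian maps the span of degree `k + 2` onto the span of degree `k`. -/
lemma harmonicSpan_le_map_polyLaplacian (hN : 1 ≤ N) (k : ℕ) :
    harmonicSpan N k ≤ (harmonicSpan N (k + 2)).map (polyLaplacian N) := by
  refine Submodule.span_le.2 ?_
  rintro _ ⟨j, m, h, hh, rfl, rfl⟩
  obtain ⟨c, hc, e⟩ := exists_polyLaplacian_normSq_pow hN hh j
  refine ⟨c⁻¹ • (polyNormSq N ^ (j + 1) * h), Submodule.smul_mem _ _ (Submodule.subset_span
    ⟨j + 1, m, h, hh, by ring, rfl⟩), ?_⟩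
  rw [map_smul, e, smul_smul, inv_mul_cancel₀ hc.ne', one_smul]

/-- Every homogeneous polynomial is a combination of products `|x|^{2j} h` with `h` harmonic:
subtract from it a combination with the same Laplacian. -/
theorem homogeneous_le_harmonicSpan (hN : 1 ≤ N) (k : ℕ) :
    homogeneousSubmodule (Fin N) ℝ k ≤ harmonicSpan N k := by
  induction k using Nat.strong_induction_on with
  | _ k ih =>
    have harm : harmonicPoly N k ≤ harmonicSpan N k := fun h hh =>
      Submodule.subset_span ⟨0, k, h, hh, by simp, by simp⟩
    intro q hq
    rcases lt_or_ge k 2 with hk | hk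
    · exact harm (mem_harmonicPoly.2 ⟨hq, polyLaplacian_eq_zero_of_degree_lt_two hk hq⟩)
    · obtain ⟨l, rfl⟩ := Nat.exists_eq_add_of_le' hk
      have h1 : polyLaplacian N q ∈ harmonicSpan N l :=
        ih l (by omega) (polyLaplacian_isHomogeneous hq)
      obtain ⟨q', hq', e⟩ := harmonicSpan_le_map_polyLaplacian hN l h1
      have h2 : q - q' ∈ harmonicPoly N (l + 2) := mem_harmonicPoly.2
        ⟨Submodule.sub_mem _ hq (harmonicSpan_le_homogeneous N _ hq'), by rw [map_sub, e, sub_self]⟩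
      simpa using Submodule.add_mem _ (harm h2) hq'

instance finiteDimensional_homogeneousSubmodule (k : ℕ) :
    FiniteDimensional ℝ (homogeneousSubmodule (Fin N) ℝ k) :=
  Module.Finite.iff_fg.2 (homogeneousSubmodule_fg (Fin N) ℝ k)

instance finiteDimensional_harmonicPoly (k : ℕ) : FiniteDimensional ℝ (harmonicPoly N k) :=
  Submodule.finiteDimensional_of_le (S₂ := homogeneousSubmodule (Fin N) ℝ k) inf_le_left

lemma finrank_homogeneousSubmodule (k : ℕ) :
    Module.finrank ℝ (homogeneousSubmodule (Fin N) ℝ k) = (N + k - 1).choose k := by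
  classical
  have hs : {d : Fin N →₀ ℕ | d.degree = k}
      = ((Finset.finsuppAntidiag Finset.univ k : Finset (Fin N →₀ ℕ)) : Set (Fin N →₀ ℕ)) := by
    ext d
    simp [Finsupp.degree_eq_sum]
  rw [homogeneousSubmodule_eq_finsupp_supported, hs,
    (AddMonoidAlgebra.supportedEquivFinsupp _).finrank_eq, Module.finrank_finsupp_self]
  simp only [Fintype.card_coe, Finset.coe_sort_coe]
  rw [Finset.card_finsuppAntidiag_nat_eq_choose]
  simp

/-- The Laplacian is onto in every degree, and the harmonic polynomials are its kernel. -/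
lemma finrank_harmonicPoly_add_two (hN : 1 ≤ N) (k : ℕ) :
    Module.finrank ℝ (harmonicPoly N (k + 2)) + (N + k - 1).choose k
      = (N + (k + 2) - 1).choose (k + 2) := by
  set A := homogeneousSubmodule (Fin N) ℝ (k + 2)
  have hle : (A.map (polyLaplacian N)) = homogeneousSubmodule (Fin N) ℝ k := by
    apply le_antisymm
    · rintro _ ⟨q, hq, rfl⟩
      exact polyLaplacian_isHomogeneous hq
    · exact (homogeneous_le_harmonicSpan hN k).trans ((harmonicSpan_le_map_polyLaplacian hN k).trans
        (Submodule.map_mono (harmonicSpan_le_homogeneous N _)))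
  have h := LinearMap.finrank_range_add_finrank_ker ((polyLaplacian N).domRestrict A)
  rw [LinearMap.range_domRestrict, hle, finrank_homogeneousSubmodule,
    finrank_homogeneousSubmodule] at h
  have hk : Module.finrank ℝ (LinearMap.ker ((polyLaplacian N).domRestrict A))
      = Module.finrank ℝ (harmonicPoly N (k + 2)) := by
    rw [LinearMap.ker_domRestrict]
    refine LinearEquiv.finrank_eq ((Submodule.equivSubtypeMap A _).trans
      (LinearEquiv.ofEq _ _ ?_))
    rw [Submodule.map_comap_subtype]
    rfl
  rw [hk] at h
  omega

theorem finrank_harmonicPoly (hN : 2 ≤ N) {k : ℕ} (hk : 1 ≤ k) :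
    Module.finrank ℝ (harmonicPoly N k) = harmonicDim N k := by
  obtain ⟨n, rfl⟩ := Nat.exists_eq_add_of_le' hN
  rcases Nat.lt_or_ge k 2 with hk2 | hk2
  · obtain rfl : k = 1 := by omega
    have e : harmonicPoly (n + 2) 1 = homogeneousSubmodule (Fin (n + 2)) ℝ 1 :=
      inf_eq_left.2 fun q hq => polyLaplacian_eq_zero_of_degree_lt_two (by norm_num) hq
    rw [e, finrank_homogeneousSubmodule, harmonicDim]
    simp only [show n + 2 + 1 - 1 = n + 2 by omega, show n + 2 + 2 * 1 - 2 = n + 2 by omega,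
      show n + 2 + 1 - 3 = n by omega, show n + 2 - 2 = n by omega]
    rw [Nat.choose_one_right, Nat.factorial_one, mul_one,
      Nat.mul_div_cancel _ (Nat.factorial_pos n)]
  · obtain ⟨l, rfl⟩ := Nat.exists_eq_add_of_le' hk2
    have h := finrank_harmonicPoly_add_two (N := n + 2) (by omega) l
    rw [show n + 2 + l - 1 = n + 1 + l by omega,
      show n + 2 + (l + 2) - 1 = n + 1 + (l + 2) by omega] at h
    have h1 := Nat.add_choose_mul_factorial_mul_factorial (n + 1) l
    have h2 := Nat.add_choose_mul_factorial_mul_factorial (n + 1) (l + 2)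
    rw [harmonicDim, show n + 2 + 2 * (l + 2) - 2 = n + 2 * l + 4 by omega,
      show n + 2 + (l + 2) - 3 = n + l + 1 by omega, show n + 2 - 2 = n by omega]
    symm
    apply Nat.div_eq_of_eq_mul_left (by positivity)
    have pos : 0 < (n + 1) := by omega
    apply Nat.eq_of_mul_eq_mul_left pos
    rw [← h] at h2
    have f1 : (n + 1)! = (n + 1) * n ! := Nat.factorial_succ n
    have f2 : (l + 2)! = (l + 2) * ((l + 1) * l !) := by
      rw [Nat.factorial_succ, Nat.factorial_succ]
    have f3 : (n + 1 + (l + 2))! = (n + l + 3) * ((n + l + 2) * (n + l + 1)!) := by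
      rw [show n + 1 + (l + 2) = n + l + 3 by ring, Nat.factorial_succ, Nat.factorial_succ]
    have f4 : (n + 1 + l)! = (n + l + 1)! := by rw [show n + 1 + l = n + l + 1 by ring]
    rw [f3, f1, f2] at h2
    rw [f4, f1] at h1
    rw [f2]
    zify at h1 h2 ⊢
    linear_combination (((l : ℤ) + 2) * (l + 1)) * h1 - h2

end Harmonic

/-! ### The radial equation in the logarithmic variable -/

/-- The logistic function `e^τ / (1 + e^τ)`. -/
noncomputable def logistic (τ : ℝ) : ℝ := Real.exp τ / (1 + Real.exp τ)

lemma logistic_pos (τ : ℝ) : 0 < logistic τ := by unfold logistic; positivity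

lemma logistic_lt_one (τ : ℝ) : logistic τ < 1 := by
  unfold logistic
  rw [div_lt_one (by positivity)]
  linarith

lemma hasDerivAt_logistic (τ : ℝ) :
    HasDerivAt logistic (logistic τ * (1 - logistic τ)) τ := by
  have h := (Real.hasDerivAt_exp τ).div ((Real.hasDerivAt_exp τ).const_add 1)
    (by positivity : 1 + Real.exp τ ≠ 0)
  refine h.congr_deriv ?_
  unfold logistic
  field_simp

lemma tendsto_logistic_atBot : Tendsto logistic atBot (𝓝 0) := by
  have h := Real.tendsto_exp_atBot.div (Real.tendsto_exp_atBot.const_add 1) (by norm_num)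
  rw [zero_div] at h
  exact h

lemma tendsto_logistic_atTop : Tendsto logistic atTop (𝓝 1) := by
  have e : logistic = fun τ => 1 - logistic (-τ) := by
    funext τ
    unfold logistic
    rw [Real.exp_neg]
    field_simp
    ring
  rw [e]
  simpa using (tendsto_logistic_atBot.comp tendsto_neg_atTop_atBot).const_sub 1

/-- The weight `ω` of the radial equation. For `β = (N+α)/(p+α)` it is `r^{N-2} |∇U|^{p-2}`, up to
a constant factor, in the variable `τ = log r^{(p+α)/(p-1)}`. -/
noncomputable def modeWeight (p β τ : ℝ) : ℝ :=
  Real.exp ((β * (p - 1) - 1) * τ) * (1 + Real.exp τ) ^ (-(β * (p - 2)))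

/-- The logarithmic derivative of the weight `ω`. -/
noncomputable def modeDrift (p β τ : ℝ) : ℝ := β * (p - 1) - 1 - β * (p - 2) * logistic τ

lemma modeWeight_pos (p β τ : ℝ) : 0 < modeWeight p β τ := by unfold modeWeight; positivity

lemma hasDerivAt_one_add_exp_rpow (c τ : ℝ) :
    HasDerivAt (fun τ => (1 + Real.exp τ) ^ c) (c * logistic τ * (1 + Real.exp τ) ^ c) τ := by
  have h := ((Real.hasDerivAt_exp τ).const_add 1).rpow_const (p := c)
    (Or.inl (by positivity : 1 + Real.exp τ ≠ 0))
  refine h.congr_deriv ?_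
  rw [Real.rpow_sub_one (by positivity : 1 + Real.exp τ ≠ 0), logistic]
  ring

lemma hasDerivAt_exp_const_mul (c τ : ℝ) :
    HasDerivAt (fun τ => Real.exp (c * τ)) (c * Real.exp (c * τ)) τ := by
  simpa [mul_comm] using ((hasDerivAt_id τ).const_mul c).exp

lemma hasDerivAt_modeWeight (p β τ : ℝ) :
    HasDerivAt (modeWeight p β) (modeDrift p β τ * modeWeight p β τ) τ := by
  have h := (hasDerivAt_exp_const_mul (β * (p - 1) - 1) τ).mul
    (hasDerivAt_one_add_exp_rpow (-(β * (p - 2))) τ)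
  refine h.congr_deriv ?_
  unfold modeDrift modeWeight
  ring

/-- `f`, with derivative `g`, solves `(ω f')' = ω (Λ - (β²(p-1)+β) e^τ/(1+e^τ)²) f`. The equation
is divided by `ω`, and `e^τ/(1+e^τ)²` is written `z (1 - z)` with `z` the logistic function. -/
structure IsModeSolution (p β Λ : ℝ) (f g : ℝ → ℝ) : Prop where
  hasDerivAt : ∀ τ, HasDerivAt f (g τ) τ
  hasDerivAt_deriv : ∀ τ, HasDerivAt g (-(modeDrift p β τ) * g τ
    + (Λ - (β ^ 2 * (p - 1) + β) * (logistic τ * (1 - logistic τ))) * f τ) τ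

lemma IsModeSolution.neg {p β Λ : ℝ} {f g : ℝ → ℝ} (h : IsModeSolution p β Λ f g) :
    IsModeSolution p β Λ (-f) (-g) := by
  refine ⟨fun τ => (h.1 τ).neg, fun τ => ?_⟩
  refine (h.2 τ).neg.congr_deriv ?_
  simp only [Pi.neg_apply]
  ring

lemma monotoneOn_Iic_of_hasDerivAt_nonneg {F F' : ℝ → ℝ} {T : ℝ}
    (h : ∀ τ, HasDerivAt F (F' τ) τ) (h0 : ∀ τ ≤ T, 0 ≤ F' τ) : MonotoneOn F (Set.Iic T) := by
  refine monotoneOn_of_hasDerivWithinAt_nonneg (f' := F') (convex_Iic T)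
    (fun τ _ => (h τ).continuousAt.continuousWithinAt) (fun τ _ => (h τ).hasDerivWithinAt) ?_
  intro τ hτ
  exact h0 τ (interior_subset (s := Set.Iic T) hτ)

lemma monotoneOn_Ici_of_hasDerivAt_nonneg {F F' : ℝ → ℝ} {T : ℝ}
    (h : ∀ τ, HasDerivAt F (F' τ) τ) (h0 : ∀ τ, T ≤ τ → 0 ≤ F' τ) :
    MonotoneOn F (Set.Ici T) := by
  refine monotoneOn_of_hasDerivWithinAt_nonneg (f' := F') (convex_Ici T)
    (fun τ _ => (h τ).continuousAt.continuousWithinAt) (fun τ _ => (h τ).hasDerivWithinAt) ?_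
  intro τ hτ
  exact h0 τ (interior_subset (s := Set.Ici T) hτ)

section Rigidity

variable {p β Λ : ℝ} {f g : ℝ → ℝ}

lemma eventually_potential_le {l : Filter ℝ} {c : ℝ} (hc : c * (1 - c) = 0)
    (hl : Tendsto logistic l (𝓝 c)) (hΛ : 0 < Λ) (K : ℝ) :
    ∀ᶠ τ in l, K * (logistic τ * (1 - logistic τ)) ≤ Λ / 2 := by
  have h : Tendsto (fun τ => K * (logistic τ * (1 - logistic τ))) l (𝓝 (K * (c * (1 - c)))) :=
    (hl.mul (hl.const_sub 1)).const_mul K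
  rw [hc, mul_zero] at h
  filter_upwards [h.eventually (gt_mem_nhds (by positivity : 0 < Λ / 2))] with τ hτ using hτ.le

lemma exists_potential_le_atBot (hΛ : 0 < Λ) (K : ℝ) :
    ∃ T, ∀ τ ≤ T, K * (logistic τ * (1 - logistic τ)) ≤ Λ / 2 :=
  eventually_atBot.1 (eventually_potential_le (by norm_num) tendsto_logistic_atBot hΛ K)

lemma exists_potential_le_atTop (hΛ : 0 < Λ) (K : ℝ) :
    ∃ T, ∀ τ, T ≤ τ → K * (logistic τ * (1 - logistic τ)) ≤ Λ / 2 :=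
  eventually_atTop.1 (eventually_potential_le (by norm_num) tendsto_logistic_atTop hΛ K)

lemma IsModeSolution.hasDerivAt_flux (h : IsModeSolution p β Λ f g) (τ : ℝ) :
    HasDerivAt (fun τ => modeWeight p β τ * g τ)
      (modeWeight p β τ * ((Λ - (β ^ 2 * (p - 1) + β) * (logistic τ * (1 - logistic τ))) * f τ))
      τ := by
  refine ((hasDerivAt_modeWeight p β τ).mul (h.2 τ)).congr_deriv ?_
  ring

/-- The energy identity `(ω f f')' = ω (f'² + (Λ - V) f²)`. -/
lemma IsModeSolution.hasDerivAt_energy (h : IsModeSolution p β Λ f g) (τ : ℝ) :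
    HasDerivAt (fun τ => modeWeight p β τ * g τ * f τ)
      (modeWeight p β τ * (g τ ^ 2 +
        (Λ - (β ^ 2 * (p - 1) + β) * (logistic τ * (1 - logistic τ))) * f τ ^ 2)) τ := by
  refine ((h.hasDerivAt_flux τ).mul (h.1 τ)).congr_deriv ?_
  ring

/-- Near `-∞` the function `ω f f'` is nondecreasing. So it is either nonnegative there or negative
from some point on towards `-∞`, and `|f|` is then strictly decreasing. -/
lemma IsModeSolution.sign_atBot (h : IsModeSolution p β Λ f g) (hΛ : 0 < Λ) :
    (∃ T, ∀ τ ≤ T, 0 ≤ f τ * g τ) ∨ ∃ T, ∀ τ ≤ T, f τ * g τ < 0 := by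
  obtain ⟨T, hT⟩ := exists_potential_le_atBot hΛ (β ^ 2 * (p - 1) + β)
  by_cases hg : ∀ τ ≤ T, 0 ≤ f τ * g τ
  · exact Or.inl ⟨T, hg⟩
  · right
    push Not at hg
    obtain ⟨T', hT', hneg⟩ := hg
    refine ⟨T', fun τ hτ => ?_⟩
    have mono := monotoneOn_Iic_of_hasDerivAt_nonneg (T := T) h.hasDerivAt_energy (fun τ hτ => by
      have := hT τ hτ
      have := modeWeight_pos p β τ
      have : 0 ≤ (Λ - (β ^ 2 * (p - 1) + β) * (logistic τ * (1 - logistic τ))) :=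
        by linarith
      positivity)
    have h1 := mono (hτ.trans hT') hT' hτ
    have h2 : modeWeight p β T' * (f T' * g T') < 0 :=
      mul_neg_of_pos_of_neg (modeWeight_pos p β T') hneg
    have h3 : modeWeight p β τ * (f τ * g τ) < 0 := by
      simp only at h1
      nlinarith
    exact (pos_iff_neg_of_mul_neg h3).1 (modeWeight_pos p β τ)

lemma IsModeSolution.sign_atTop (h : IsModeSolution p β Λ f g) (hΛ : 0 < Λ) :
    (∃ T, ∀ τ, T ≤ τ → f τ * g τ ≤ 0) ∨ ∃ T, ∀ τ, T ≤ τ → 0 < f τ * g τ := by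
  obtain ⟨T, hT⟩ := exists_potential_le_atTop hΛ (β ^ 2 * (p - 1) + β)
  by_cases hg : ∀ τ, T ≤ τ → f τ * g τ ≤ 0
  · exact Or.inl ⟨T, hg⟩
  · right
    push Not at hg
    obtain ⟨T', hT', hpos⟩ := hg
    refine ⟨T', fun τ hτ => ?_⟩
    have mono := monotoneOn_Ici_of_hasDerivAt_nonneg (T := T) h.hasDerivAt_energy (fun τ hτ => by
      have := hT τ hτ
      have := modeWeight_pos p β τ
      have : 0 ≤ (Λ - (β ^ 2 * (p - 1) + β) * (logistic τ * (1 - logistic τ))) :=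
        by linarith
      positivity)
    have h1 := mono hT' (hT'.trans hτ) hτ
    have h2 : 0 < modeWeight p β T' * (f T' * g T') := mul_pos (modeWeight_pos p β T') hpos
    have h3 : 0 < modeWeight p β τ * (f τ * g τ) := by
      simp only at h1
      nlinarith
    exact (pos_iff_pos_of_mul_pos h3).1 (modeWeight_pos p β τ)

lemma energy_lower {w F G V δ : ℝ} (hw : 0 < w) (hΛ : 0 < Λ) (hV : V ≤ Λ / 2)
    (hδ : δ < w * (F ^ 2 + G ^ 2)) :
    min 1 (Λ / 2) * δ ≤ w * (G ^ 2 + (Λ - V) * F ^ 2) := by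
  have hm : 0 < min 1 (Λ / 2) := lt_min one_pos (by positivity)
  have h1 : min 1 (Λ / 2) * G ^ 2 ≤ G ^ 2 := by
    nlinarith [min_le_left 1 (Λ / 2), sq_nonneg G]
  have h2 : min 1 (Λ / 2) * F ^ 2 ≤ (Λ - V) * F ^ 2 :=
    mul_le_mul_of_nonneg_right ((min_le_right 1 (Λ / 2)).trans (by linarith)) (sq_nonneg F)
  calc min 1 (Λ / 2) * δ ≤ min 1 (Λ / 2) * (w * (F ^ 2 + G ^ 2)) :=
        mul_le_mul_of_nonneg_left hδ.le hm.le
    _ = w * (min 1 (Λ / 2) * G ^ 2 + min 1 (Λ / 2) * F ^ 2) := by ring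
    _ ≤ _ := mul_le_mul_of_nonneg_left (add_le_add h1 h2) hw.le

/-- If `ω f f'` is nonnegative near `-∞` then, being monotone there, it has an integrable
derivative, so the energy density comes arbitrarily close to zero. -/
lemma IsModeSolution.exists_small_atBot (h : IsModeSolution p β Λ f g) (hΛ : 0 < Λ)
    (hgood : ∃ T, ∀ τ ≤ T, 0 ≤ f τ * g τ) {δ : ℝ} (hδ : 0 < δ) (T₁ : ℝ) :
    ∃ τ ≤ T₁, modeWeight p β τ * (f τ ^ 2 + g τ ^ 2) ≤ δ := by
  obtain ⟨T, hT⟩ := exists_potential_le_atBot hΛ (β ^ 2 * (p - 1) + β)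
  obtain ⟨T', hT'⟩ := hgood
  by_contra! hcon
  set S := min T₁ (min T T') with hS
  set c := min 1 (Λ / 2) * δ with hc
  have hm : 0 < min 1 (Λ / 2) := lt_min one_pos (by positivity)
  have hc0 : 0 < c := mul_pos hm hδ
  have mono := monotoneOn_Iic_of_hasDerivAt_nonneg (T := S)
    (fun τ => (h.hasDerivAt_energy τ).sub ((hasDerivAt_id τ).const_mul c)) (fun τ hτ => by
      have e1 := hcon τ (hτ.trans (min_le_left _ _))
      have e2 := hT τ (hτ.trans ((min_le_right _ _).trans (min_le_left _ _)))
      have := energy_lower (modeWeight_pos p β τ) hΛ e2 e1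
      linarith)
  set E := modeWeight p β S * g S * f S with hE
  have hτ : S - (|E| + 1) / c ≤ S := by
    have : 0 ≤ (|E| + 1) / c := by positivity
    linarith
  have h1 := mono hτ (le_refl S) hτ
  have h2 := hT' _ (hτ.trans ((min_le_right _ _).trans (min_le_right _ _)))
  have h3 := mul_nonneg (modeWeight_pos p β (S - (|E| + 1) / c)).le h2
  simp only [Pi.sub_apply, id] at h1
  have h4 : c * (S - (|E| + 1) / c) = c * S - (|E| + 1) := by field_simp
  rw [h4] at h1
  nlinarith [le_abs_self E]

lemma IsModeSolution.exists_small_atTop (h : IsModeSolution p β Λ f g) (hΛ : 0 < Λ)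
    (hgood : ∃ T, ∀ τ, T ≤ τ → f τ * g τ ≤ 0) {δ : ℝ} (hδ : 0 < δ) (T₁ : ℝ) :
    ∃ τ, T₁ ≤ τ ∧ modeWeight p β τ * (f τ ^ 2 + g τ ^ 2) ≤ δ := by
  obtain ⟨T, hT⟩ := exists_potential_le_atTop hΛ (β ^ 2 * (p - 1) + β)
  obtain ⟨T', hT'⟩ := hgood
  by_contra! hcon
  set S := max T₁ (max T T') with hS
  set c := min 1 (Λ / 2) * δ with hc
  have hm : 0 < min 1 (Λ / 2) := lt_min one_pos (by positivity)
  have hc0 : 0 < c := mul_pos hm hδ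
  have mono := monotoneOn_Ici_of_hasDerivAt_nonneg (T := S)
    (fun τ => (h.hasDerivAt_energy τ).sub ((hasDerivAt_id τ).const_mul c)) (fun τ hτ => by
      have e1 := hcon τ ((le_max_left _ _).trans hτ)
      have e2 := hT τ (((le_max_left _ _).trans (le_max_right _ _)).trans hτ)
      have := energy_lower (modeWeight_pos p β τ) hΛ e2 e1
      linarith)
  set E := modeWeight p β S * g S * f S with hE
  have hτ : S ≤ S + (|E| + 1) / c := by
    have : 0 ≤ (|E| + 1) / c := by positivity
    linarith
  have h1 := mono (le_refl S) hτ hτ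
  have h2 := hT' _ (((le_max_right _ _).trans (le_max_right _ _)).trans hτ)
  have h3 := mul_nonneg_of_nonpos_of_nonpos
    (neg_nonpos.2 (modeWeight_pos p β (S + (|E| + 1) / c)).le) h2
  simp only [Pi.sub_apply, id] at h1
  have h4 : c * (S + (|E| + 1) / c) = c * S + (|E| + 1) := by field_simp
  rw [h4] at h1
  nlinarith [neg_abs_le E]

/-- The multiple `m = f' + (β z - 1/p) f` of the derivative of the quotient of `f` by the
explicit positive solution; it vanishes exactly on the multiples of that solution. -/
noncomputable def modeQuot (p β : ℝ) (f g : ℝ → ℝ) (τ : ℝ) : ℝ :=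
  g τ + (β * logistic τ - 1 / p) * f τ

/-- `n = m' + (β - 1) z m`, with the second derivative of `f` eliminated by the equation. -/
noncomputable def modeQuotDeriv (p β Λ : ℝ) (f g : ℝ → ℝ) (τ : ℝ) : ℝ :=
  (-(modeDrift p β τ) + (β * logistic τ - 1 / p) + (β - 1) * logistic τ) * g τ
    + (Λ - (β ^ 2 * (p - 1) + β) * (logistic τ * (1 - logistic τ))
      + β * (logistic τ * (1 - logistic τ))
      + (β - 1) * logistic τ * (β * logistic τ - 1 / p)) * f τ

lemma IsModeSolution.hasDerivAt_quot (h : IsModeSolution p β Λ f g) (τ : ℝ) :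
    HasDerivAt (modeQuot p β f g)
      (modeQuotDeriv p β Λ f g τ - (β - 1) * logistic τ * modeQuot p β f g τ) τ := by
  have h1 := (h.2 τ).add ((((hasDerivAt_logistic τ).const_mul β).sub_const (1 / p)).mul (h.1 τ))
  refine h1.congr_deriv ?_
  unfold modeQuotDeriv modeQuot
  ring

/-- Up to a positive factor, `m` solves an equation whose zeroth order coefficient is the
constant `Λ`. This is what makes the maximum principle available. -/
lemma IsModeSolution.hasDerivAt_quotDeriv (h : IsModeSolution p β Λ f g) (hp : p ≠ 0) (τ : ℝ) :
    HasDerivAt (modeQuotDeriv p β Λ f g)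
      (-(β * (p - 1) - 1 + (1 + β - β * p) * logistic τ) * modeQuotDeriv p β Λ f g τ
        + Λ * modeQuot p β f g τ) τ := by
  have hz := hasDerivAt_logistic τ
  have hd : HasDerivAt (modeDrift p β) (-(β * (p - 2) * (logistic τ * (1 - logistic τ)))) τ := by
    exact (hz.const_mul (β * (p - 2))).const_sub (β * (p - 1) - 1)
  have hzz := hz.mul (hz.const_sub 1)
  have hb := (hz.const_mul β).sub_const (1 / p)
  have h1 := (((hd.neg.add hb).add (hz.const_mul (β - 1))).mul (h.2 τ)).add
    (((((hzz.const_mul (β ^ 2 * (p - 1) + β)).const_sub Λ).add (hzz.const_mul β)).add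
      ((hz.const_mul (β - 1)).mul hb)).mul (h.1 τ))
  refine h1.congr_deriv ?_
  unfold modeQuotDeriv modeQuot modeDrift
  simp only [Pi.add_apply, Pi.neg_apply, Pi.mul_apply]
  field_simp
  ring

/-- The energy identity `(ω m n)' = ω (n² + Λ m²)`. Unlike the one for `f`, its right-hand side is
nonnegative on the whole line. -/
lemma IsModeSolution.hasDerivAt_quot_energy (h : IsModeSolution p β Λ f g) (hp : p ≠ 0) (τ : ℝ) :
    HasDerivAt (fun τ => modeWeight p β τ * modeQuot p β f g τ * modeQuotDeriv p β Λ f g τ)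
      (modeWeight p β τ * (modeQuotDeriv p β Λ f g τ ^ 2 + Λ * modeQuot p β f g τ ^ 2)) τ := by
  have h1 := ((hasDerivAt_modeWeight p β τ).mul (h.hasDerivAt_quot τ)).mul
    (h.hasDerivAt_quotDeriv hp τ)
  refine h1.congr_deriv ?_
  unfold modeDrift
  simp only [Pi.mul_apply]
  ring

/-- `m` and `n` are linear in `f` and `f'` with bounded coefficients. -/
lemma exists_quot_energy_le (p β Λ : ℝ) : ∃ C, 0 < C ∧ ∀ (f g : ℝ → ℝ) (τ : ℝ),
    |modeWeight p β τ * modeQuot p β f g τ * modeQuotDeriv p β Λ f g τ|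
      ≤ C * (modeWeight p β τ * (f τ ^ 2 + g τ ^ 2)) := by
  obtain ⟨A, hA⟩ := isCompact_Icc.exists_bound_of_continuousOn (s := Set.Icc (0 : ℝ) 1)
    (f := fun z : ℝ => β * z - 1 / p) (by fun_prop)
  obtain ⟨B, hB⟩ := isCompact_Icc.exists_bound_of_continuousOn (s := Set.Icc (0 : ℝ) 1)
    (f := fun z : ℝ => -(β * (p - 1) - 1 - β * (p - 2) * z) + (β * z - 1 / p) + (β - 1) * z)
    (by fun_prop)
  obtain ⟨D, hD⟩ := isCompact_Icc.exists_bound_of_continuousOn (s := Set.Icc (0 : ℝ) 1)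
    (f := fun z : ℝ => Λ - (β ^ 2 * (p - 1) + β) * (z * (1 - z)) + β * (z * (1 - z))
      + (β - 1) * z * (β * z - 1 / p)) (by fun_prop)
  set M := 1 + |A| + |B| + |D| with hM
  have hM0 : 0 < M := by positivity
  refine ⟨2 * M ^ 2, by positivity, fun f g τ => ?_⟩
  have hz : logistic τ ∈ Set.Icc (0 : ℝ) 1 := ⟨(logistic_pos τ).le, (logistic_lt_one τ).le⟩
  have hA' := (hA _ hz).trans (le_abs_self A)
  have hB' := (hB _ hz).trans (le_abs_self B)
  have hD' := (hD _ hz).trans (le_abs_self D)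
  rw [Real.norm_eq_abs] at hA' hB' hD'
  have hf := abs_nonneg (f τ)
  have hg := abs_nonneg (g τ)
  have h1 : |modeQuot p β f g τ| ≤ M * (|f τ| + |g τ|) := by
    unfold modeQuot
    refine (abs_add_le _ _).trans ?_
    rw [abs_mul]
    have : |β * logistic τ - 1 / p| * |f τ| ≤ M * |f τ| :=
      mul_le_mul_of_nonneg_right (by linarith [abs_nonneg B, abs_nonneg D]) hf
    nlinarith [abs_nonneg A, abs_nonneg B, abs_nonneg D]
  have h2 : |modeQuotDeriv p β Λ f g τ| ≤ M * (|f τ| + |g τ|) := by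
    unfold modeQuotDeriv modeDrift
    refine (abs_add_le _ _).trans ?_
    rw [abs_mul, abs_mul]
    have e1 := mul_le_mul_of_nonneg_right
      (hB'.trans (by linarith [abs_nonneg A, abs_nonneg D] : |B| ≤ M)) hg
    have e2 := mul_le_mul_of_nonneg_right
      (hD'.trans (by linarith [abs_nonneg A, abs_nonneg B] : |D| ≤ M)) hf
    linarith
  have hw := modeWeight_pos p β τ
  rw [abs_mul, abs_mul, abs_of_pos hw, mul_assoc]
  have h3 := mul_le_mul h1 h2 (abs_nonneg _) (by positivity)
  have h4 : M * (|f τ| + |g τ|) * (M * (|f τ| + |g τ|)) ≤ 2 * M ^ 2 * (f τ ^ 2 + g τ ^ 2) := by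
    have : (|f τ| + |g τ|) ^ 2 ≤ 2 * (f τ ^ 2 + g τ ^ 2) := by
      rw [← sq_abs (f τ), ← sq_abs (g τ)]
      nlinarith [sq_nonneg (|f τ| - |g τ|)]
    nlinarith [mul_le_mul_of_nonneg_left this (sq_nonneg M)]
  calc modeWeight p β τ * (|modeQuot p β f g τ| * |modeQuotDeriv p β Λ f g τ|)
      ≤ modeWeight p β τ * (2 * M ^ 2 * (f τ ^ 2 + g τ ^ 2)) :=
        mul_le_mul_of_nonneg_left (h3.trans h4) hw.le
    _ = _ := by ring

/-- A solution with the right signs at both ends is a multiple of the explicit positive one: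
`ω m n` is monotone and comes arbitrarily close to zero at both ends. -/
theorem IsModeSolution.quot_eq_zero (h : IsModeSolution p β Λ f g) (hp : p ≠ 0) (hΛ : 0 < Λ)
    (hbot : ∃ T, ∀ τ ≤ T, 0 ≤ f τ * g τ) (htop : ∃ T, ∀ τ, T ≤ τ → f τ * g τ ≤ 0) (τ : ℝ) :
    modeQuot p β f g τ = 0 := by
  obtain ⟨C, hC, hJ⟩ := exists_quot_energy_le p β Λ
  set J := fun τ => modeWeight p β τ * modeQuot p β f g τ * modeQuotDeriv p β Λ f g τ with hJdef
  have hd := h.hasDerivAt_quot_energy hp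
  have hd0 : ∀ τ, 0 ≤ modeWeight p β τ *
      (modeQuotDeriv p β Λ f g τ ^ 2 + Λ * modeQuot p β f g τ ^ 2) := fun τ => by
    have := modeWeight_pos p β τ
    positivity
  have mono : Monotone J := monotone_of_hasDerivAt_nonneg hd hd0
  have hJ0 : ∀ s, J s = 0 := by
    intro s
    apply le_antisymm
    · refine le_of_forall_pos_le_add fun δ hδ => ?_
      obtain ⟨s', hs', e⟩ := h.exists_small_atTop hΛ htop (div_pos hδ hC) s
      have h1 := (le_abs_self _).trans (hJ f g s')
      have h2 := mul_le_mul_of_nonneg_left e hC.le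
      rw [mul_div_cancel₀ _ hC.ne'] at h2
      linarith [mono hs', h1.trans h2]
    · refine le_of_forall_pos_le_add fun δ hδ => ?_
      obtain ⟨s', hs', e⟩ := h.exists_small_atBot hΛ hbot (div_pos hδ hC) s
      have h1 := (neg_le_abs _).trans (hJ f g s')
      have h2 := mul_le_mul_of_nonneg_left e hC.le
      rw [mul_div_cancel₀ _ hC.ne'] at h2
      linarith [mono hs', h1.trans h2]
  have hJc : J = fun _ => 0 := funext hJ0
  have h1 := (hd τ).unique (by
    change HasDerivAt J 0 τ
    rw [hJc]
    exact hasDerivAt_const τ 0)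
  have hw := modeWeight_pos p β τ
  have h2 : modeQuotDeriv p β Λ f g τ ^ 2 + Λ * modeQuot p β f g τ ^ 2 = 0 :=
    (mul_eq_zero.1 h1).resolve_left hw.ne'
  have h3 : Λ * modeQuot p β f g τ ^ 2 = 0 := by
    nlinarith [sq_nonneg (modeQuotDeriv p β Λ f g τ),
      mul_nonneg hΛ.le (sq_nonneg (modeQuot p β f g τ))]
  exact pow_eq_zero_iff two_ne_zero |>.1 ((mul_eq_zero.1 h3).resolve_left hΛ.ne')

/-- The explicit positive solution `e^{τ/p} (1 + e^τ)^{-β}` of the radial equation. -/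
noncomputable def groundMode (p β τ : ℝ) : ℝ :=
  Real.exp (1 / p * τ) * (1 + Real.exp τ) ^ (-β)

lemma groundMode_pos (p β τ : ℝ) : 0 < groundMode p β τ := by unfold groundMode; positivity

lemma hasDerivAt_groundMode (p β τ : ℝ) :
    HasDerivAt (groundMode p β) ((1 / p - β * logistic τ) * groundMode p β τ) τ := by
  have h := (hasDerivAt_exp_const_mul (1 / p) τ).mul (hasDerivAt_one_add_exp_rpow (-β) τ)
  refine h.congr_deriv ?_
  unfold groundMode
  ring

lemma groundMode_isModeSolution (hp : p ≠ 0) :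
    IsModeSolution p β ((p - 1) / p * (β - 1 / p)) (groundMode p β)
      (fun τ => (1 / p - β * logistic τ) * groundMode p β τ) := by
  refine ⟨hasDerivAt_groundMode p β, fun τ => ?_⟩
  have h := (((hasDerivAt_logistic τ).const_mul β).const_sub (1 / p)).mul
    (hasDerivAt_groundMode p β τ)
  refine h.congr_deriv ?_
  unfold modeDrift
  field_simp
  ring

lemma IsModeSolution.eq_groundMode (h : IsModeSolution p β Λ f g)
    (hm : ∀ τ, modeQuot p β f g τ = 0) : ∃ c, ∀ τ, f τ = c * groundMode p β τ := by
  have hd : ∀ τ, HasDerivAt (fun τ => f τ / groundMode p β τ) 0 τ := by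
    intro τ
    have h1 := (h.1 τ).div (hasDerivAt_groundMode p β τ) (groundMode_pos p β τ).ne'
    refine h1.congr_deriv ?_
    have := hm τ
    unfold modeQuot at this
    rw [show g τ = (1 / p - β * logistic τ) * f τ by linarith]
    ring_nf
  refine ⟨f 0 / groundMode p β 0, fun τ => ?_⟩
  have := is_const_of_deriv_eq_zero (f := fun τ => f τ / groundMode p β τ)
    (fun τ => (hd τ).differentiableAt) (fun τ => (hd τ).deriv) τ 0
  rw [← this, div_mul_cancel₀ _ (groundMode_pos p β τ).ne']

/-- The relation `m = 0` determines `f''` in terms of `f`, which is compatible with the equation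
for one value of `Λ` only. -/
lemma IsModeSolution.eq_zero_of_ne (h : IsModeSolution p β Λ f g) (hp : p ≠ 0)
    (hm : ∀ τ, modeQuot p β f g τ = 0) (hΛ : Λ ≠ (p - 1) / p * (β - 1 / p)) (τ : ℝ) :
    f τ = 0 := by
  have h1 := (h.hasDerivAt_quot τ).unique (by
    rw [show modeQuot p β f g = fun _ => 0 from funext hm]
    exact hasDerivAt_const τ 0)
  have h2 := hm τ
  unfold modeQuot at h2
  have h3 : g τ = (1 / p - β * logistic τ) * f τ := by linarith
  rw [hm τ] at h1
  unfold modeQuotDeriv modeDrift at h1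
  rw [h3] at h1
  have h4 : (Λ - (p - 1) / p * (β - 1 / p)) * f τ = 0 := by
    rw [← h1]
    field_simp
    ring
  exact (mul_eq_zero.1 h4).resolve_left (sub_ne_zero.2 hΛ)

end Rigidity

/-! ### Behaviour of the radial solutions at the two ends -/

/-- A fixed smooth nonnegative function on the line with integral one, supported in `[-1, 1]`. -/
noncomputable def bumpFn : ℝ → ℝ :=
  (⟨1 / 2, 1, by norm_num, by norm_num⟩ : ContDiffBump (0 : ℝ)).normed volume

lemma contDiff_bumpFn : ContDiff ℝ ∞ bumpFn := ContDiffBump.contDiff_normed _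

lemma bumpFn_nonneg (τ : ℝ) : 0 ≤ bumpFn τ := ContDiffBump.nonneg_normed _ _

lemma bumpFn_eq_zero {τ : ℝ} (h : 1 ≤ |τ|) : bumpFn τ = 0 := by
  have h1 : τ ∉ Function.support bumpFn := by
    unfold bumpFn
    rw [ContDiffBump.support_normed_eq]
    simpa using h
  simpa using h1

lemma hasCompactSupport_bumpFn : HasCompactSupport bumpFn :=
  ContDiffBump.hasCompactSupport_normed _

lemma integral_bumpFn : ∫ τ, bumpFn τ = 1 := ContDiffBump.integral_normed _

lemma exists_bumpFn_le : ∃ M, 0 < M ∧ ∀ τ, bumpFn τ ≤ M := by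
  obtain ⟨M, hM⟩ := hasCompactSupport_bumpFn.exists_bound_of_continuous contDiff_bumpFn.continuous
  exact ⟨|M| + 1, by positivity, fun τ => (le_abs_self _).trans
    ((hM τ).trans ((le_abs_self M).trans (by linarith)))⟩

lemma contDiff_bumpFn_add (σ : ℝ) : ContDiff ℝ ∞ fun τ => bumpFn (τ + σ) :=
  contDiff_bumpFn.comp (contDiff_id.add contDiff_const)

lemma hasCompactSupport_bumpFn_add (σ : ℝ) : HasCompactSupport fun τ => bumpFn (τ + σ) :=
  hasCompactSupport_bumpFn.comp_homeomorph (Homeomorph.addRight σ)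

lemma bumpFn_add_eq_zero {σ τ : ℝ} (h : τ ∉ Set.Icc (-σ - 1) (-σ + 1)) : bumpFn (τ + σ) = 0 := by
  refine bumpFn_eq_zero ?_
  by_contra! hc
  rw [abs_lt] at hc
  exact h ⟨by linarith, by linarith⟩

lemma integrable_bumpFn_add_mul (σ : ℝ) {F : ℝ → ℝ} (hF : Continuous F) :
    Integrable fun τ => bumpFn (τ + σ) * F τ :=
  ((contDiff_bumpFn_add σ).continuous.mul hF).integrable_of_hasCompactSupport
    (hasCompactSupport_bumpFn_add σ).mul_right

lemma integral_bumpFn_add_mul_const (σ c : ℝ) : ∫ τ, bumpFn (τ + σ) * c = c := by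
  rw [integral_mul_const, integral_add_right_eq_self (fun τ => bumpFn τ), integral_bumpFn, one_mul]

lemma le_integral_bumpFn_add_mul {σ c : ℝ} {F : ℝ → ℝ} (hF : Continuous F)
    (h : ∀ τ ∈ Set.Icc (-σ - 1) (-σ + 1), c ≤ F τ) :
    c ≤ ∫ τ, bumpFn (τ + σ) * F τ := by
  rw [← integral_bumpFn_add_mul_const σ c]
  refine integral_mono (integrable_bumpFn_add_mul σ continuous_const)
    (integrable_bumpFn_add_mul σ hF) fun τ => ?_
  by_cases hτ : τ ∈ Set.Icc (-σ - 1) (-σ + 1)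
  · exact mul_le_mul_of_nonneg_left (h τ hτ) (bumpFn_nonneg _)
  · simp [bumpFn_add_eq_zero hτ]

/-- In the mean, `f` is at most of the order of `e^{-δ τ}`, at both ends of the line. -/
def MeanBound (δ : ℝ) (f : ℝ → ℝ) : Prop :=
  ∃ C, 0 ≤ C ∧ ∀ (σ M : ℝ) (η : ℝ → ℝ), Continuous η → (∀ τ, |η τ| ≤ M) →
    (∀ τ ∉ Set.Icc (-σ - 1) (-σ + 1), η τ = 0) → |∫ τ, f τ * η τ| ≤ C * Real.exp (δ * σ) * M

lemma MeanBound.neg {δ : ℝ} {f : ℝ → ℝ} (h : MeanBound δ f) : MeanBound δ (-f) := by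
  obtain ⟨C, hC, hb⟩ := h
  refine ⟨C, hC, fun σ M η h1 h2 h3 => ?_⟩
  simpa [integral_neg] using hb σ M η h1 h2 h3

lemma MeanBound.exists_bump_le {δ : ℝ} {f : ℝ → ℝ} (h : MeanBound δ f) :
    ∃ C, 0 ≤ C ∧ ∀ σ, ∫ τ, bumpFn (τ + σ) * f τ ≤ C * Real.exp (δ * σ) := by
  obtain ⟨C, hC, hb⟩ := h
  obtain ⟨M, hM, hle⟩ := exists_bumpFn_le
  refine ⟨C * M, by positivity, fun σ => ?_⟩
  have := hb σ M (fun τ => bumpFn (τ + σ)) (contDiff_bumpFn_add σ).continuous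
    (fun τ => by rw [abs_of_nonneg (bumpFn_nonneg _)]; exact hle _)
    (fun τ hτ => bumpFn_add_eq_zero hτ)
  simp only [mul_comm (bumpFn _)]
  linarith [le_abs_self (∫ τ, f τ * bumpFn (τ + σ))]

section Ends

variable {p β Λ δ : ℝ} {f g : ℝ → ℝ}

lemma IsModeSolution.continuous (h : IsModeSolution p β Λ f g) : Continuous f :=
  continuous_iff_continuousAt.2 fun τ => (h.1 τ).continuousAt

lemma IsModeSolution.continuous_deriv (h : IsModeSolution p β Λ f g) : Continuous g :=
  continuous_iff_continuousAt.2 fun τ => (h.2 τ).continuousAt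

lemma continuous_modeWeight (p β : ℝ) : Continuous (modeWeight p β) :=
  continuous_iff_continuousAt.2 fun τ => (hasDerivAt_modeWeight p β τ).continuousAt

/-- A continuous function without zeros on a convex set keeps its sign. -/
lemma forall_pos_of_forall_ne_zero {s : Set ℝ} (hs : Convex ℝ s) (hf : Continuous f)
    (h0 : ∀ τ ∈ s, f τ ≠ 0) {τ₀ : ℝ} (hτ₀ : τ₀ ∈ s) (hpos : 0 < f τ₀) : ∀ τ ∈ s, 0 < f τ := by
  intro τ hτ
  by_contra! hneg
  obtain ⟨x, hx, hx0⟩ := hs.isPreconnected.intermediate_value hτ hτ₀ hf.continuousOn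
    ⟨hneg, hpos.le⟩
  exact h0 x hx hx0

/-- A solution with `|f|` increasing near `∞` does not decay in the mean. -/
lemma IsModeSolution.not_growing_atTop_of_pos (h : IsModeSolution p β Λ f g) (hδ : 0 < δ)
    (hB : MeanBound δ f) {T : ℝ} (hT : ∀ τ, T ≤ τ → 0 < f τ * g τ) (hpos : 0 < f T) : False := by
  have hf : ∀ τ ∈ Set.Ici T, 0 < f τ := forall_pos_of_forall_ne_zero (convex_Ici T) h.continuous
    (fun τ hτ h0 => by simpa [h0] using hT τ hτ) Set.self_mem_Ici hpos
  have mono := monotoneOn_Ici_of_hasDerivAt_nonneg (T := T) h.1 fun τ hτ =>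
    ((pos_iff_pos_of_mul_pos (hT τ hτ)).1 (hf τ hτ)).le
  obtain ⟨C, hC, hb⟩ := hB.exists_bump_le
  have h1 : ∀ᶠ σ in atBot, f T ≤ C * Real.exp (δ * σ) := by
    filter_upwards [eventually_le_atBot (-T - 1)] with σ hσ
    refine le_trans (le_integral_bumpFn_add_mul h.continuous fun τ hτ => ?_) (hb σ)
    have : T ≤ τ := by linarith [hτ.1]
    exact mono Set.self_mem_Ici this this
  have h2 : Tendsto (fun σ => C * Real.exp (δ * σ)) atBot (𝓝 (C * 0)) :=
    (Real.tendsto_exp_atBot.comp (tendsto_id.const_mul_atBot hδ)).const_mul C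
  rw [mul_zero] at h2
  exact absurd (le_of_tendsto' (a := f T) (b := 0) (f := fun _ : ℝ => f T) (x := atBot)
    tendsto_const_nhds (fun _ => ge_of_tendsto h2 h1)) (not_le.2 hpos)

lemma IsModeSolution.not_growing_atTop (h : IsModeSolution p β Λ f g) (hδ : 0 < δ)
    (hB : MeanBound δ f) : ¬ ∃ T, ∀ τ, T ≤ τ → 0 < f τ * g τ := by
  rintro ⟨T, hT⟩
  rcases lt_trichotomy (f T) 0 with h0 | h0 | h0
  · exact h.neg.not_growing_atTop_of_pos hδ hB.neg (T := T)
      (fun τ hτ => by simpa using hT τ hτ) (by simpa using h0)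
  · have := hT T le_rfl
    simp [h0] at this
  · exact h.not_growing_atTop_of_pos hδ hB hT h0

/-- The signs and the monotonicity of the flux of a positive solution decreasing near `-∞`. -/
lemma IsModeSolution.exists_decreasing (h : IsModeSolution p β Λ f g) (hΛ : 0 < Λ) {T : ℝ}
    (hT : ∀ τ ≤ T, f τ * g τ < 0) (hpos : 0 < f T) :
    ∃ S ≤ T, (∀ τ ≤ S, 0 < f τ) ∧ (∀ τ ≤ S, g τ < 0) ∧
      MonotoneOn (fun τ => modeWeight p β τ * g τ) (Set.Iic S) := by
  obtain ⟨T', hT'⟩ := exists_potential_le_atBot hΛ (β ^ 2 * (p - 1) + β)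
  have hf : ∀ τ ∈ Set.Iic T, 0 < f τ := forall_pos_of_forall_ne_zero (convex_Iic T) h.continuous
    (fun τ hτ h0 => by simpa [h0] using hT τ hτ) Set.self_mem_Iic hpos
  have hle := min_le_left T T'
  refine ⟨min T T', hle, fun τ hτ => hf τ (hτ.trans hle), fun τ hτ =>
    (pos_iff_neg_of_mul_neg (hT τ (hτ.trans hle))).1 (hf τ (hτ.trans hle)), ?_⟩
  refine monotoneOn_Iic_of_hasDerivAt_nonneg h.hasDerivAt_flux fun τ hτ => ?_
  have h1 := hT' τ (hτ.trans (min_le_right _ _))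
  have h2 := (hf τ (hτ.trans hle)).le
  have h3 := modeWeight_pos p β τ
  have : 0 ≤ (Λ - (β ^ 2 * (p - 1) + β) * (logistic τ * (1 - logistic τ))) := by linarith
  positivity

/-- If `|f|` decreases near `-∞`, then the flux `ω f'` stays away from zero there, so that `|f|`
grows at least like `1/ω`, which is more than the mean bound allows. The hypothesis `p ≥ 2` gives
`ω ≤ e^{(β(p-1)-1)τ}`. -/
lemma IsModeSolution.not_decreasing_atBot_of_two_le_of_pos (h : IsModeSolution p β Λ f g)
    (hΛ : 0 < Λ) (hβ : 0 ≤ β) (hp : 2 ≤ p) (hδ : δ < β * (p - 1) - 1) (hδ0 : 0 ≤ δ)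
    (hB : MeanBound δ f) {T : ℝ} (hT : ∀ τ ≤ T, f τ * g τ < 0) (hpos : 0 < f T) : False := by
  obtain ⟨S, hS, hf, hg, mono⟩ := h.exists_decreasing hΛ hT hpos
  set c := β * (p - 1) - 1 with hc
  have hw : ∀ τ, modeWeight p β τ ≤ Real.exp (c * τ) := fun τ => by
    unfold modeWeight
    refine mul_le_of_le_one_right (Real.exp_pos _).le ?_
    refine Real.rpow_le_one_of_one_le_of_nonpos (by linarith [Real.exp_pos τ]) ?_
    have : 0 ≤ β * (p - 2) := mul_nonneg hβ (by linarith)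
    linarith
  set d := -(modeWeight p β S * g S) with hd
  have hd0 : 0 < d := by
    have := mul_neg_of_pos_of_neg (modeWeight_pos p β S) (hg S le_rfl)
    linarith
  have hg2 : ∀ τ ≤ S, d * Real.exp (-(c * τ)) ≤ -g τ := fun τ hτ => by
    have h1 := mono hτ (le_refl S) hτ
    simp only at h1
    have h2 := mul_le_mul_of_nonneg_right (hw τ) (by linarith [hg τ hτ] : 0 ≤ -g τ)
    have h3 : d ≤ Real.exp (c * τ) * (-g τ) := by linarith
    calc d * Real.exp (-(c * τ)) ≤ Real.exp (c * τ) * (-g τ) * Real.exp (-(c * τ)) :=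
          mul_le_mul_of_nonneg_right h3 (Real.exp_pos _).le
      _ = -g τ * (Real.exp (c * τ) * Real.exp (-(c * τ))) := by ring
      _ = -g τ := by rw [← Real.exp_add, add_neg_cancel, Real.exp_zero, mul_one]
  have hf2 : ∀ τ, τ + 1 ≤ S → d * Real.exp (-(c * (τ + 1))) ≤ f τ := fun τ hτ => by
    obtain ⟨ξ, hξ, e⟩ := exists_hasDerivAt_eq_slope f g (by linarith : τ < τ + 1)
      h.continuous.continuousOn fun x _ => h.1 x
    have h1 := hg2 ξ (hξ.2.le.trans hτ)
    have h2 : d * Real.exp (-(c * (τ + 1))) ≤ d * Real.exp (-(c * ξ)) := by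
      have : c * ξ ≤ c * (τ + 1) := mul_le_mul_of_nonneg_left hξ.2.le (by linarith)
      gcongr
    rw [add_sub_cancel_left, div_one] at e
    have h3 := hf (τ + 1) hτ
    linarith
  obtain ⟨C, hC, hb⟩ := hB.exists_bump_le
  have h1 : ∀ᶠ σ in atTop, d * Real.exp (-2 * c) ≤ C * Real.exp ((δ - c) * σ) := by
    filter_upwards [eventually_ge_atTop (2 - S)] with σ hσ
    have h2 : d * Real.exp (-(c * (-σ + 2))) ≤ C * Real.exp (δ * σ) := by
      refine le_trans (le_integral_bumpFn_add_mul h.continuous fun τ hτ => ?_) (hb σ)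
      refine le_trans ?_ (hf2 τ (by linarith [hτ.2]))
      have : c * (τ + 1) ≤ c * (-σ + 2) := mul_le_mul_of_nonneg_left (by linarith [hτ.2])
        (by linarith)
      gcongr
    have h3 := mul_le_mul_of_nonneg_right h2 (Real.exp_pos (-(c * σ))).le
    rw [mul_assoc, mul_assoc, ← Real.exp_add, ← Real.exp_add] at h3
    rw [show -(c * (-σ + 2)) + -(c * σ) = -2 * c by ring,
      show δ * σ + -(c * σ) = (δ - c) * σ by ring] at h3
    exact h3
  have h2 : Tendsto (fun σ => C * Real.exp ((δ - c) * σ)) atTop (𝓝 (C * 0)) :=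
    (Real.tendsto_exp_atBot.comp (tendsto_id.const_mul_atTop_of_neg
      (by linarith : δ - c < 0))).const_mul C
  rw [mul_zero] at h2
  exact absurd (ge_of_tendsto h2 h1) (not_le.2 (by positivity))

lemma IsModeSolution.not_decreasing_atBot_of_two_le (h : IsModeSolution p β Λ f g)
    (hΛ : 0 < Λ) (hβ : 0 ≤ β) (hp : 2 ≤ p) (hδ : δ < β * (p - 1) - 1) (hδ0 : 0 ≤ δ)
    (hB : MeanBound δ f) : ¬ ∃ T, ∀ τ ≤ T, f τ * g τ < 0 := by
  rintro ⟨T, hT⟩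
  rcases lt_trichotomy (f T) 0 with h0 | h0 | h0
  · exact h.neg.not_decreasing_atBot_of_two_le_of_pos hΛ hβ hp hδ hδ0 hB.neg (T := T)
      (fun τ hτ => by simpa using hT τ hτ) (by simpa using h0)
  · have := hT T le_rfl
    simp [h0] at this
  · exact h.not_decreasing_atBot_of_two_le_of_pos hΛ hβ hp hδ hδ0 hB hT h0

/-- The two limits at the origin that the weak equation, tested with functions that are not
supported away from the origin, adds to the radial equation: the flux through small spheres
against `r^k` vanishes, and the form is absolutely integrable against `r^k`. In the variable `τ`
the power `r^k` is `e^{ε τ}`. -/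
structure VanishesAtOrigin (p β Λ ε : ℝ) (f g : ℝ → ℝ) : Prop where
  flux : Tendsto (fun σ => ∫ τ, bumpFn (τ + σ) * (modeWeight p β τ * Real.exp (ε * τ) * g τ))
    atTop (𝓝 0)
  form : Tendsto (fun σ => ∫ τ, bumpFn (τ + σ) *
    (modeWeight p β τ * Real.exp (ε * τ) * (ε * g τ + Λ * f τ))) atTop (𝓝 0)

lemma VanishesAtOrigin.neg {ε : ℝ} (h : VanishesAtOrigin p β Λ ε f g) :
    VanishesAtOrigin p β Λ ε (-f) (-g) := by
  refine ⟨?_, ?_⟩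
  · convert h.flux.neg using 1
    · funext σ
      rw [← integral_neg]
      congr 1; funext τ; simp
    · simp
  · convert h.form.neg using 1
    · funext σ
      rw [← integral_neg]
      congr 1; funext τ; simp only [Pi.neg_apply]; ring
    · simp

/-- If `e^{ετ}` is a subsolution of the equation near `-∞`, a solution that is positive and
decreasing there has a Wronskian with `e^{ετ}` bounded away from zero, which the two limits at
the origin exclude. -/
lemma IsModeSolution.not_decreasing_atBot_of_vanishes_of_pos {ε : ℝ}
    (h : IsModeSolution p β Λ f g) (hΛ : 0 < Λ) (hε : 0 < ε)
    (hsub : ε ^ 2 + (β * (p - 1) - 1) * ε < Λ) (hV : VanishesAtOrigin p β Λ ε f g)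
    {T : ℝ} (hT : ∀ τ ≤ T, f τ * g τ < 0) (hpos : 0 < f T) : False := by
  obtain ⟨S, hS, hf, hg, -⟩ := h.exists_decreasing hΛ hT hpos
  -- `X` and `Y` are the flux and the value, both weighted by `ω e^{ετ}`.
  set w := fun τ => modeWeight p β τ * Real.exp (ε * τ) with hw
  have hw0 : ∀ τ, 0 < w τ := fun τ => mul_pos (modeWeight_pos p β τ) (Real.exp_pos _)
  have hwc : Continuous w := (continuous_modeWeight p β).mul (by fun_prop)
  have hD : ∀ τ, HasDerivAt (fun τ => w τ * g τ - ε * (w τ * f τ))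
      ((Λ - (β ^ 2 * (p - 1) + β) * (logistic τ * (1 - logistic τ))
        - ε ^ 2 - ε * modeDrift p β τ) * (w τ * f τ)) τ := by
    intro τ
    have h1 := (hasDerivAt_modeWeight p β τ).mul (hasDerivAt_exp_const_mul ε τ)
    have h2 := (h1.mul (h.2 τ)).sub ((h1.mul (h.1 τ)).const_mul ε)
    refine h2.congr_deriv ?_
    simp only [hw, Pi.mul_apply]
    ring
  have hlim : Tendsto (fun τ => Λ - (β ^ 2 * (p - 1) + β) * (logistic τ * (1 - logistic τ))
      - ε ^ 2 - ε * modeDrift p β τ) atBot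
      (𝓝 (Λ - (β ^ 2 * (p - 1) + β) * (0 * (1 - 0)) - ε ^ 2
        - ε * (β * (p - 1) - 1 - β * (p - 2) * 0))) := by
    have hl := tendsto_logistic_atBot
    exact ((((hl.mul (hl.const_sub 1)).const_mul _).const_sub Λ).sub_const _).sub
      (((hl.const_mul _).const_sub _).const_mul ε)
  obtain ⟨R, hR⟩ := eventually_atBot.1 (hlim.eventually (lt_mem_nhds
    (by nlinarith : (0 : ℝ) < Λ - (β ^ 2 * (p - 1) + β) * (0 * (1 - 0)) - ε ^ 2
        - ε * (β * (p - 1) - 1 - β * (p - 2) * 0))))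
  set Q := min R S with hQ
  have mono := monotoneOn_Iic_of_hasDerivAt_nonneg (T := Q) hD fun τ hτ =>
    mul_nonneg (hR τ (hτ.trans (min_le_left _ _))).le
      (mul_pos (hw0 τ) (hf τ (hτ.trans (min_le_right _ _)))).le
  set d := -(w Q * g Q - ε * (w Q * f Q)) with hd
  have hd0 : 0 < d := by
    have h1 := mul_neg_of_pos_of_neg (hw0 Q) (hg Q (min_le_right _ _))
    have h2 := mul_pos (hw0 Q) (hf Q (min_le_right _ _))
    have h3 := mul_pos hε h2
    linarith
  -- `Λ d ≤ (ε² + Λ) X + ε (Λ Y - ε X)`, and both means tend to zero.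
  have hF : Continuous fun τ => -(Λ + ε ^ 2) * (w τ * g τ) + ε * (w τ * (ε * g τ + Λ * f τ)) := by
    have := h.continuous
    have := h.continuous_deriv
    fun_prop
  have hev : ∀ᶠ σ in atTop, Λ * d ≤ -(Λ + ε ^ 2) * (∫ τ, bumpFn (τ + σ) * (w τ * g τ))
      + ε * ∫ τ, bumpFn (τ + σ) * (w τ * (ε * g τ + Λ * f τ)) := by
    filter_upwards [eventually_ge_atTop (1 - Q)] with σ hσ
    have i1 : Integrable fun τ => bumpFn (τ + σ) * (w τ * g τ) :=
      integrable_bumpFn_add_mul σ (hwc.mul h.continuous_deriv)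
    have i2 : Integrable fun τ => bumpFn (τ + σ) * (w τ * (ε * g τ + Λ * f τ)) :=
      integrable_bumpFn_add_mul σ (hwc.mul
        ((h.continuous_deriv.const_mul ε).add (h.continuous.const_mul Λ)))
    have h1 : Λ * d ≤ ∫ τ, bumpFn (τ + σ) *
        (-(Λ + ε ^ 2) * (w τ * g τ) + ε * (w τ * (ε * g τ + Λ * f τ))) := by
      refine le_integral_bumpFn_add_mul hF fun τ hτ => ?_
      have hτQ : τ ≤ Q := by linarith [hτ.2]
      have h2 := mono hτQ (le_refl Q) hτQ
      simp only at h2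
      have h3 : d ≤ -(w τ * g τ - ε * (w τ * f τ)) := by linarith
      nlinarith
    refine h1.trans (le_of_eq ?_)
    rw [← integral_const_mul, ← integral_const_mul, ← integral_add (i1.const_mul _)
      (i2.const_mul _)]
    congr 1; funext τ; ring
  have hl := (hV.flux.const_mul (-(Λ + ε ^ 2))).add (hV.form.const_mul ε)
  rw [mul_zero, mul_zero, add_zero] at hl
  exact absurd (ge_of_tendsto hl hev) (not_le.2 (by positivity))

lemma IsModeSolution.not_decreasing_atBot_of_vanishes {ε : ℝ}
    (h : IsModeSolution p β Λ f g) (hΛ : 0 < Λ) (hε : 0 < ε)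
    (hsub : ε ^ 2 + (β * (p - 1) - 1) * ε < Λ) (hV : VanishesAtOrigin p β Λ ε f g) :
    ¬ ∃ T, ∀ τ ≤ T, f τ * g τ < 0 := by
  rintro ⟨T, hT⟩
  rcases lt_trichotomy (f T) 0 with h0 | h0 | h0
  · exact h.neg.not_decreasing_atBot_of_vanishes_of_pos hΛ hε hsub hV.neg (T := T)
      (fun τ hτ => by simpa using hT τ hτ) (by simpa using h0)
  · have := hT T le_rfl
    simp [h0] at this
  · exact h.not_decreasing_atBot_of_vanishes_of_pos hΛ hε hsub hV hT h0

end Ends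

section RadialMode

variable {p β δ : ℝ} {f g : ℝ → ℝ}

/-- The radial solution `((p-1) - e^τ) (1 + e^τ)^{-β}` with `Λ = 0`. -/
noncomputable def radialMode (p β τ : ℝ) : ℝ :=
  ((p - 1) - Real.exp τ) * (1 + Real.exp τ) ^ (-β)

/-- The derivative of the radial solution `radialMode`. -/
noncomputable def radialModeDeriv (p β τ : ℝ) : ℝ :=
  -(Real.exp τ * (1 + Real.exp τ) ^ (-β)) - β * logistic τ * radialMode p β τ

lemma radialMode_isModeSolution (p β : ℝ) :
    IsModeSolution p β 0 (radialMode p β) (radialModeDeriv p β) := by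
  have hE := fun τ => hasDerivAt_one_add_exp_rpow (-β) τ
  have h1 : ∀ τ, HasDerivAt (radialMode p β) (radialModeDeriv p β τ) τ := fun τ => by
    refine (((Real.hasDerivAt_exp τ).const_sub (p - 1)).mul (hE τ)).congr_deriv ?_
    unfold radialModeDeriv radialMode
    ring
  refine ⟨h1, fun τ => ?_⟩
  have h2 := (((Real.hasDerivAt_exp τ).mul (hE τ)).neg).sub
    (((hasDerivAt_logistic τ).const_mul β).mul (h1 τ))
  refine h2.congr_deriv ?_
  have e : Real.exp τ = logistic τ * (1 + Real.exp τ) := by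
    unfold logistic; field_simp
  have e2 : 1 + Real.exp τ = (1 - logistic τ)⁻¹ := by
    unfold logistic; field_simp; ring
  unfold radialModeDeriv radialMode modeDrift
  generalize (1 + Real.exp τ) ^ (-β) = A
  have e3 : Real.exp τ = logistic τ * (1 - logistic τ)⁻¹ := by rw [← e2]; exact e
  have h3 : 1 - logistic τ ≠ 0 := by linarith [logistic_lt_one τ]
  rw [e3]
  field_simp
  ring

lemma modeQuot_radialMode (hp : p ≠ 0) (τ : ℝ) :
    modeQuot p β (radialMode p β) (radialModeDeriv p β) τ
      = -((p - 1) / p * (1 + Real.exp τ) * (1 + Real.exp τ) ^ (-β)) := by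
  unfold modeQuot radialModeDeriv radialMode
  field_simp
  ring

lemma tendsto_radialMode_atBot (p β : ℝ) :
    Tendsto (radialMode p β) atBot (𝓝 (p - 1)) := by
  have h1 : Tendsto (fun τ => (1 + Real.exp τ) ^ (-β)) atBot (𝓝 ((1 + 0) ^ (-β))) :=
    (Real.tendsto_exp_atBot.const_add 1).rpow_const (Or.inl (by norm_num))
  have h2 := (Real.tendsto_exp_atBot.const_sub (p - 1)).mul h1
  rw [add_zero, Real.one_rpow, sub_zero, mul_one] at h2
  exact h2

lemma abs_radialMode_le (hp : 1 < p) (hβ : 1 ≤ β) (τ : ℝ) : |radialMode p β τ| ≤ p := by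
  have h0 := Real.exp_pos τ
  have h1 : (1 + Real.exp τ) ^ (-β) ≤ (1 + Real.exp τ) ^ (-1 : ℝ) :=
    Real.rpow_le_rpow_of_exponent_le (by linarith) (by linarith)
  rw [Real.rpow_neg_one] at h1
  unfold radialMode
  rw [abs_mul, abs_of_pos (by positivity : 0 < (1 + Real.exp τ) ^ (-β))]
  have h2 : |p - 1 - Real.exp τ| ≤ p * (1 + Real.exp τ) := by
    rw [abs_le]; constructor <;> nlinarith
  calc _ ≤ p * (1 + Real.exp τ) * (1 + Real.exp τ)⁻¹ := by gcongr
    _ = p := by field_simp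

lemma IsModeSolution.sub_const_mul {Λ c : ℝ} {f₁ g₁ f₂ g₂ : ℝ → ℝ}
    (h₁ : IsModeSolution p β Λ f₁ g₁) (h₂ : IsModeSolution p β Λ f₂ g₂) :
    IsModeSolution p β Λ (fun τ => f₁ τ - c * f₂ τ) (fun τ => g₁ τ - c * g₂ τ) := by
  refine ⟨fun τ => (h₁.1 τ).sub ((h₂.1 τ).const_mul c), fun τ => ?_⟩
  refine ((h₁.2 τ).sub ((h₂.2 τ).const_mul c)).congr_deriv ?_
  ring

/-- The Wronskian of a solution with `Λ = 0` and of the explicit radial one is constant. -/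
lemma IsModeSolution.exists_wronskian (h : IsModeSolution p β 0 f g) :
    ∃ c, ∀ τ, modeWeight p β τ * (g τ * radialMode p β τ - f τ * radialModeDeriv p β τ) = c := by
  have hZ := radialMode_isModeSolution p β
  have hd : ∀ τ, HasDerivAt (fun τ => modeWeight p β τ *
      (g τ * radialMode p β τ - f τ * radialModeDeriv p β τ)) 0 τ := fun τ => by
    refine ((hasDerivAt_modeWeight p β τ).mul
      (((h.2 τ).mul (hZ.1 τ)).sub ((h.1 τ).mul (hZ.2 τ)))).congr_deriv ?_
    simp only [Pi.sub_apply, Pi.mul_apply]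
    ring
  exact ⟨_, fun τ => is_const_of_deriv_eq_zero (fun τ => (hd τ).differentiableAt)
    (fun τ => (hd τ).deriv) τ 0⟩

/-- A solution with `Λ = 0` whose Wronskian with the explicit one is zero is a multiple of it.
The quotient of the derivatives `m` is used, since the explicit solution has a zero. -/
lemma IsModeSolution.eq_radialMode (h : IsModeSolution p β 0 f g) (hp : 1 < p)
    (hβ : 1 ≤ β)
    (hW : ∀ τ, g τ * radialMode p β τ - f τ * radialModeDeriv p β τ = 0) :
    ∃ c, ∀ τ, f τ = c * radialMode p β τ := by
  have hp0 : p ≠ 0 := by linarith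
  have hZ := radialMode_isModeSolution p β
  set m := modeQuot p β f g with hm
  set mZ := modeQuot p β (radialMode p β) (radialModeDeriv p β) with hmZ
  have hne : ∀ τ, mZ τ ≠ 0 := fun τ => by
    rw [hmZ, modeQuot_radialMode hp0]
    have : 0 < (p - 1) / p := div_pos (by linarith) (by linarith)
    have h1 := Real.exp_pos τ
    have : 0 < (p - 1) / p * (1 + Real.exp τ) * (1 + Real.exp τ) ^ (-β) := by positivity
    linarith
  have hd : ∀ τ, HasDerivAt (fun τ => m τ / mZ τ) 0 τ := fun τ => by
    refine ((h.hasDerivAt_quot τ).div (hZ.hasDerivAt_quot τ) (hne τ)).congr_deriv ?_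
    rw [div_eq_zero_iff]
    left
    have e := hW τ
    unfold modeQuotDeriv modeQuot
    generalize modeDrift p β τ = ρ
    generalize logistic τ = z
    generalize radialMode p β τ = Z at *
    generalize radialModeDeriv p β τ = Z' at *
    generalize f τ = F at *
    generalize g τ = G at *
    have key : ∀ A B D : ℝ, (A * G + B * F) * (Z' + D * Z) - (G + D * F) * (A * Z' + B * Z)
        = (A * D - B) * (G * Z - F * Z') := fun A B D => by ring
    have k2 := key (-ρ + (β * z - 1 / p) + (β - 1) * z)
      (0 - (β ^ 2 * (p - 1) + β) * (z * (1 - z)) + β * (z * (1 - z))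
        + (β - 1) * z * (β * z - 1 / p)) (β * z - 1 / p)
    rw [e, mul_zero] at k2
    linear_combination k2
  refine ⟨m 0 / mZ 0, fun τ => ?_⟩
  set c := m 0 / mZ 0 with hc
  have hmc : ∀ τ, m τ = c * mZ τ := fun τ => by
    have := is_const_of_deriv_eq_zero (f := fun τ => m τ / mZ τ)
      (fun τ => (hd τ).differentiableAt) (fun τ => (hd τ).deriv) τ 0
    rw [hc, ← this, div_mul_cancel₀ _ (hne τ)]
  have h3 := (h.sub_const_mul (c := c) hZ).eq_zero_of_ne hp0 (fun τ => by
      have := hmc τ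
      simp only [hm, hmZ, modeQuot] at this ⊢
      linear_combination this) (by
      have h1 : 1 / p < 1 := by rw [div_lt_one (by linarith)]; exact hp
      have h2 : 0 < (p - 1) / p := div_pos (by linarith) (by linarith)
      have : 0 < (p - 1) / p * (β - 1 / p) := mul_pos h2 (by linarith)
      exact this.ne) τ
  linarith

/-- The flux of the explicit radial solution is `O(e^{β(p-1)τ})` at `-∞`. -/
lemma exists_abs_flux_radialMode_le (p β : ℝ) : ∃ C, 0 ≤ C ∧ ∀ τ ≤ 0,
    |modeWeight p β τ * radialModeDeriv p β τ| ≤ C * Real.exp (β * (p - 1) * τ) := by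
  -- After division by the exponential the flux is a continuous function of `e^τ ∈ [0, 1]`.
  have hc : ContinuousOn (fun y : ℝ => (1 + y) ^ (-(β * (p - 2))) *
      (-((1 + y) ^ (-β)) - β * (1 + y)⁻¹ * ((p - 1 - y) * (1 + y) ^ (-β)))) (Set.Icc 0 1) := by
    have h1 : ∀ c : ℝ, ContinuousOn (fun y : ℝ => (1 + y) ^ c) (Set.Icc 0 1) := fun c =>
      ContinuousOn.rpow_const (by fun_prop) fun y hy => Or.inl (by linarith [hy.1])
    have h2 : ContinuousOn (fun y : ℝ => (1 + y)⁻¹) (Set.Icc 0 1) :=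
      ContinuousOn.inv₀ (by fun_prop) fun y hy => by linarith [hy.1]
    have h3 := h1 (-β)
    have h4 := h1 (-(β * (p - 2)))
    fun_prop
  obtain ⟨C, hC⟩ := isCompact_Icc.exists_bound_of_continuousOn hc
  refine ⟨|C|, abs_nonneg _, fun τ hτ => ?_⟩
  have h1 := (hC (Real.exp τ) ⟨(Real.exp_pos τ).le, Real.exp_le_one_iff.2 hτ⟩).trans (le_abs_self C)
  have e : modeWeight p β τ * radialModeDeriv p β τ = Real.exp (β * (p - 1) * τ) *
      ((1 + Real.exp τ) ^ (-(β * (p - 2))) * (-((1 + Real.exp τ) ^ (-β)) -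
        β * (1 + Real.exp τ)⁻¹ * ((p - 1 - Real.exp τ) * (1 + Real.exp τ) ^ (-β)))) := by
    have h2 : Real.exp (β * (p - 1) * τ) = Real.exp ((β * (p - 1) - 1) * τ) * Real.exp τ := by
      rw [← Real.exp_add]; ring_nf
    rw [h2]
    unfold modeWeight radialModeDeriv radialMode logistic
    ring
  rw [e, abs_mul, abs_of_pos (Real.exp_pos _), mul_comm]
  exact mul_le_mul_of_nonneg_right h1 (Real.exp_pos _).le

/-- A radial solution without flux into the origin is a multiple of the explicit one. -/
theorem IsModeSolution.exists_eq_radialMode (h : IsModeSolution p β 0 f g) (hp : 1 < p)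
    (hβ : 1 ≤ β) (hδ : δ < β * (p - 1)) (hB : MeanBound δ f)
    (hflux : Tendsto (fun σ => ∫ τ, bumpFn (τ + σ) * (modeWeight p β τ * g τ)) atTop (𝓝 0)) :
    ∃ c, ∀ τ, f τ = c * radialMode p β τ := by
  have hZ := radialMode_isModeSolution p β
  obtain ⟨c, hc⟩ := h.exists_wronskian
  suffices hc0 : c = 0 by
    refine h.eq_radialMode hp hβ fun τ => ?_
    exact (mul_eq_zero.1 ((hc τ).trans hc0)).resolve_left (modeWeight_pos p β τ).ne'
  obtain ⟨R, hR⟩ := eventually_atBot.1 ((tendsto_radialMode_atBot p β).eventually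
    (lt_mem_nhds (by linarith : (p - 1) / 2 < p - 1)))
  set q := (p - 1) / 2 with hq
  have hq0 : 0 < q := by rw [hq]; linarith
  -- A positive continuous function equal to the radial solution near `-∞`.
  set Z := fun τ => max (radialMode p β τ) q with hZdef
  have hZc : Continuous Z := hZ.continuous.max continuous_const
  have hZq : ∀ τ, q ≤ Z τ := fun τ => le_max_right _ _
  have hZ0 : ∀ τ, Z τ ≠ 0 := fun τ => by linarith [hZq τ]
  have hZp : ∀ τ, Z τ ≤ p := fun τ =>
    max_le ((le_abs_self _).trans (abs_radialMode_le hp hβ τ)) (by rw [hq]; linarith)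
  have hZR : ∀ τ ≤ R, Z τ = radialMode p β τ := fun τ hτ => max_eq_left (hR τ hτ).le
  obtain ⟨C, hC, hb⟩ := hB
  obtain ⟨M, hM, hle⟩ := exists_bumpFn_le
  obtain ⟨D, hD, hfl⟩ := exists_abs_flux_radialMode_le p β
  set η := fun σ τ => bumpFn (τ + σ) *
    (modeWeight p β τ * radialModeDeriv p β τ / Z τ) with hη
  have hcont : Continuous fun τ => modeWeight p β τ * radialModeDeriv p β τ / Z τ :=
    ((continuous_modeWeight p β).mul hZ.continuous_deriv).div hZc hZ0
  set b := β * (p - 1) with hb'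
  have hbound : ∀ σ, 1 ≤ σ → |∫ τ, f τ * η σ τ| ≤
      C * Real.exp (δ * σ) * (M * (D * Real.exp (|b|) * Real.exp (-(b * σ)) / q)) := by
    intro σ hσ
    refine hb σ _ (η σ) ((contDiff_bumpFn_add σ).continuous.mul hcont) (fun τ => ?_)
      fun τ hτ => by simp [hη, bumpFn_add_eq_zero hτ]
    by_cases hτ : τ ∈ Set.Icc (-σ - 1) (-σ + 1)
    · simp only [hη]
      rw [abs_mul, abs_of_nonneg (bumpFn_nonneg _), abs_div, abs_of_pos (hq0.trans_le (hZq τ))]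
      have h1 := hfl τ (by linarith [hτ.2])
      have h2 : Real.exp (b * τ) ≤ Real.exp |b| * Real.exp (-(b * σ)) := by
        rw [← Real.exp_add]
        refine Real.exp_le_exp.2 ?_
        have h3 : b * (τ + σ) ≤ |b| * 1 := by
          refine (le_abs_self _).trans ?_
          rw [abs_mul]
          exact mul_le_mul_of_nonneg_left (abs_le.2 ⟨by linarith [hτ.1], by linarith [hτ.2]⟩)
            (abs_nonneg _)
        linarith
      have h4 : |modeWeight p β τ * radialModeDeriv p β τ| ≤
          D * Real.exp |b| * Real.exp (-(b * σ)) := by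
        exact (h1.trans (mul_le_mul_of_nonneg_left h2 hD)).trans_eq (mul_assoc _ _ _).symm
      exact mul_le_mul (hle _) (div_le_div₀ (by positivity) h4 hq0 (hZq τ))
        (div_nonneg (abs_nonneg _) (hq0.trans_le (hZq τ)).le) hM.le
    · simp only [hη, bumpFn_add_eq_zero hτ, zero_mul, abs_zero]
      positivity
  have hto : Tendsto (fun σ => ∫ τ, f τ * η σ τ) atTop (𝓝 0) := by
    refine squeeze_zero_norm' (a := fun σ => C * M * D * Real.exp |b| / q *
      Real.exp ((δ - b) * σ)) ?_ ?_
    · filter_upwards [eventually_ge_atTop 1] with σ hσ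
      refine (hbound σ hσ).trans (le_of_eq ?_)
      have : Real.exp ((δ - b) * σ) = Real.exp (δ * σ) * Real.exp (-(b * σ)) := by
        rw [← Real.exp_add]; ring_nf
      rw [this]
      ring
    · have := (Real.tendsto_exp_atBot.comp (tendsto_id.const_mul_atTop_of_neg
        (by linarith : δ - b < 0))).const_mul (C * M * D * Real.exp |b| / q)
      rw [mul_zero] at this
      exact this
  have hlim := (hflux.sub hto).abs
  rw [sub_zero, abs_zero] at hlim
  have hev : ∀ᶠ σ in atTop, |c| / p ≤ |(∫ τ, bumpFn (τ + σ) * (modeWeight p β τ * g τ))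
      - ∫ τ, f τ * η σ τ| := by
    filter_upwards [eventually_ge_atTop (1 - R)] with σ hσ
    have i1 : Integrable fun τ => bumpFn (τ + σ) * (modeWeight p β τ * g τ) :=
      integrable_bumpFn_add_mul σ ((continuous_modeWeight p β).mul h.continuous_deriv)
    have i2 : Integrable fun τ => f τ * η σ τ := by
      convert integrable_bumpFn_add_mul σ (h.continuous.mul hcont) using 2 with τ
      simp only [hη, Pi.mul_apply]; ring
    have e : (∫ τ, bumpFn (τ + σ) * (modeWeight p β τ * g τ)) - ∫ τ, f τ * η σ τ
        = c * ∫ τ, bumpFn (τ + σ) * (1 / Z τ) := by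
      rw [← integral_sub i1 i2, ← integral_const_mul]
      congr 1; funext τ
      by_cases hτ : τ ∈ Set.Icc (-σ - 1) (-σ + 1)
      · have h1 := hc τ
        rw [← hZR τ (by linarith [hτ.2])] at h1
        have h2 := hZ0 τ
        simp only [hη]
        field_simp
        linear_combination bumpFn (τ + σ) * h1
      · simp [hη, bumpFn_add_eq_zero hτ]
    rw [e, abs_mul, div_eq_mul_one_div]
    refine mul_le_mul_of_nonneg_left ?_ (abs_nonneg c)
    refine (le_integral_bumpFn_add_mul (continuous_const.div hZc hZ0) fun τ _ => ?_).trans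
      (le_abs_self _)
    exact one_div_le_one_div_of_le (hq0.trans_le (hZq τ)) (hZp τ)
  have h1 := ge_of_tendsto hlim hev
  have h2 : |c| ≤ 0 := by
    have hp0 : 0 < p := by linarith
    by_contra! h3
    exact absurd h1 (not_le.2 (by positivity))
  exact abs_nonpos_iff.1 h2

end RadialMode

/-! ### Regularity of distributional solutions on the line -/

lemma exists_eq_zero_of_le_abs {η : ℝ → ℝ} (hη : HasCompactSupport η) :
    ∃ R, 0 < R ∧ ∀ τ, R ≤ |τ| → η τ = 0 := by
  obtain ⟨R, hR⟩ := hη.isCompact.isBounded.subset_closedBall 0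
  refine ⟨|R| + 1, by positivity, fun τ hτ => ?_⟩
  by_contra h
  have h1 := hR (subset_tsupport η h)
  rw [Metric.mem_closedBall, dist_zero_right, Real.norm_eq_abs] at h1
  linarith [le_abs_self R]

lemma integral_eq_intervalIntegral {η : ℝ → ℝ} {R : ℝ} (h : ∀ τ, R ≤ |τ| → η τ = 0) :
    ∫ τ, η τ = ∫ τ in (-R)..R, η τ := by
  refine (intervalIntegral.integral_eq_integral_of_support_subset fun τ hτ => ?_).symm
  have : |τ| < R := by
    by_contra! hc
    exact hτ (h τ hc)
  rw [abs_lt] at this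
  exact ⟨this.1, this.2.le⟩

/-- A smooth compactly supported function with integral zero is the derivative of another one. -/
lemma exists_deriv_eq_of_integral_eq_zero {η : ℝ → ℝ} (hη : ContDiff ℝ ∞ η)
    (hc : HasCompactSupport η) (h0 : ∫ τ, η τ = 0) :
    ∃ χ : ℝ → ℝ, ContDiff ℝ ∞ χ ∧ HasCompactSupport χ ∧ deriv χ = η := by
  obtain ⟨R, hR0, hR⟩ := exists_eq_zero_of_le_abs hc
  have hd : ∀ τ, HasDerivAt (fun x => ∫ t in (-R)..x, η t) (η τ) τ := fun τ =>
    intervalIntegral.integral_hasDerivAt_right (hη.continuous.intervalIntegrable _ _)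
      (hη.continuous.stronglyMeasurableAtFilter _ _) hη.continuous.continuousAt
  have hderiv : deriv (fun x => ∫ t in (-R)..x, η t) = η := funext fun τ => (hd τ).deriv
  refine ⟨fun x => ∫ t in (-R)..x, η t, ?_, ?_, hderiv⟩
  · rw [contDiff_infty_iff_deriv, hderiv]
    exact ⟨fun τ => (hd τ).differentiableAt, hη⟩
  · refine HasCompactSupport.of_support_subset_isCompact (isCompact_Icc (a := -R) (b := R)) ?_
    intro x hx
    by_contra hxR
    refine hx ?_
    rw [Set.mem_Icc, not_and_or, not_le, not_le] at hxR
    have hz : ∀ a b : ℝ, (∀ t ∈ Set.uIcc a b, R ≤ |t|) → ∫ t in a..b, η t = 0 := fun a b hab => by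
      rw [intervalIntegral.integral_congr (g := fun _ => 0) fun t ht => hR t (hab t ht)]
      simp
    rcases hxR with hx1 | hx1
    · refine hz _ _ fun t ht => ?_
      rw [Set.uIcc_of_ge hx1.le] at ht
      exact le_abs.2 (Or.inr (by linarith [ht.2]))
    · have hii := fun a b => hη.continuous.intervalIntegrable (μ := volume) a b
      change ∫ t in (-R)..x, η t = 0
      rw [← intervalIntegral.integral_add_adjacent_intervals (hii (-R) R) (hii R x),
        ← integral_eq_intervalIntegral hR, h0, zero_add]
      refine hz _ _ fun t ht => ?_
      rw [Set.uIcc_of_le hx1.le] at ht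
      exact le_abs.2 (Or.inl ht.1)

/-- A distribution on the line with derivative zero is a constant. -/
lemma ae_eq_const_of_forall_integral_mul_deriv {d : ℝ → ℝ} (hd : LocallyIntegrable d)
    (h : ∀ χ : ℝ → ℝ, ContDiff ℝ ∞ χ → HasCompactSupport χ → ∫ τ, d τ * deriv χ τ = 0) :
    ∃ c, ∀ᵐ τ, d τ = c := by
  have hint : ∀ η : ℝ → ℝ, ContDiff ℝ ∞ η → HasCompactSupport η → Integrable fun τ => d τ * η τ :=
    fun η h1 h2 => by
      simpa [mul_comm] using hd.integrable_smul_left_of_hasCompactSupport h1.continuous h2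
  refine ⟨∫ τ, d τ * bumpFn τ, ?_⟩
  set c := ∫ τ, d τ * bumpFn τ with hc
  have key := ae_eq_zero_of_integral_contDiff_smul_eq_zero (μ := volume)
    (f := fun τ => d τ - c) (hd.sub (locallyIntegrable_const c)) fun η hη hηc => ?_
  · filter_upwards [key] with τ hτ using sub_eq_zero.1 hτ
  have i1 : Integrable η := hη.continuous.integrable_of_hasCompactSupport hηc
  have i2 : Integrable bumpFn :=
    contDiff_bumpFn.continuous.integrable_of_hasCompactSupport hasCompactSupport_bumpFn
  set I := ∫ τ, η τ with hI
  obtain ⟨χ, h1, h2, h3⟩ := exists_deriv_eq_of_integral_eq_zero (η := fun τ => η τ - I * bumpFn τ)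
    (hη.sub (contDiff_const.mul contDiff_bumpFn)) (hηc.sub hasCompactSupport_bumpFn.mul_left)
    (by rw [integral_sub i1 (i2.const_mul I), integral_const_mul, integral_bumpFn]; ring)
  have h4 := h χ h1 h2
  rw [h3] at h4
  have j1 := hint η hη hηc
  have j2 := hint bumpFn contDiff_bumpFn hasCompactSupport_bumpFn
  have e1 : ∫ τ, d τ * (η τ - I * bumpFn τ) = (∫ τ, d τ * η τ) - I * c := by
    rw [hc, ← integral_const_mul, ← integral_sub j1 (j2.const_mul I)]
    congr 1; funext τ; ring
  have e2 : ∫ τ, η τ • (d τ - c) = (∫ τ, d τ * η τ) - c * I := by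
    rw [hI, ← integral_const_mul, ← integral_sub j1 (i1.const_mul c)]
    congr 1; funext τ; rw [smul_eq_mul]; ring
  rw [e2]
  rw [e1] at h4
  linarith

/-- Integration by parts for the primitive of a locally integrable function. -/
lemma integral_primitive_mul_deriv {h : ℝ → ℝ} (hh : LocallyIntegrable h) {χ : ℝ → ℝ}
    (hχ : ContDiff ℝ 1 χ) (hc : HasCompactSupport χ) :
    ∫ τ, (∫ t in (0 : ℝ)..τ, h t) * deriv χ τ = -∫ τ, h τ * χ τ := by
  obtain ⟨R, hR0, hR⟩ := exists_eq_zero_of_le_abs hc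
  obtain ⟨R', hR0', hR'⟩ := exists_eq_zero_of_le_abs hc.deriv
  set S := max R R' with hS
  have hS0 : 0 < S := lt_max_of_lt_left hR0
  have hSχ : ∀ τ, S ≤ |τ| → χ τ = 0 := fun τ hτ => hR τ ((le_max_left _ _).trans hτ)
  have hSχ' : ∀ τ, S ≤ |τ| → deriv χ τ = 0 := fun τ hτ => hR' τ ((le_max_right _ _).trans hτ)
  rw [integral_eq_intervalIntegral (R := S) fun τ hτ => by rw [hSχ' τ hτ, mul_zero],
    integral_eq_intervalIntegral (R := S) fun τ hτ => by rw [hSχ τ hτ, mul_zero]]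
  have hii : IntervalIntegrable h volume (-S) S :=
    intervalIntegrable_iff.mpr ((hh.integrableOn_isCompact isCompact_uIcc).mono_set
      Set.uIoc_subset_uIcc)
  have ac1 := hii.absolutelyContinuousOnInterval_intervalIntegral (c := 0)
    (by rw [Set.uIcc_of_le (by linarith)]; exact ⟨by linarith, hS0.le⟩)
  have ac2 := (hχ.contDiffOn (s := Set.uIcc (-S) S)).absolutelyContinuousOnInterval
  rw [ac1.integral_mul_deriv_eq_deriv_mul ac2, hSχ S (le_abs_self S),
    hSχ (-S) (by rw [abs_neg]; exact le_abs_self S)]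
  simp only [mul_zero, sub_zero, zero_sub]
  congr 1
  refine intervalIntegral.integral_congr_ae ?_
  filter_upwards [_root_.LocallyIntegrable.ae_hasDerivAt_integral hh] with τ hτ _
  rw [(hτ 0).deriv]

lemma continuous_primitive_of_locallyIntegrable {h : ℝ → ℝ} (hh : LocallyIntegrable h) :
    Continuous fun τ => ∫ t in (0 : ℝ)..τ, h t :=
  intervalIntegral.continuous_primitive (fun _ _ => intervalIntegrable_iff.mpr
    ((hh.integrableOn_isCompact isCompact_uIcc).mono_set Set.uIoc_subset_uIcc)) 0

/-- A locally integrable distributional solution of `(P f')' = q f` on the line agrees almost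
everywhere with a classical one. -/
theorem exists_classical_of_weak {P q f : ℝ → ℝ} (hP : ContDiff ℝ ∞ P) (hP0 : ∀ τ, 0 < P τ)
    (hq : Continuous q) (hf : LocallyIntegrable f)
    (h : ∀ χ : ℝ → ℝ, ContDiff ℝ ∞ χ → HasCompactSupport χ →
      ∫ τ, f τ * deriv (fun s => P s * deriv χ s) τ = ∫ τ, q τ * f τ * χ τ) :
    ∃ F G : ℝ → ℝ, (∀ᵐ τ, f τ = F τ) ∧ (∀ τ, HasDerivAt F (G τ) τ) ∧
      ∀ τ, HasDerivAt (fun s => P s * G s) (q τ * F τ) τ := by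
  have hqf : LocallyIntegrable fun τ => q τ * f τ := by
    rw [← locallyIntegrableOn_univ] at hf ⊢
    exact hf.continuousOn_mul hq.continuousOn isOpen_univ.isLocallyClosed
  set Q := fun τ => ∫ t in (0 : ℝ)..τ, q t * f t with hQ
  have hQc : Continuous Q := continuous_primitive_of_locallyIntegrable hqf
  have hPi : Continuous fun τ => (P τ)⁻¹ := hP.continuous.inv₀ fun τ => (hP0 τ).ne'
  have hPis : ContDiff ℝ ∞ fun τ => (P τ)⁻¹ := hP.inv fun τ => (hP0 τ).ne'
  set R := fun τ => ∫ t in (0 : ℝ)..τ, Q t * (P t)⁻¹ with hR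
  set S := fun τ => ∫ t in (0 : ℝ)..τ, (P t)⁻¹ with hS
  have hRd : ∀ τ, HasDerivAt R (Q τ * (P τ)⁻¹) τ := fun τ =>
    ((hQc.mul hPi).integral_hasStrictDerivAt 0 τ).hasDerivAt
  have hSd : ∀ τ, HasDerivAt S ((P τ)⁻¹) τ := fun τ =>
    (hPi.integral_hasStrictDerivAt 0 τ).hasDerivAt
  have hRc : Continuous R := continuous_iff_continuousAt.2 fun τ => (hRd τ).continuousAt
  have hSc : Continuous S := continuous_iff_continuousAt.2 fun τ => (hSd τ).continuousAt
  have mulint : ∀ {d : ℝ → ℝ}, LocallyIntegrable d → ∀ {η : ℝ → ℝ}, Continuous η →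
      HasCompactSupport η → Integrable fun τ => d τ * η τ := fun hd η h1 h2 => by
    simpa [mul_comm] using hd.integrable_smul_left_of_hasCompactSupport h1 h2
  have hRloc := hRc.locallyIntegrable (μ := volume)
  have hdloc : LocallyIntegrable fun τ => f τ - R τ := hf.sub hRloc
  -- `f - R` is orthogonal to all derivatives of functions `P χ'`.
  have h1 : ∀ χ : ℝ → ℝ, ContDiff ℝ ∞ χ → HasCompactSupport χ →
      ∫ τ, (f τ - R τ) * deriv (fun s => P s * deriv χ s) τ = 0 := by
    intro χ hχ hχc
    have hχ' : ContDiff ℝ ∞ (deriv χ) := (contDiff_infty_iff_deriv.1 hχ).2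
    have hPχ : ContDiff ℝ ∞ fun s => P s * deriv χ s := hP.mul hχ'
    have hPχc : HasCompactSupport fun s => P s * deriv χ s := hχc.deriv.mul_left
    have hPχ' : Continuous (deriv fun s => P s * deriv χ s) :=
      (contDiff_infty_iff_deriv.1 hPχ).2.continuous
    have e1 : ∫ τ, R τ * deriv (fun s => P s * deriv χ s) τ = ∫ τ, q τ * f τ * χ τ := by
      rw [integral_primitive_mul_deriv (h := fun τ => Q τ * (P τ)⁻¹)
        (hQc.mul hPi).locallyIntegrable (hPχ.of_le (by simp)) hPχc]
      have : ∀ τ, Q τ * (P τ)⁻¹ * (P τ * deriv χ τ) = Q τ * deriv χ τ := fun τ => by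
        have := (hP0 τ).ne'
        field_simp
      simp only [this]
      rw [integral_primitive_mul_deriv hqf (hχ.of_le (by simp)) hχc, neg_neg]
    simp only [sub_mul]
    rw [integral_sub (mulint hf hPχ' hPχc.deriv) (mulint hRloc hPχ' hPχc.deriv), e1, h χ hχ hχc,
      sub_self]
  -- Hence it is a constant plus a multiple of the primitive `S` of `1 / P`.
  have hb : ContDiff ℝ ∞ fun τ => P τ * bumpFn τ := hP.mul contDiff_bumpFn
  have hbc : HasCompactSupport fun τ => P τ * bumpFn τ := hasCompactSupport_bumpFn.mul_left
  set c := ∫ τ, (f τ - R τ) * deriv (fun s => P s * bumpFn s) τ with hc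
  obtain ⟨c₂, hc₂⟩ := ae_eq_const_of_forall_integral_mul_deriv
    (d := fun τ => (f τ - R τ) + c * S τ)
    (hdloc.add (hSc.const_mul c).locallyIntegrable) fun χ hχ hχc => by
      have i1 : Integrable fun τ => (P τ)⁻¹ * χ τ :=
        (hPi.mul hχ.continuous).integrable_of_hasCompactSupport hχc.mul_left
      have i2 : Integrable bumpFn :=
        contDiff_bumpFn.continuous.integrable_of_hasCompactSupport hasCompactSupport_bumpFn
      set I := ∫ τ, (P τ)⁻¹ * χ τ with hI
      obtain ⟨ξ, hξ, hξc, hξd⟩ := exists_deriv_eq_of_integral_eq_zero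
        (η := fun τ => (P τ)⁻¹ * χ τ - I * bumpFn τ)
        ((hPis.mul hχ).sub (contDiff_const.mul contDiff_bumpFn))
        (hχc.mul_left.sub hasCompactSupport_bumpFn.mul_left)
        (by rw [integral_sub i1 (i2.const_mul I), integral_const_mul, integral_bumpFn]; ring)
      have h2 := h1 ξ hξ hξc
      have e1 : (fun s => P s * deriv ξ s) = fun s => χ s - I * (P s * bumpFn s) := by
        funext s
        have := (hP0 s).ne'
        rw [hξd]
        field_simp
      have e2 : deriv (fun s => P s * deriv ξ s) =
          fun τ => deriv χ τ - I * deriv (fun s => P s * bumpFn s) τ := by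
        funext τ
        rw [e1]
        have d1 := (hχ.differentiable (by simp) τ).hasDerivAt
        have d2 := (hb.differentiable (by simp) τ).hasDerivAt
        exact (d1.sub (d2.const_mul I)).deriv
      have hχ' := (contDiff_infty_iff_deriv.1 hχ).2.continuous
      have j1 := mulint hdloc hχ' hχc.deriv
      have j2 := mulint hdloc (contDiff_infty_iff_deriv.1 hb).2.continuous hbc.deriv
      have j3 := mulint hSc.locallyIntegrable hχ' hχc.deriv
      rw [e2] at h2
      have e3 : ∫ τ, (f τ - R τ) * (deriv χ τ - I * deriv (fun s => P s * bumpFn s) τ)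
          = (∫ τ, (f τ - R τ) * deriv χ τ) - I * c := by
        rw [hc, ← integral_const_mul, ← integral_sub j1 (j2.const_mul I)]
        congr 1; funext τ; ring
      have e4 : ∫ τ, ((f τ - R τ) + c * S τ) * deriv χ τ
          = (∫ τ, (f τ - R τ) * deriv χ τ) + c * ∫ τ, S τ * deriv χ τ := by
        rw [← integral_const_mul, ← integral_add j1 (j3.const_mul c)]
        congr 1; funext τ; ring
      rw [e4, integral_primitive_mul_deriv hPi.locallyIntegrable (hχ.of_le (by simp)) hχc]
      rw [e3] at h2
      linear_combination h2
  refine ⟨fun τ => R τ - c * S τ + c₂, fun τ => (Q τ - c) * (P τ)⁻¹, ?_, fun τ => ?_, fun τ => ?_⟩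
  · filter_upwards [hc₂] with τ hτ
    linarith
  · refine (((hRd τ).sub ((hSd τ).const_mul c)).add_const c₂).congr_deriv ?_
    ring
  · have e1 : (fun s => P s * ((Q s - c) * (P s)⁻¹)) = fun s => Q s - c := by
      funext s
      have := (hP0 s).ne'
      field_simp
    rw [e1]
    have hFc : Continuous fun τ => q τ * (R τ - c * S τ + c₂) := by fun_prop
    have e2 : Q = fun s => ∫ t in (0 : ℝ)..s, q t * (R t - c * S t + c₂) := by
      funext s
      refine intervalIntegral.integral_congr_ae ?_
      filter_upwards [hc₂] with t ht _
      rw [show f t = R t - c * S t + c₂ by linarith]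
    rw [e2]
    exact ((hFc.integral_hasStrictDerivAt 0 τ).hasDerivAt).sub_const c

/-! ### Integration in polar coordinates -/

section Polar

variable {N : ℕ}

/-- The integral of `w` over the sphere of radius `r`, with respect to the surface measure of
the unit sphere. -/
noncomputable def sphereIntegral (w : HenonSpace N → ℝ) (r : ℝ) : ℝ :=
  ∫ θ : Metric.sphere (0 : HenonSpace N) 1, w (r • (θ : HenonSpace N))
    ∂(volume : Measure (HenonSpace N)).toSphere

lemma integral_polar (hN : 1 ≤ N) {w : HenonSpace N → ℝ} (hw : Integrable w) :
    IntegrableOn (fun r => r ^ (N - 1) * sphereIntegral w r) (Set.Ioi 0) ∧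
      ∫ x, w x = ∫ r in Set.Ioi (0 : ℝ), r ^ (N - 1) * sphereIntegral w r := by
  have : Nontrivial (HenonSpace N) := by
    have : Nonempty (Fin N) := ⟨⟨0, hN⟩⟩
    infer_instance
  have hdim : Module.finrank ℝ (HenonSpace N) = N := by simp
  set μ : Measure (HenonSpace N) := volume with hμ
  set σ := μ.toSphere with hσ
  have mp := μ.measurePreserving_homeomorphUnitSphereProd
  rw [hdim] at mp
  have emb := (homeomorphUnitSphereProd (HenonSpace N)).measurableEmbedding
  set Φ : Metric.sphere (0 : HenonSpace N) 1 × Set.Ioi (0 : ℝ) → ℝ :=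
    fun q => w ((q.2 : ℝ) • (q.1 : HenonSpace N)) with hΦ
  have hcomp : ∀ x : ({0}ᶜ : Set (HenonSpace N)),
      Φ (homeomorphUnitSphereProd (HenonSpace N) x) = w x := fun x => by
    have : (x : HenonSpace N) ≠ 0 := x.2
    simp only [hΦ, homeomorphUnitSphereProd_apply_snd_coe, homeomorphUnitSphereProd_apply_fst_coe]
    rw [smul_smul, mul_inv_cancel₀ (norm_ne_zero_iff.2 this), one_smul]
  have i0 : Integrable (fun x : ({0}ᶜ : Set (HenonSpace N)) => w x) (μ.comap (↑)) :=
    (integrableOn_iff_comap_subtypeVal (measurableSet_singleton _).compl).1 hw.integrableOn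
  have i1 : Integrable Φ (σ.prod (Measure.volumeIoiPow (N - 1))) := by
    rw [← mp.integrable_comp_emb emb]
    exact i0.congr (Eventually.of_forall fun x => (hcomp x).symm)
  have e1 : ∫ x, w x ∂μ = ∫ q, Φ q ∂(σ.prod (Measure.volumeIoiPow (N - 1))) := by
    rw [← mp.integral_comp emb]
    conv_lhs => rw [← restrict_compl_singleton (μ := μ) 0]
    rw [← integral_subtype_comap (measurableSet_singleton _).compl]
    exact integral_congr_ae (Eventually.of_forall fun x => (hcomp x).symm)
  have e2 := integral_prod_symm Φ i1
  have i2 := i1.integral_prod_right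
  have hpos : ∀ r : Set.Ioi (0 : ℝ), (0 : ℝ) ≤ (r : ℝ) ^ (N - 1) := fun r =>
    pow_nonneg (le_of_lt r.2) _
  have hmeas : Measurable fun r : Set.Ioi (0 : ℝ) => (ENNReal.ofReal ((r : ℝ) ^ (N - 1))) := by
    fun_prop
  have hg : ∀ r : Set.Ioi (0 : ℝ), (∫ θ, Φ (θ, r) ∂σ) = sphereIntegral w r := fun r => rfl
  simp only [hg] at e2 i2
  constructor
  · rw [integrableOn_iff_comap_subtypeVal measurableSet_Ioi]
    unfold Measure.volumeIoiPow at i2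
    rw [integrable_withDensity_iff_integrable_smul' hmeas (by simp)] at i2
    refine i2.congr (Eventually.of_forall fun r => ?_)
    simp [ENNReal.toReal_ofReal (hpos r)]
  · rw [e1, e2, ← integral_subtype_comap measurableSet_Ioi
      (fun r : ℝ => r ^ (N - 1) * sphereIntegral w r)]
    unfold Measure.volumeIoiPow
    rw [integral_withDensity_eq_integral_toReal_smul hmeas (by simp)]
    refine integral_congr_ae (Eventually.of_forall fun r => ?_)
    simp [ENNReal.toReal_ofReal (hpos r)]

lemma image_exp_mul_univ {ν : ℝ} (hν : 0 < ν) :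
    (fun τ => Real.exp (ν * τ)) '' Set.univ = Set.Ioi 0 := by
  ext r
  simp only [Set.image_univ, Set.mem_range, Set.mem_Ioi]
  refine ⟨fun ⟨τ, h⟩ => h ▸ Real.exp_pos _, fun hr => ⟨ν⁻¹ * Real.log r, ?_⟩⟩
  rw [← mul_assoc, mul_inv_cancel₀ hν.ne', one_mul, Real.exp_log hr]

/-- The density on the line of the measure `w dx` in the variable `τ = ν⁻¹ log |x|`. -/
noncomputable def polarDensity (ν : ℝ) (w : HenonSpace N → ℝ) (τ : ℝ) : ℝ :=
  ν * Real.exp (ν * τ) * (Real.exp (ν * τ) ^ (N - 1) * sphereIntegral w (Real.exp (ν * τ)))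

lemma integral_polarDensity (hN : 1 ≤ N) {ν : ℝ} (hν : 0 < ν) {w : HenonSpace N → ℝ}
    (hw : Integrable w) :
    Integrable (polarDensity ν w) ∧ ∫ x, w x = ∫ τ, polarDensity ν w τ := by
  obtain ⟨h1, h2⟩ := integral_polar hN hw
  have hd : ∀ τ ∈ Set.univ, HasDerivWithinAt (fun τ => Real.exp (ν * τ))
      (ν * Real.exp (ν * τ)) Set.univ τ := fun τ _ =>
    (hasDerivAt_exp_const_mul ν τ).hasDerivWithinAt
  have hinj : Set.InjOn (fun τ => Real.exp (ν * τ)) Set.univ := fun x _ y _ h => by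
    simpa [hν.ne'] using h
  have habs : ∀ τ, |ν * Real.exp (ν * τ)| = ν * Real.exp (ν * τ) := fun τ =>
    abs_of_pos (by positivity)
  rw [← image_exp_mul_univ hν] at h1 h2
  rw [integrableOn_image_iff_integrableOn_abs_deriv_smul MeasurableSet.univ hd hinj] at h1
  rw [integral_image_eq_integral_abs_deriv_smul MeasurableSet.univ hd hinj] at h2
  simp only [habs, smul_eq_mul, integrableOn_univ, Measure.restrict_univ] at h1 h2
  exact ⟨h1, h2⟩

lemma polarDensity_mul {ν : ℝ} (hν : 0 < ν) (w : HenonSpace N → ℝ) (η : ℝ → ℝ) (τ : ℝ) :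
    polarDensity ν (fun x => w x * η (ν⁻¹ * Real.log ‖x‖)) τ = polarDensity ν w τ * η τ := by
  have h : sphereIntegral (fun x => w x * η (ν⁻¹ * Real.log ‖x‖)) (Real.exp (ν * τ))
      = sphereIntegral w (Real.exp (ν * τ)) * η τ := by
    unfold sphereIntegral
    rw [← integral_mul_const]
    refine integral_congr_ae (Eventually.of_forall fun θ => ?_)
    have h1 : ‖Real.exp (ν * τ) • (θ : HenonSpace N)‖ = Real.exp (ν * τ) := by
      rw [norm_smul, norm_eq_of_mem_sphere, mul_one, Real.norm_eq_abs, abs_of_pos (Real.exp_pos _)]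
    simp only [h1, Real.log_exp]
    rw [← mul_assoc, inv_mul_cancel₀ hν.ne', one_mul]
  unfold polarDensity
  rw [h]
  ring

lemma measurable_logNorm (ν : ℝ) : Measurable fun x : HenonSpace N => ν⁻¹ * Real.log ‖x‖ := by
  fun_prop

/-- The product of a locally integrable function and a bounded function of `log |x|` that
vanishes for large `|x|` is integrable. -/
lemma integrable_mul_comp_log {ν : ℝ} (hν : 0 < ν) {w : HenonSpace N → ℝ}
    (hw : LocallyIntegrable w) {η : ℝ → ℝ} (hη : Measurable η) {M R : ℝ}
    (hM : ∀ τ, |η τ| ≤ M) (hR : ∀ τ, R ≤ τ → η τ = 0) :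
    Integrable fun x => w x * η (ν⁻¹ * Real.log ‖x‖) := by
  have h1 : IntegrableOn w (Metric.closedBall 0 (Real.exp (ν * R))) :=
    hw.integrableOn_isCompact (isCompact_closedBall _ _)
  have h2 : IntegrableOn (fun x => w x * η (ν⁻¹ * Real.log ‖x‖))
      (Metric.closedBall 0 (Real.exp (ν * R))) := by
    refine h1.mul_bdd (c := M) ((hη.comp (measurable_logNorm ν)).aestronglyMeasurable)
      (Eventually.of_forall fun x => ?_)
    exact hM _
  refine (integrableOn_iff_integrable_of_support_subset fun x hx => ?_).1 h2
  by_contra hc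
  refine hx ?_
  rw [Metric.mem_closedBall, dist_zero_right, not_le] at hc
  have h3 : ν * R < Real.log ‖x‖ := (Real.lt_log_iff_exp_lt ((Real.exp_pos _).trans hc)).2 hc
  have h4 : R ≤ ν⁻¹ * Real.log ‖x‖ := by
    rw [inv_mul_eq_div, le_div_iff₀ hν]
    linarith
  simp only [hR _ h4, mul_zero]

/-- Disintegration of a locally integrable function along the spheres around the origin. -/
theorem exists_polarDensity (hN : 1 ≤ N) {ν : ℝ} (hν : 0 < ν) {w : HenonSpace N → ℝ}
    (hw : LocallyIntegrable w) :
    ∃ f : ℝ → ℝ, LocallyIntegrable f ∧ ∀ η : ℝ → ℝ, Continuous η → HasCompactSupport η →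
      ∫ x, w x * η (ν⁻¹ * Real.log ‖x‖) = ∫ τ, f τ * η τ := by
  refine ⟨polarDensity ν w, ?_, fun η hη hc => ?_⟩
  · rw [locallyIntegrable_iff]
    intro K hK
    obtain ⟨R, hR⟩ := hK.isBounded.subset_closedBall 0
    have hi := integrable_mul_comp_log hν hw (η := (Set.Icc (-R) R).indicator fun _ => 1)
      (measurable_const.indicator measurableSet_Icc) (M := 1) (R := R + 1) (fun τ => by
        by_cases h : τ ∈ Set.Icc (-R) R
        · simp [h]
        · simp [h]) (fun τ hτ => Set.indicator_of_notMem (fun h => by linarith [h.2]) _)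
    have h1 := (integral_polarDensity hN hν hi).1
    rw [show polarDensity ν (fun x => w x * (Set.Icc (-R) R).indicator (fun _ => 1)
        (ν⁻¹ * Real.log ‖x‖)) = (Set.Icc (-R) R).indicator (polarDensity ν w) from by
          funext τ
          rw [polarDensity_mul hν]
          by_cases h : τ ∈ Set.Icc (-R) R
          · simp [h]
          · simp [h], integrable_indicator_iff measurableSet_Icc] at h1
    refine h1.mono_set fun x hx => ?_
    have := hR hx
    rwa [Real.closedBall_eq_Icc, zero_sub, zero_add] at this
  · obtain ⟨M, hM⟩ := hc.exists_bound_of_continuous hη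
    obtain ⟨R, hR0, hR⟩ := exists_eq_zero_of_le_abs hc
    have hi := integrable_mul_comp_log hν hw hη.measurable (M := M) (R := R) hM
      (fun τ hτ => hR τ (hτ.trans (le_abs_self τ)))
    rw [(integral_polarDensity hN hν hi).2]
    simp only [polarDensity_mul hν]

end Polar

/-! ### Calculus of products of radial functions and polynomials -/

section Calculus

variable {N : ℕ} {ν : ℝ}

lemma hasGradientAt_mul {f g : HenonSpace N → ℝ} {f' g' x : HenonSpace N}
    (hf : HasGradientAt f f' x) (hg : HasGradientAt g g' x) :
    HasGradientAt (fun y => f y * g y) (f x • g' + g x • f') x := by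
  rw [hasGradientAt_iff_hasFDerivAt] at *
  refine (hf.mul hg).congr_fderiv ?_
  simp

lemma hasGradientAt_add {f g : HenonSpace N → ℝ} {f' g' x : HenonSpace N}
    (hf : HasGradientAt f f' x) (hg : HasGradientAt g g' x) :
    HasGradientAt (fun y => f y + g y) (f' + g') x := by
  rw [hasGradientAt_iff_hasFDerivAt] at *
  refine (hf.add hg).congr_fderiv ?_
  simp

lemma hasGradientAt_comp {f : HenonSpace N → ℝ} {f' x : HenonSpace N} {η : ℝ → ℝ} {η' : ℝ}
    (hη : HasDerivAt η η' (f x)) (hf : HasGradientAt f f' x) :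
    HasGradientAt (fun y => η (f y)) (η' • f') x := by
  rw [hasGradientAt_iff_hasFDerivAt] at *
  refine (hη.comp_hasFDerivAt x hf).congr_fderiv ?_
  simp

lemma gradient_apply (f : HenonSpace N → ℝ) (x : HenonSpace N) (i : Fin N) :
    gradient f x i = fderiv ℝ f x (EuclideanSpace.single i 1) := by
  rw [← inner_gradient_left, EuclideanSpace.inner_single_right]
  simp

lemma inner_eq_sum (x y : HenonSpace N) : inner ℝ x y = ∑ i, x i * y i := by
  simp [PiLp.inner_apply, mul_comm]

/-- The logarithmic radial variable `τ = ν⁻¹ log |x|`. -/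
noncomputable def logNorm (ν : ℝ) (x : HenonSpace N) : ℝ := ν⁻¹ * Real.log ‖x‖

lemma exp_mul_logNorm (hν : ν ≠ 0) {x : HenonSpace N} (hx : x ≠ 0) (c : ℝ) :
    Real.exp (c * ν * logNorm ν x) = ‖x‖ ^ c := by
  rw [logNorm, Real.rpow_def_of_pos (norm_pos_iff.2 hx)]
  congr 1
  field_simp

lemma hasGradientAt_logNorm (ν : ℝ) {x : HenonSpace N} (hx : x ≠ 0) :
    HasGradientAt (logNorm ν) ((ν⁻¹ * (‖x‖ ^ 2)⁻¹) • x) x := by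
  have h1 : HasGradientAt (fun y : HenonSpace N => ‖y‖ ^ 2) ((2 : ℝ) • x) x := by
    rw [hasGradientAt_iff_hasFDerivAt]
    refine (hasStrictFDerivAt_norm_sq x).hasFDerivAt.congr_fderiv ?_
    ext y
    simp
  have hx2 : ‖x‖ ^ 2 ≠ 0 := pow_ne_zero 2 (norm_ne_zero_iff.2 hx)
  have h2 : HasDerivAt (fun r => ν⁻¹ * (1 / 2 * Real.log r)) (ν⁻¹ * (1 / 2 * (‖x‖ ^ 2)⁻¹))
      (‖x‖ ^ 2) := ((Real.hasDerivAt_log hx2).const_mul (1 / 2)).const_mul ν⁻¹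
  have h3 := hasGradientAt_comp h2 h1
  have e : (fun y : HenonSpace N => ν⁻¹ * (1 / 2 * Real.log (‖y‖ ^ 2))) = logNorm ν := by
    funext y
    rw [Real.log_pow, logNorm]
    push_cast
    ring
  rw [e, smul_smul] at h3
  convert h3 using 2
  ring

lemma hasGradientAt_comp_logNorm {η : ℝ → ℝ} {η' : ℝ} {x : HenonSpace N} (hx : x ≠ 0)
    (hη : HasDerivAt η η' (logNorm ν x)) :
    HasGradientAt (fun y => η (logNorm ν y)) ((ν⁻¹ * η' * (‖x‖ ^ 2)⁻¹) • x) x := by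
  have := hasGradientAt_comp hη (hasGradientAt_logNorm ν hx)
  rw [smul_smul] at this
  convert this using 2
  ring

/-- The function `η(ν⁻¹ log |x|)`, with the value `c` at the origin, where `log |x|` has a
junk value. -/
noncomputable def radialLift (ν c : ℝ) (η : ℝ → ℝ) (x : HenonSpace N) : ℝ :=
  open Classical in if x = 0 then c else η (logNorm ν x)

lemma radialLift_of_ne {c : ℝ} {η : ℝ → ℝ} {x : HenonSpace N} (hx : x ≠ 0) :
    radialLift ν c η x = η (logNorm ν x) := by simp [radialLift, hx]

lemma radialLift_eventuallyEq {c : ℝ} {η : ℝ → ℝ} {x : HenonSpace N} (hx : x ≠ 0) :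
    radialLift ν c η =ᶠ[𝓝 x] fun y => η (logNorm ν y) := by
  filter_upwards [isOpen_ne.mem_nhds hx] with y hy using radialLift_of_ne hy

lemma logNorm_le_of_norm_le (hν : 0 < ν) {x : HenonSpace N} (hx : x ≠ 0) {T : ℝ}
    (h : ‖x‖ ≤ Real.exp (ν * T)) : logNorm ν x ≤ T := by
  rw [logNorm, inv_mul_le_iff₀ hν]
  exact (Real.log_le_iff_le_exp (norm_pos_iff.2 hx)).2 h

lemma le_logNorm_of_le_norm (hν : 0 < ν) {x : HenonSpace N} {T : ℝ}
    (h : Real.exp (ν * T) ≤ ‖x‖) : T ≤ logNorm ν x := by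
  rw [logNorm, le_inv_mul_iff₀ hν]
  exact (Real.le_log_iff_exp_le ((Real.exp_pos _).trans_le h)).2 h

lemma radialLift_eventuallyEq_const (hν : 0 < ν) {c T : ℝ} {η : ℝ → ℝ}
    (h : ∀ τ ≤ T, η τ = c) : radialLift (N := N) ν c η =ᶠ[𝓝 0] fun _ => c := by
  filter_upwards [Metric.ball_mem_nhds (0 : HenonSpace N) (Real.exp_pos (ν * T))] with y hy
  rw [mem_ball_zero_iff] at hy
  by_cases hy0 : y = 0
  · simp [radialLift, hy0]
  · rw [radialLift_of_ne hy0]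
    exact h _ (logNorm_le_of_norm_le hν hy0 hy.le)

lemma contDiffAt_logNorm {x : HenonSpace N} (hx : x ≠ 0) : ContDiffAt ℝ ∞ (logNorm ν) x :=
  contDiffAt_const.mul ((contDiffAt_norm ℝ hx).log (norm_ne_zero_iff.2 hx))

lemma contDiff_radialLift (hν : 0 < ν) {c T : ℝ} {η : ℝ → ℝ} (hη : ContDiff ℝ ∞ η)
    (h : ∀ τ ≤ T, η τ = c) : ContDiff ℝ ∞ (radialLift (N := N) ν c η) := by
  rw [contDiff_iff_contDiffAt]
  intro x
  by_cases hx : x = 0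
  · subst hx
    exact contDiffAt_const.congr_of_eventuallyEq (radialLift_eventuallyEq_const hν h)
  · exact (hη.contDiffAt.comp x (contDiffAt_logNorm hx)).congr_of_eventuallyEq
      (radialLift_eventuallyEq hx)

lemma hasCompactSupport_radialLift (hν : 0 < ν) {c T : ℝ} {η : ℝ → ℝ}
    (h : ∀ τ, T ≤ τ → η τ = 0) : HasCompactSupport (radialLift (N := N) ν c η) := by
  refine HasCompactSupport.of_support_subset_isCompact
    (isCompact_closedBall 0 (Real.exp (ν * T))) fun x hx => ?_
  by_contra hc
  rw [Metric.mem_closedBall, dist_zero_right, not_le] at hc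
  have hx0 : x ≠ 0 := norm_pos_iff.1 ((Real.exp_pos _).trans hc)
  refine hx ?_
  rw [radialLift_of_ne hx0]
  exact h _ (le_logNorm_of_le_norm hν hc.le)

/-- The polynomial function on `ℝ^N` given by `q`. -/
noncomputable def polyEval (q : MvPolynomial (Fin N) ℝ) (x : HenonSpace N) : ℝ :=
  MvPolynomial.eval (fun i => x i) q

/-- The gradient of a polynomial function, with formal partial derivatives as coordinates. -/
noncomputable def polyGrad (q : MvPolynomial (Fin N) ℝ) (x : HenonSpace N) : HenonSpace N :=
  WithLp.toLp 2 fun i => polyEval (MvPolynomial.pderiv i q) x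

@[simp] lemma polyGrad_apply (q : MvPolynomial (Fin N) ℝ) (x : HenonSpace N) (i : Fin N) :
    polyGrad q x i = polyEval (MvPolynomial.pderiv i q) x := rfl

@[simp] lemma polyEval_add (q r : MvPolynomial (Fin N) ℝ) (x : HenonSpace N) :
    polyEval (q + r) x = polyEval q x + polyEval r x := by simp [polyEval]

@[simp] lemma polyEval_mul (q r : MvPolynomial (Fin N) ℝ) (x : HenonSpace N) :
    polyEval (q * r) x = polyEval q x * polyEval r x := by simp [polyEval]

@[simp] lemma polyEval_X (i : Fin N) (x : HenonSpace N) :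
    polyEval (MvPolynomial.X i) x = x i := by simp [polyEval]

@[simp] lemma polyEval_C (c : ℝ) (x : HenonSpace N) :
    polyEval (MvPolynomial.C c) x = c := by simp [polyEval]

lemma polyEval_sum {ι : Type*} (s : Finset ι) (q : ι → MvPolynomial (Fin N) ℝ)
    (x : HenonSpace N) : polyEval (∑ i ∈ s, q i) x = ∑ i ∈ s, polyEval (q i) x := by
  simp [polyEval]

lemma polyEval_smul (c : ℝ) (q : MvPolynomial (Fin N) ℝ) (x : HenonSpace N) :
    polyEval (c • q) x = c * polyEval q x := by
  simp [polyEval, MvPolynomial.smul_eval]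

lemma polyEval_normSq (x : HenonSpace N) : polyEval (polyNormSq N) x = ‖x‖ ^ 2 := by
  rw [EuclideanSpace.real_norm_sq_eq]
  simp [polyNormSq, polyEval]

lemma contDiff_polyEval (q : MvPolynomial (Fin N) ℝ) : ContDiff ℝ ∞ (polyEval q) := by
  induction q using MvPolynomial.induction_on with
  | C c =>
    have : polyEval (MvPolynomial.C c) = fun _ : HenonSpace N => c := funext fun x => by simp
    rw [this]
    exact contDiff_const
  | add q r hq hr =>
    have : polyEval (q + r) = fun x => polyEval q x + polyEval r x := funext fun x => by simp
    rw [this]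
    exact hq.add hr
  | mul_X q i hq =>
    have : polyEval (q * MvPolynomial.X i) = fun x : HenonSpace N => polyEval q x * x i :=
      funext fun x => by simp
    rw [this]
    exact hq.mul (EuclideanSpace.proj (𝕜 := ℝ) i).contDiff

lemma hasGradientAt_coord (i : Fin N) (x : HenonSpace N) :
    HasGradientAt (fun y : HenonSpace N => y i) (EuclideanSpace.single i 1) x := by
  rw [hasGradientAt_iff_hasFDerivAt]
  refine (EuclideanSpace.proj (𝕜 := ℝ) i).hasFDerivAt.congr_fderiv ?_
  ext y
  simp [EuclideanSpace.inner_single_left]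

lemma hasGradientAt_polyEval (q : MvPolynomial (Fin N) ℝ) (x : HenonSpace N) :
    HasGradientAt (polyEval q) (polyGrad q x) x := by
  induction q using MvPolynomial.induction_on with
  | C c =>
    have h1 : polyEval (MvPolynomial.C c) = fun _ : HenonSpace N => c := funext fun x => by simp
    have h2 : polyGrad (MvPolynomial.C c) x = 0 := by ext i; simp [polyEval]
    rw [h1, h2]
    exact hasGradientAt_const x c
  | add q r hq hr =>
    have h1 : polyEval (q + r) = fun x => polyEval q x + polyEval r x := funext fun x => by simp
    have h2 : polyGrad (q + r) x = polyGrad q x + polyGrad r x := by ext i; simp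
    rw [h1, h2]
    exact hasGradientAt_add hq hr
  | mul_X q i hq =>
    have h1 : polyEval (q * MvPolynomial.X i) = fun x : HenonSpace N => polyEval q x * x i :=
      funext fun x => by simp
    have h2 : polyGrad (q * MvPolynomial.X i) x
        = polyEval q x • EuclideanSpace.single i 1 + x i • polyGrad q x := by
      ext j
      by_cases h : j = i
      · subst h
        simp
      · simp [MvPolynomial.pderiv_X_of_ne (Ne.symm h), h, polyEval]
    rw [h1, h2]
    exact hasGradientAt_mul hq (hasGradientAt_coord i x)

lemma continuous_polyGrad (q : MvPolynomial (Fin N) ℝ) : Continuous (polyGrad q) := by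
  refine (PiLp.continuous_toLp 2 _).comp (continuous_pi fun i => ?_)
  exact (contDiff_polyEval _).continuous

lemma polyEval_smul_vector {d : ℕ} {q : MvPolynomial (Fin N) ℝ} (hq : q.IsHomogeneous d)
    (c : ℝ) (x : HenonSpace N) : polyEval q (c • x) = c ^ d * polyEval q x := by
  unfold polyEval
  rw [MvPolynomial.eval_eq', MvPolynomial.eval_eq', Finset.mul_sum]
  refine Finset.sum_congr rfl fun m hm => ?_
  have hd : ∑ i, m i = d := by
    have := hq.degree_eq_sum_deg_support hm
    rw [this]
    exact (Finset.sum_subset (Finset.subset_univ _) fun i _ hi => by simpa using hi).symm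
  simp only [PiLp.smul_apply, smul_eq_mul, mul_pow, Finset.prod_mul_distrib]
  rw [Finset.prod_pow_eq_pow_sum, hd]
  ring

lemma exists_abs_polyEval_le {d : ℕ} {q : MvPolynomial (Fin N) ℝ} (hq : q.IsHomogeneous d) :
    ∃ C, 0 ≤ C ∧ ∀ x : HenonSpace N, |polyEval q x| ≤ C * ‖x‖ ^ d := by
  obtain ⟨C, hC⟩ := (isCompact_closedBall (0 : HenonSpace N) 1).exists_bound_of_continuousOn
    (contDiff_polyEval q).continuous.continuousOn
  refine ⟨|C|, abs_nonneg C, fun x => ?_⟩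
  by_cases hx : x = 0
  · subst hx
    have h := polyEval_smul_vector hq 0 (0 : HenonSpace N)
    have h0 := (hC 0 (by simp)).trans (le_abs_self C)
    rw [Real.norm_eq_abs] at h0
    rw [norm_zero]
    rcases Nat.eq_zero_or_pos d with hd | hd
    · simpa [hd] using h0
    · rw [zero_smul, zero_pow hd.ne', zero_mul] at h
      simp [h, zero_pow hd.ne']
  · have h := polyEval_smul_vector hq ‖x‖ (‖x‖⁻¹ • x)
    rw [smul_smul, mul_inv_cancel₀ (norm_ne_zero_iff.2 hx), one_smul] at h
    rw [h, abs_mul, abs_of_nonneg (by positivity), mul_comm]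
    refine mul_le_mul_of_nonneg_right ?_ (by positivity)
    refine (hC _ ?_).trans (le_abs_self C)
    rw [mem_closedBall_zero_iff, norm_smul, norm_inv, norm_norm,
      inv_mul_cancel₀ (norm_ne_zero_iff.2 hx)]

/-- Euler's identity. -/
lemma sum_mul_polyEval_pderiv {d : ℕ} {q : MvPolynomial (Fin N) ℝ} (hq : q.IsHomogeneous d)
    (x : HenonSpace N) :
    ∑ i, x i * polyEval (MvPolynomial.pderiv i q) x = d * polyEval q x := by
  have h := congrArg (fun r => polyEval r x) hq.sum_X_mul_pderiv
  simp only [polyEval_sum, polyEval_mul, polyEval_X] at h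
  rw [h]
  simp [polyEval]

lemma sum_polyEval_pderiv_pderiv {k : ℕ} {H : MvPolynomial (Fin N) ℝ} (hH : H ∈ harmonicPoly N k)
    (x : HenonSpace N) :
    ∑ i, polyEval (MvPolynomial.pderiv i (MvPolynomial.pderiv i H)) x = 0 := by
  have h := congrArg (fun r => polyEval r x) ((polyLaplacian_apply H).symm.trans hH.2)
  simpa [polyEval_sum, polyEval] using h

end Calculus

/-! ### The coefficients of the linearized equation -/

section Coefficients

variable {N : ℕ} {p α : ℝ}

/-- The exponent `ν = (p-1)/(p+α)`, so that `|x| = e^{ντ}` when `e^τ = |x|^{(p+α)/(p-1)}`. -/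
noncomputable def rate (p α : ℝ) : ℝ := (p - 1) / (p + α)

/-- The exponent `β = (N+α)/(p+α)`. -/
noncomputable def decay (N : ℕ) (p α : ℝ) : ℝ := (N + α) / (p + α)

/-- The constant factor of `|∇U|^{p-2}`. -/
noncomputable def weightConst (N : ℕ) (p α : ℝ) : ℝ :=
  (((N : ℝ) - p) / (p - 1) * bubbleConst N p α) ^ (p - 2)

/-- The weight `|∇U|^{p-2}` in the variable `τ`. -/
noncomputable def linWeight (N : ℕ) (p α τ : ℝ) : ℝ :=
  weightConst N p α * modeWeight p (decay N p α) τ * Real.exp (-((N - 2) * rate p α * τ))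

lemma rate_pos (hp : 1 < p) (hα : 0 ≤ α) : 0 < rate p α := div_pos (by linarith) (by linarith)

lemma one_lt_decay (hp : 1 < p) (hpN : p < N) (hα : 0 ≤ α) : 1 < decay N p α := by
  unfold decay
  rw [one_lt_div (by linarith)]
  linarith

lemma bubbleConst_pos (hp : 1 < p) (hpN : p < N) (hα : 0 ≤ α) : 0 < bubbleConst N p α := by
  unfold bubbleConst
  have : 0 < ((N : ℝ) - p) / (p - 1) := div_pos (by linarith) (by linarith)
  have : (0 : ℝ) < N + α := by linarith
  positivity

lemma weightConst_pos (hp : 1 < p) (hpN : p < N) (hα : 0 ≤ α) : 0 < weightConst N p α := by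
  unfold weightConst
  have : 0 < ((N : ℝ) - p) / (p - 1) := div_pos (by linarith) (by linarith)
  have := bubbleConst_pos hp hpN hα
  positivity

lemma linWeight_pos (hp : 1 < p) (hpN : p < N) (hα : 0 ≤ α) (τ : ℝ) : 0 < linWeight N p α τ :=
  mul_pos (mul_pos (weightConst_pos hp hpN hα) (modeWeight_pos _ _ _)) (Real.exp_pos _)

lemma norm_rpow_eq_exp (hp : 1 < p) (hα : 0 ≤ α) {x : HenonSpace N} (hx : x ≠ 0) :
    ‖x‖ ^ ((p + α) / (p - 1)) = Real.exp (logNorm (rate p α) x) := by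
  have hν := (rate_pos hp hα).ne'
  have h := exp_mul_logNorm hν hx ((p + α) / (p - 1))
  rw [← h]
  congr 1
  have h1 : p - 1 ≠ 0 := by linarith
  have h2 : p + α ≠ 0 := by linarith
  unfold rate
  field_simp

lemma rpow_eq_exp_rate (hp : 1 < p) (hα : 0 ≤ α) {x : HenonSpace N} (hx : x ≠ 0) (c : ℝ) :
    ‖x‖ ^ c = Real.exp (c * rate p α * logNorm (rate p α) x) :=
  (exp_mul_logNorm (rate_pos hp hα).ne' hx c).symm

lemma hasGradientAt_bubble (hp : 1 < p) (hα : 0 ≤ α) {x : HenonSpace N}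
    (hx : x ≠ 0) : HasGradientAt (bubble N p α)
      (-(((N : ℝ) - p) / (p - 1) * bubbleConst N p α * logistic (logNorm (rate p α) x)
        * (1 + Real.exp (logNorm (rate p α) x)) ^ (-(((N : ℝ) - p) / (p + α)))
        * (‖x‖ ^ 2)⁻¹) • x) x := by
  set b := ((N : ℝ) - p) / (p + α) with hb
  have h1 := (hasDerivAt_one_add_exp_rpow (-b) (logNorm (rate p α) x)).const_mul
    (bubbleConst N p α)
  have h2 := hasGradientAt_comp_logNorm hx h1
  have e : bubble N p α =ᶠ[𝓝 x] fun y =>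
      bubbleConst N p α * (1 + Real.exp (logNorm (rate p α) y)) ^ (-b) := by
    filter_upwards [isOpen_ne.mem_nhds hx] with y hy
    rw [bubble, norm_rpow_eq_exp hp hα hy, Real.rpow_neg (by positivity), div_eq_mul_inv]
  have h3 := h2.congr_of_eventuallyEq e
  convert h3 using 2
  have h1 : p - 1 ≠ 0 := by linarith
  have h2 : p + α ≠ 0 := by linarith
  rw [hb, rate]
  field_simp

lemma norm_gradient_bubble_rpow (hp : 1 < p) (hpN : p < N) (hα : 0 ≤ α) {x : HenonSpace N}
    (hx : x ≠ 0) :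
    ‖gradient (bubble N p α) x‖ ^ (p - 2) = linWeight N p α (logNorm (rate p α) x) := by
  rw [(hasGradientAt_bubble hp hα hx).gradient]
  set τ := logNorm (rate p α) x with hτ
  set b := ((N : ℝ) - p) / (p + α) with hb
  set c := ((N : ℝ) - p) / (p - 1) * bubbleConst N p α with hc
  have hc0 : 0 < c := mul_pos (div_pos (by linarith) (by linarith)) (bubbleConst_pos hp hpN hα)
  have hz := logistic_pos τ
  have hx' := norm_pos_iff.2 hx
  have h1 : ‖x‖ = Real.exp (rate p α * τ) := by
    have := rpow_eq_exp_rate hp hα hx 1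
    rwa [Real.rpow_one, one_mul] at this
  have e1 : ‖-(c * logistic τ * (1 + Real.exp τ) ^ (-b) * (‖x‖ ^ 2)⁻¹) • x‖
      = c * (Real.exp ((1 - rate p α) * τ) * (1 + Real.exp τ) ^ (-(b + 1))) := by
    rw [norm_smul, norm_neg, Real.norm_eq_abs, abs_of_pos (by positivity), neg_add,
      Real.rpow_add (by positivity), Real.rpow_neg_one]
    have h2 : Real.exp ((1 - rate p α) * τ) = Real.exp τ / ‖x‖ := by
      rw [h1, ← Real.exp_sub]; ring_nf
    rw [h2]
    unfold logistic
    field_simp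
  rw [e1, Real.mul_rpow hc0.le (by positivity), Real.mul_rpow (Real.exp_pos _).le (by positivity),
    ← Real.exp_mul, ← Real.rpow_mul (by positivity), linWeight, weightConst, modeWeight]
  have e2 : decay N p α = b + 1 := by
    have : p + α ≠ 0 := by linarith
    rw [hb, decay]
    field_simp
    ring
  have e3 : (1 - rate p α) * τ * (p - 2)
      = ((b + 1) * (p - 1) - 1) * τ + -((N - 2) * rate p α * τ) := by
    have : p + α ≠ 0 := by linarith
    rw [hb, rate]
    field_simp
    ring
  rw [e2, e3, Real.exp_add, neg_mul]
  ring

/-- Away from the origin, `linForm` is the weight `|∇U|^{p-2}` times the form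
`⟪g, h⟫ + (p - 2) ⟪x/|x|, g⟫ ⟪x/|x|, h⟫`. -/
lemma linForm_eq (hp : 1 < p) (hpN : p < N) (hα : 0 ≤ α) {x : HenonSpace N} (hx : x ≠ 0)
    (g h : HenonSpace N) :
    linForm p α x g h = linWeight N p α (logNorm (rate p α) x) *
      (inner ℝ g h + (p - 2) * (inner ℝ x g * inner ℝ x h) * (‖x‖ ^ 2)⁻¹) := by
  have hw := norm_gradient_bubble_rpow hp hpN hα hx
  have hG := (hasGradientAt_bubble hp hα hx).gradient
  have hx' := norm_pos_iff.2 hx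
  have hne : 0 < ‖gradient (bubble N p α) x‖ := by
    by_contra! h0
    have h1 : gradient (bubble N p α) x = 0 := norm_le_zero_iff.1 h0
    rw [hG, neg_smul, neg_eq_zero, smul_eq_zero] at h1
    rcases h1 with h1 | h1
    · have := logistic_pos (logNorm (rate p α) x)
      have := bubbleConst_pos hp hpN hα
      have : 0 < ((N : ℝ) - p) / (p - 1) := div_pos (by linarith) (by linarith)
      exact absurd h1 (by positivity)
    · exact hx h1
  have e4 : ‖gradient (bubble N p α) x‖ ^ (p - 4)
      = linWeight N p α (logNorm (rate p α) x) * (‖gradient (bubble N p α) x‖ ^ 2)⁻¹ := by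
    rw [← hw, ← Real.rpow_natCast, ← Real.rpow_neg hne.le, ← Real.rpow_add hne]
    congr 1
    push_cast
    ring
  rw [linForm, e4, hw]
  obtain ⟨m, hm⟩ : ∃ m : ℝ, gradient (bubble N p α) x = m • x := ⟨_, hG⟩
  have hm0 : m ≠ 0 := by
    rintro rfl
    rw [hm, zero_smul, norm_zero] at hne
    exact lt_irrefl _ hne
  rw [hm, norm_smul, real_inner_smul_left, real_inner_smul_left, mul_pow, Real.norm_eq_abs, sq_abs]
  field_simp

/-- The constant in front of the potential in the radial equation. -/
noncomputable def potentialConst (N : ℕ) (p α : ℝ) : ℝ :=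
  (p - 1) * (rate p α)⁻¹ ^ 2 * (decay N p α ^ 2 * (p - 1) + decay N p α)

/-- The potential has the same weight `|∇U|^{p-2}` as the form, times `|x|^{-2}` and a bounded
function of `τ`. The value of `C_{N,p,α}` enters here only: it makes the constants independent of
the size of `U`. -/
lemma linPotential_eq (hp : 1 < p) (hpN : p < N) (hα : 0 ≤ α) {x : HenonSpace N} (hx : x ≠ 0) :
    linPotential p α x = potentialConst N p α *
      (linWeight N p α (logNorm (rate p α) x) * (‖x‖ ^ 2)⁻¹ *
        (logistic (logNorm (rate p α) x) * (1 - logistic (logNorm (rate p α) x)))) := by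
  set τ := logNorm (rate p α) x with hτ
  set C := bubbleConst N p α with hC
  set s := ((N : ℝ) - p) / (p - 1) with hs
  set b := ((N : ℝ) - p) / (p + α) with hb
  have hs0 : 0 < s := div_pos (by linarith) (by linarith)
  have hC0 : 0 < C := bubbleConst_pos hp hpN hα
  have hp1 : p - 1 ≠ 0 := by linarith
  have hpa : p + α ≠ 0 := by linarith
  have hNp : (N : ℝ) - p ≠ 0 := by linarith
  have hp0 : p ≠ 0 := by linarith
  have hNa : (0 : ℝ) < N + α := by linarith
  have h1 : ‖x‖ ^ 2 = Real.exp (2 * rate p α * τ) := by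
    have := rpow_eq_exp_rate hp hα hx 2
    rwa [Real.rpow_two] at this
  have hu : bubble N p α x = C * (1 + Real.exp τ) ^ (-b) := by
    rw [bubble, norm_rpow_eq_exp hp hα hx, Real.rpow_neg (by positivity), div_eq_mul_inv]
  have hCp : C ^ (pStar N p α - p) = (N + α) * s ^ (p - 1) := by
    rw [hC, bubbleConst, ← Real.rpow_mul (by positivity)]
    have : ((N : ℝ) - p) / (p * (p + α)) * (pStar N p α - p) = 1 := by
      rw [pStar]
      field_simp
      ring
    rw [this, Real.rpow_one]
  have hC2 : C ^ (pStar N p α - 2) = (N + α) * s * (s ^ (p - 2) * C ^ (p - 2)) := by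
    have : pStar N p α - 2 = (pStar N p α - p) + (p - 2) := by ring
    rw [this, Real.rpow_add hC0, hCp]
    have : p - 1 = 1 + (p - 2) := by ring
    rw [this, Real.rpow_add hs0, Real.rpow_one]
    ring
  have hz : logistic τ * (1 - logistic τ) = Real.exp τ * (1 + Real.exp τ) ^ (-2 : ℝ) := by
    have : (1 + Real.exp τ) ^ (-2 : ℝ) = ((1 + Real.exp τ) ^ 2)⁻¹ := by
      rw [Real.rpow_neg (by positivity), Real.rpow_two]
    rw [this]
    unfold logistic
    field_simp
    ring
  rw [linPotential, hu, rpow_eq_exp_rate hp hα hx α, Real.mul_rpow hC0.le (by positivity),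
    ← Real.rpow_mul (by positivity), hC2, hz, h1, linWeight, weightConst, modeWeight,
    Real.mul_rpow hs0.le hC0.le, ← Real.exp_neg, ← hτ]
  have e1 : -b * (pStar N p α - 2) = -(decay N p α * (p - 2)) + -2 := by
    rw [hb, pStar, decay]
    field_simp
    ring
  have e2 : α * rate p α * τ = ((decay N p α * (p - 1) - 1) * τ
      + -((N - 2) * rate p α * τ)) + (-(2 * rate p α * τ) + τ) := by
    rw [rate, decay]
    field_simp
    ring
  have e3 : (pStar N p α - 1) * ((N + α) * s) = potentialConst N p α := by
    rw [pStar, hs, potentialConst, rate, decay]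
    field_simp
    ring
  rw [e1, Real.rpow_add (by positivity), e2, Real.exp_add, Real.exp_add, Real.exp_add, ← e3]
  ring

lemma contDiff_logistic : ContDiff ℝ ∞ logistic :=
  Real.contDiff_exp.div (contDiff_const.add Real.contDiff_exp) fun τ => by positivity

lemma contDiff_one_add_exp_rpow (c : ℝ) : ContDiff ℝ ∞ fun τ => (1 + Real.exp τ) ^ c :=
  (contDiff_const.add Real.contDiff_exp).rpow_const_of_ne fun τ => by positivity

lemma contDiff_exp_const_mul (c : ℝ) : ContDiff ℝ ∞ fun τ => Real.exp (c * τ) :=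
  Real.contDiff_exp.comp (contDiff_const.mul contDiff_id)

lemma contDiff_modeWeight (p β : ℝ) : ContDiff ℝ ∞ (modeWeight p β) :=
  (contDiff_exp_const_mul _).mul (contDiff_one_add_exp_rpow _)

lemma contDiff_linWeight (N : ℕ) (p α : ℝ) : ContDiff ℝ ∞ (linWeight N p α) := by
  have h := (contDiff_const (c := weightConst N p α)).mul (contDiff_modeWeight p (decay N p α))
  have h2 : ContDiff ℝ ∞ fun τ => Real.exp (-((N - 2) * rate p α * τ)) :=
    Real.contDiff_exp.comp (contDiff_const.mul contDiff_id).neg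
  exact h.mul h2

end Coefficients

/-! ### From the weak equation to the radial equations -/

section Fields

variable {N : ℕ} {ν : ℝ}

lemma ae_ne_zero (hN : 1 ≤ N) : ∀ᵐ x : HenonSpace N, x ≠ 0 := by
  have : Nontrivial (HenonSpace N) := by
    have : Nonempty (Fin N) := ⟨⟨0, hN⟩⟩
    infer_instance
  rw [ae_iff]
  simp

/-- The vector field `A ∇H + B H x`, with `A` and `B` functions of `τ = ν⁻¹ log |x|`. The
gradients of the products of `H` with radial functions are of this form. -/
noncomputable def modeField (ν : ℝ) (H : MvPolynomial (Fin N) ℝ) (A B : ℝ → ℝ)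
    (x : HenonSpace N) : HenonSpace N :=
  A (logNorm ν x) • polyGrad H x + (B (logNorm ν x) * polyEval H x) • x

/-- The radial factor of the divergence of the vector field `modeField`, for `H` harmonic and
homogeneous of degree `k`. -/
noncomputable def modeDiv (N k : ℕ) (ν : ℝ) (A B : ℝ → ℝ) (τ : ℝ) : ℝ :=
  k * (ν⁻¹ * deriv A τ * Real.exp (-(2 * ν * τ))) + ν⁻¹ * deriv B τ + (N + k) * B τ

lemma isTest_radialLift_mul (hν : 0 < ν) {c T : ℝ} {η : ℝ → ℝ} (hη : ContDiff ℝ ∞ η)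
    (hbot : ∀ τ ≤ T, η τ = c) {R : ℝ} (htop : ∀ τ, R ≤ τ → η τ = 0)
    (q : MvPolynomial (Fin N) ℝ) :
    IsTest fun x : HenonSpace N => radialLift ν c η x * polyEval q x :=
  ⟨(contDiff_radialLift hν hη hbot).mul (contDiff_polyEval q),
    (hasCompactSupport_radialLift hν htop).mul_right⟩

lemma exists_eq_zero_ends {η : ℝ → ℝ} (hη : HasCompactSupport η) :
    ∃ R, (∀ τ ≤ -R, η τ = 0) ∧ ∀ τ, R ≤ τ → η τ = 0 := by
  obtain ⟨R, -, h⟩ := exists_eq_zero_of_le_abs hη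
  exact ⟨R, fun τ hτ => h τ (le_abs.2 (Or.inr (by linarith))),
    fun τ hτ => h τ (le_abs.2 (Or.inl hτ))⟩

lemma hasGradientAt_comp_logNorm_mul {η : ℝ → ℝ} {x : HenonSpace N} (hx : x ≠ 0)
    (hη : DifferentiableAt ℝ η (logNorm ν x)) (q : MvPolynomial (Fin N) ℝ) :
    HasGradientAt (fun y => η (logNorm ν y) * polyEval q y)
      (η (logNorm ν x) • polyGrad q x +
        polyEval q x • (ν⁻¹ * deriv η (logNorm ν x) * (‖x‖ ^ 2)⁻¹) • x) x :=
  hasGradientAt_mul (hasGradientAt_comp_logNorm hx hη.hasDerivAt) (hasGradientAt_polyEval q x)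

lemma hasGradientAt_radialLift_mul {c : ℝ} {η : ℝ → ℝ} {x : HenonSpace N} (hx : x ≠ 0)
    (hη : DifferentiableAt ℝ η (logNorm ν x)) (q : MvPolynomial (Fin N) ℝ) :
    HasGradientAt (fun y => radialLift ν c η y * polyEval q y)
      (η (logNorm ν x) • polyGrad q x +
        polyEval q x • (ν⁻¹ * deriv η (logNorm ν x) * (‖x‖ ^ 2)⁻¹) • x) x :=
  (hasGradientAt_comp_logNorm_mul hx hη q).congr_of_eventuallyEq
    ((radialLift_eventuallyEq hx).mul (EventuallyEq.refl _ _))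

lemma norm_sq_inv_eq_exp (hν : ν ≠ 0) {x : HenonSpace N} (hx : x ≠ 0) :
    (‖x‖ ^ 2)⁻¹ = Real.exp (-(2 * ν * logNorm ν x)) := by
  rw [Real.exp_neg, exp_mul_logNorm hν hx, Real.rpow_two]

lemma gradient_radialLift_mul (hν : ν ≠ 0) {c : ℝ} {η : ℝ → ℝ} {x : HenonSpace N} (hx : x ≠ 0)
    (hη : DifferentiableAt ℝ η (logNorm ν x)) (H : MvPolynomial (Fin N) ℝ) :
    gradient (fun y => radialLift ν c η y * polyEval H y) x =
      modeField ν H η (fun τ => ν⁻¹ * deriv η τ * Real.exp (-(2 * ν * τ))) x := by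
  rw [(hasGradientAt_radialLift_mul hx hη H).gradient, modeField, norm_sq_inv_eq_exp hν hx,
    smul_smul]
  congr 2
  ring

/-- The components of the weak gradient. -/
lemma IsWeakGradient.integral_component {v : HenonSpace N → ℝ} {G : HenonSpace N → HenonSpace N}
    (hv : IsWeakGradient v G) {η : HenonSpace N → ℝ} (hη : IsTest η) (i : Fin N) :
    ∫ x, v x * gradient η x i = -∫ x, η x * G x i := by
  have h := congrArg (fun y : HenonSpace N => EuclideanSpace.proj (𝕜 := ℝ) i y) (hv.2.2 η hη)
  have i1 : Integrable fun x => v x • gradient η x :=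
    hv.1.integrable_smul_right_of_hasCompactSupport hη.gradient_continuous
      hη.gradient_hasCompactSupport
  have i2 : Integrable fun x => η x • G x :=
    hv.2.1.integrable_smul_left_of_hasCompactSupport hη.1.continuous hη.2
  simp only [map_neg] at h
  rw [← ContinuousLinearMap.integral_comp_comm _ i1,
    ← ContinuousLinearMap.integral_comp_comm _ i2] at h
  simpa using h

/-- The divergence of the vector field `modeField`, with the gradients of its components written
out. -/
lemma sum_gradient_component {k : ℕ} {H : MvPolynomial (Fin N) ℝ} (hH : H ∈ harmonicPoly N k)
    (hν : ν ≠ 0) (A B : ℝ → ℝ) {x : HenonSpace N} (hx : x ≠ 0) :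
    ∑ i, ((A (logNorm ν x) • polyGrad (MvPolynomial.pderiv i H) x +
        polyEval (MvPolynomial.pderiv i H) x •
          (ν⁻¹ * deriv A (logNorm ν x) * (‖x‖ ^ 2)⁻¹) • x) i
      + (B (logNorm ν x) • polyGrad (H * MvPolynomial.X i) x +
        polyEval (H * MvPolynomial.X i) x •
          (ν⁻¹ * deriv B (logNorm ν x) * (‖x‖ ^ 2)⁻¹) • x) i)
      = polyEval H x * modeDiv N k ν A B (logNorm ν x) := by
  set τ := logNorm ν x with hτ
  have e : ∀ i : Fin N, (A τ • polyGrad (MvPolynomial.pderiv i H) x +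
        polyEval (MvPolynomial.pderiv i H) x • (ν⁻¹ * deriv A τ * (‖x‖ ^ 2)⁻¹) • x) i
      + (B τ • polyGrad (H * MvPolynomial.X i) x +
        polyEval (H * MvPolynomial.X i) x • (ν⁻¹ * deriv B τ * (‖x‖ ^ 2)⁻¹) • x) i
      = A τ * polyEval (MvPolynomial.pderiv i (MvPolynomial.pderiv i H)) x
        + (ν⁻¹ * deriv A τ * (‖x‖ ^ 2)⁻¹ + B τ) * (x i * polyEval (MvPolynomial.pderiv i H) x)
        + (ν⁻¹ * deriv B τ * (‖x‖ ^ 2)⁻¹ * polyEval H x) * (x i * x i)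
        + B τ * polyEval H x := fun i => by
    simp
    ring
  have hn : ∑ i, x i * x i = ‖x‖ ^ 2 := by
    rw [← inner_eq_sum, real_inner_self_eq_norm_sq]
  rw [Finset.sum_congr rfl fun i _ => e i, Finset.sum_add_distrib, Finset.sum_add_distrib,
    Finset.sum_add_distrib, ← Finset.mul_sum, ← Finset.mul_sum, ← Finset.mul_sum,
    sum_polyEval_pderiv_pderiv hH, sum_mul_polyEval_pderiv hH.1, hn, Finset.sum_const,
    Finset.card_univ, Fintype.card_fin, nsmul_eq_mul, modeDiv, ← norm_sq_inv_eq_exp hν hx]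
  have hx2 : ‖x‖ ^ 2 ≠ 0 := pow_ne_zero 2 (norm_ne_zero_iff.2 hx)
  field_simp
  ring

lemma isTest_modeField_component (hν : 0 < ν) (H : MvPolynomial (Fin N) ℝ) {A B : ℝ → ℝ}
    (hA : ContDiff ℝ ∞ A) (hAc : HasCompactSupport A) (hB : ContDiff ℝ ∞ B)
    (hBc : HasCompactSupport B) (i : Fin N) :
    IsTest fun x : HenonSpace N => radialLift ν 0 A x * polyEval (MvPolynomial.pderiv i H) x
      + radialLift ν 0 B x * polyEval (H * MvPolynomial.X i) x := by
  obtain ⟨R, h1, h2⟩ := exists_eq_zero_ends hAc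
  obtain ⟨S, h3, h4⟩ := exists_eq_zero_ends hBc
  have t1 := isTest_radialLift_mul hν hA h1 h2 (MvPolynomial.pderiv i H)
  have t2 := isTest_radialLift_mul hν hB h3 h4 (H * MvPolynomial.X i)
  exact ⟨t1.1.add t2.1, t1.2.add t2.2⟩

lemma modeField_component_eq (H : MvPolynomial (Fin N) ℝ) (A B : ℝ → ℝ) {x : HenonSpace N}
    (hx : x ≠ 0) (i : Fin N) :
    radialLift ν 0 A x * polyEval (MvPolynomial.pderiv i H) x
      + radialLift ν 0 B x * polyEval (H * MvPolynomial.X i) x = modeField ν H A B x i := by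
  rw [radialLift_of_ne hx, radialLift_of_ne hx]
  simp [modeField]
  ring

/-- The weak gradient tested with the vector field `modeField`, whose coefficients vanish near
the origin and for large `|x|`. -/
lemma IsWeakGradient.integral_inner_modeField (hN : 1 ≤ N) (hν : 0 < ν)
    {v : HenonSpace N → ℝ} {G : HenonSpace N → HenonSpace N} (hv : IsWeakGradient v G) {k : ℕ}
    {H : MvPolynomial (Fin N) ℝ} (hH : H ∈ harmonicPoly N k) {A B : ℝ → ℝ}
    (hA : ContDiff ℝ ∞ A) (hAc : HasCompactSupport A) (hB : ContDiff ℝ ∞ B)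
    (hBc : HasCompactSupport B) :
    Integrable (fun x => inner ℝ (G x) (modeField ν H A B x)) ∧
    ∫ x, inner ℝ (G x) (modeField ν H A B x)
      = -∫ x, (v x * polyEval H x) * modeDiv N k ν A B (logNorm ν x) := by
  set u := fun (i : Fin N) (x : HenonSpace N) =>
    radialLift ν 0 A x * polyEval (MvPolynomial.pderiv i H) x
      + radialLift ν 0 B x * polyEval (H * MvPolynomial.X i) x with hu
  have ht : ∀ i, IsTest (u i) := isTest_modeField_component hν H hA hAc hB hBc
  have i1 : ∀ i, Integrable fun x => v x * gradient (u i) x i := fun i => by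
    have := (hv.1.integrable_smul_right_of_hasCompactSupport (ht i).gradient_continuous
      (ht i).gradient_hasCompactSupport)
    simpa using (EuclideanSpace.proj (𝕜 := ℝ) i).integrable_comp this
  have i2 : ∀ i, Integrable fun x => u i x * G x i := fun i => by
    have := hv.2.1.integrable_smul_left_of_hasCompactSupport (ht i).1.continuous (ht i).2
    simpa using (EuclideanSpace.proj (𝕜 := ℝ) i).integrable_comp this
  have h1 : ∑ i, ∫ x, v x * gradient (u i) x i = -∑ i, ∫ x, u i x * G x i := by
    rw [← Finset.sum_neg_distrib]
    exact Finset.sum_congr rfl fun i _ => hv.integral_component (ht i) i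
  rw [← integral_finsetSum _ fun i _ => i1 i, ← integral_finsetSum _ fun i _ => i2 i] at h1
  have e1 : ∀ᵐ x : HenonSpace N, ∑ i, v x * gradient (u i) x i
      = (v x * polyEval H x) * modeDiv N k ν A B (logNorm ν x) := by
    filter_upwards [ae_ne_zero hN] with x hx
    rw [← Finset.mul_sum, mul_assoc]
    congr 1
    rw [← sum_gradient_component hH hν.ne' A B hx]
    refine Finset.sum_congr rfl fun i _ => ?_
    have g1 := hasGradientAt_radialLift_mul (c := 0) (ν := ν) hx
      (hA.differentiable (by simp) _) (MvPolynomial.pderiv i H)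
    have g2 := hasGradientAt_radialLift_mul (c := 0) (ν := ν) hx
      (hB.differentiable (by simp) _) (H * MvPolynomial.X i)
    rw [show gradient (u i) x = _ from (hasGradientAt_add g1 g2).gradient]
    rfl
  have e2 : ∀ᵐ x : HenonSpace N, ∑ i, u i x * G x i = inner ℝ (G x) (modeField ν H A B x) := by
    filter_upwards [ae_ne_zero hN] with x hx
    rw [inner_eq_sum]
    refine Finset.sum_congr rfl fun i _ => ?_
    rw [← modeField_component_eq H A B hx i, mul_comm]
  rw [integral_congr_ae e1, integral_congr_ae e2] at h1
  exact ⟨(integrable_finsetSum _ fun i _ => i2 i).congr e2, by linarith⟩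

end Fields

section Forms

variable {N : ℕ} {p α : ℝ}

/-- The form of the linearized equation against the vector field `modeField` is the inner product
with another vector field of this kind. -/
lemma linForm_modeField (hp : 1 < p) (hpN : p < N) (hα : 0 ≤ α) {x : HenonSpace N} (hx : x ≠ 0)
    (g : HenonSpace N) {k : ℕ} {H : MvPolynomial (Fin N) ℝ} (hH : H.IsHomogeneous k)
    (A B : ℝ → ℝ) :
    linForm p α x g (modeField (rate p α) H A B x) =
      inner ℝ g (modeField (rate p α) H (fun τ => linWeight N p α τ * A τ)
        (fun τ => linWeight N p α τ *
          ((p - 1) * B τ + (p - 2) * k * (A τ * Real.exp (-(2 * rate p α * τ))))) x) := by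
  rw [linForm_eq hp hpN hα hx]
  have hE : inner ℝ x (polyGrad H x) = k * polyEval H x := by
    rw [inner_eq_sum, ← sum_mul_polyEval_pderiv hH]
    rfl
  have hx2 : ‖x‖ ^ 2 ≠ 0 := pow_ne_zero 2 (norm_ne_zero_iff.2 hx)
  simp only [modeField, inner_add_right, real_inner_smul_right, hE, real_inner_self_eq_norm_sq,
    real_inner_comm g x, ← norm_sq_inv_eq_exp (rate_pos hp hα).ne' hx]
  field_simp
  ring

end Forms

section Modes

variable {N : ℕ} {ν p α : ℝ} {k : ℕ} {v : HenonSpace N → ℝ} {G : HenonSpace N → HenonSpace N}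
  {H : MvPolynomial (Fin N) ℝ} {f g : ℝ → ℝ}

/-- The function `f` of `τ = ν⁻¹ log |x|` is the coefficient of `v` along `|x|^{-k} H`, for `H`
homogeneous of degree `k`, up to a constant factor that does not depend on `τ`. The factor
`e^{(N+k)ντ}` is the product of the density `|x|^N` of the Lebesgue measure with respect to
`dτ dθ` and of `|x|^k`. -/
def IsModeCoeff (ν : ℝ) (k : ℕ) (H : MvPolynomial (Fin N) ℝ) (v : HenonSpace N → ℝ)
    (f : ℝ → ℝ) : Prop :=
  LocallyIntegrable f ∧ ∀ η : ℝ → ℝ, Continuous η → HasCompactSupport η →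
    ∫ x, (v x * polyEval H x) * η (logNorm ν x)
      = ∫ τ, f τ * (Real.exp ((N + k) * ν * τ) * η τ)

lemma locallyIntegrable_mul_polyEval (hv : LocallyIntegrable v) (H : MvPolynomial (Fin N) ℝ) :
    LocallyIntegrable fun x => v x * polyEval H x := by
  rw [locallyIntegrable_iff] at hv ⊢
  exact fun K hK => (hv K hK).mul_continuousOn (contDiff_polyEval H).continuous.continuousOn hK

lemma exists_isModeCoeff (hN : 1 ≤ N) (hν : 0 < ν) (hv : LocallyIntegrable v) (k : ℕ)
    (H : MvPolynomial (Fin N) ℝ) : ∃ f, IsModeCoeff ν k H v f := by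
  obtain ⟨f, hf, h⟩ := exists_polarDensity hN hν (locallyIntegrable_mul_polyEval hv H)
  refine ⟨fun τ => f τ * Real.exp (-((N + k) * ν * τ)), ?_, fun η hη hc => ?_⟩
  · rw [locallyIntegrable_iff] at hf ⊢
    exact fun K hK => (hf K hK).mul_continuousOn (by fun_prop) hK
  · refine (h η hη hc).trans (integral_congr_ae (Eventually.of_forall fun τ => ?_))
    simp only [Real.exp_neg]
    field_simp

lemma IsModeCoeff.congr (h : IsModeCoeff ν k H v f) (e : ∀ᵐ τ, f τ = g τ) :
    IsModeCoeff ν k H v g :=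
  ⟨h.1.congr e, fun η hη hc => (h.2 η hη hc).trans (integral_congr_ae (by
    filter_upwards [e] with τ hτ
    rw [hτ]))⟩

lemma modeDiv_exp_mul (hν : ν ≠ 0) {A B : ℝ → ℝ} {τ : ℝ} (hA : DifferentiableAt ℝ A τ)
    (hB : DifferentiableAt ℝ B τ) :
    modeDiv N k ν (fun s => Real.exp (-((N - 2 + k) * ν * s)) * A s)
        (fun s => Real.exp (-((N + k) * ν * s)) * B s) τ
      = Real.exp (-((N + k) * ν * τ)) *
        (ν⁻¹ * (k * deriv A τ + deriv B τ) - k * (k + N - 2) * A τ) := by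
  have h1 : ∀ c : ℝ, HasDerivAt (fun s => Real.exp (-(c * ν * s)))
      (-(c * ν) * Real.exp (-(c * ν * τ))) τ := fun c => by
    have := hasDerivAt_exp_const_mul (-(c * ν)) τ
    simpa only [neg_mul] using this
  have e : Real.exp (-((N - 2 + k) * ν * τ)) * Real.exp (-(2 * ν * τ))
      = Real.exp (-((N + k) * ν * τ)) := by
    rw [← Real.exp_add]; ring_nf
  have d1 : deriv (fun s => Real.exp (-((N - 2 + k) * ν * s)) * A s) τ = _ :=
    ((h1 (N - 2 + k)).mul hA.hasDerivAt).deriv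
  have d2 : deriv (fun s => Real.exp (-((N + k) * ν * s)) * B s) τ = _ :=
    ((h1 (N + k)).mul hB.hasDerivAt).deriv
  rw [modeDiv, d1, d2, ← e]
  field_simp
  ring

/-- A vector field `modeField`, with the coefficients scaled so that the form of the linearized
equation reduces to an integral with the weight `ω`. -/
noncomputable def scaledField (ν : ℝ) (k : ℕ) (H : MvPolynomial (Fin N) ℝ) (A B : ℝ → ℝ) :
    HenonSpace N → HenonSpace N :=
  modeField ν H (fun τ => Real.exp (-(k * ν * τ)) * A τ)
    (fun τ => Real.exp (-((k + 2) * ν * τ)) * B τ)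

/-- The form of the linearized equation against `scaledField`, with its weight expressed through
`ω`. -/
lemma linForm_scaledField (hp : 1 < p) (hpN : p < N) (hα : 0 ≤ α) {x : HenonSpace N}
    (hx : x ≠ 0) (y : HenonSpace N) (hH : H.IsHomogeneous k) (A B : ℝ → ℝ) :
    linForm p α x y (scaledField (rate p α) k H A B x)
      = inner ℝ y (modeField (rate p α) H
          (fun τ => Real.exp (-((N - 2 + k) * rate p α * τ)) *
            (weightConst N p α * (modeWeight p (decay N p α) τ * A τ)))
          (fun τ => Real.exp (-((N + k) * rate p α * τ)) * (weightConst N p α *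
            (modeWeight p (decay N p α) τ * ((p - 1) * B τ + (p - 2) * k * A τ)))) x) := by
  set ν := rate p α with hνd
  rw [scaledField, linForm_modeField hp hpN hα hx _ hH]
  congr 2
  · funext τ
    have : Real.exp (-((N - 2 + k) * ν * τ))
        = Real.exp (-((N - 2) * ν * τ)) * Real.exp (-(k * ν * τ)) := by
      rw [← Real.exp_add]; ring_nf
    rw [this, linWeight]
    ring
  · funext τ
    have h1 : Real.exp (-((N + k) * ν * τ)) = Real.exp (-((N - 2) * ν * τ)) *
        (Real.exp (-(k * ν * τ)) * Real.exp (-(2 * ν * τ))) := by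
      rw [← Real.exp_add, ← Real.exp_add]; ring_nf
    have h2 : Real.exp (-((k + 2) * ν * τ))
        = Real.exp (-(k * ν * τ)) * Real.exp (-(2 * ν * τ)) := by
      rw [← Real.exp_add]; ring_nf
    rw [h1, h2, linWeight]
    ring

/-- The left-hand side of the linearized equation, with `∇η` replaced by `scaledField`, in terms of
the coefficient `f` only: the weak gradient is integrated by parts. -/
lemma IsModeCoeff.integral_linForm_scaledField (hN : 1 ≤ N) (hp : 1 < p) (hpN : p < N)
    (hα : 0 ≤ α) (hv : IsWeakGradient v G) (hH : H ∈ harmonicPoly N k)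
    (hf : IsModeCoeff (rate p α) k H v f) {A B : ℝ → ℝ}
    (hA : ContDiff ℝ ∞ A) (hAc : HasCompactSupport A) (hB : ContDiff ℝ ∞ B)
    (hBc : HasCompactSupport B) :
    Integrable (fun x => linForm p α x (G x) (scaledField (rate p α) k H A B x)) ∧
    ∫ x, linForm p α x (G x) (scaledField (rate p α) k H A B x)
      = -(weightConst N p α * ∫ τ, f τ * ((rate p α)⁻¹ * (p - 1) *
          deriv (fun s => modeWeight p (decay N p α) s * (k * A s + B s)) τ
          - k * (k + N - 2) * (modeWeight p (decay N p α) τ * A τ))) := by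
  set ν := rate p α with hνd
  have hν : 0 < ν := rate_pos hp hα
  set w := modeWeight p (decay N p α) with hw
  set κ := weightConst N p α with hκ
  have hws : ContDiff ℝ ∞ w := contDiff_modeWeight _ _
  set A₁ : ℝ → ℝ := fun τ => κ * (w τ * A τ) with hA₁
  set B₁ : ℝ → ℝ := fun τ => κ * (w τ * ((p - 1) * B τ + (p - 2) * k * A τ)) with hB₁
  have hA₁s : ContDiff ℝ ∞ A₁ := contDiff_const.mul (hws.mul hA)
  have hB₁s : ContDiff ℝ ∞ B₁ := contDiff_const.mul (hws.mul
    ((contDiff_const.mul hB).add (contDiff_const.mul hA)))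
  have hexp : ∀ c : ℝ, ContDiff ℝ ∞ fun τ => Real.exp (-(c * ν * τ)) := fun c => by
    simpa only [neg_mul] using contDiff_exp_const_mul (-(c * ν))
  have h := hv.integral_inner_modeField hN hν hH ((hexp (N - 2 + k)).mul hA₁s)
    (hAc.mul_left.mul_left.mul_left) ((hexp (N + k)).mul hB₁s)
    ((hBc.mul_left.add hAc.mul_left).mul_left.mul_left.mul_left)
  have e : ∀ᵐ x : HenonSpace N,
      inner ℝ (G x) (modeField ν H (fun τ => Real.exp (-((N - 2 + k) * ν * τ)) * A₁ τ)
        (fun τ => Real.exp (-((N + k) * ν * τ)) * B₁ τ) x)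
      = linForm p α x (G x) (scaledField ν k H A B x) := by
    filter_upwards [ae_ne_zero hN] with x hx
    exact (linForm_scaledField hp hpN hα hx _ hH.1 A B).symm
  refine ⟨h.1.congr e, ?_⟩
  rw [← integral_congr_ae e, h.2]
  set D : ℝ → ℝ := fun τ => ν⁻¹ * (k * deriv A₁ τ + deriv B₁ τ) - k * (k + N - 2) * A₁ τ with hD
  have e2 : ∀ τ, modeDiv N k ν (fun τ => Real.exp (-((N - 2 + k) * ν * τ)) * A₁ τ)
        (fun τ => Real.exp (-((N + k) * ν * τ)) * B₁ τ) τ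
      = Real.exp (-((N + k) * ν * τ)) * D τ := fun τ =>
    modeDiv_exp_mul hν.ne' (hA₁s.differentiable (by simp) τ) (hB₁s.differentiable (by simp) τ)
  have hAc₁ : HasCompactSupport A₁ := hAc.mul_left.mul_left
  have hBc₁ : HasCompactSupport B₁ := (hBc.mul_left.add hAc.mul_left).mul_left.mul_left
  have hDc : Continuous D := by
    have := (contDiff_infty_iff_deriv.1 hA₁s).2.continuous
    have := (contDiff_infty_iff_deriv.1 hB₁s).2.continuous
    have := hA₁s.continuous
    fun_prop
  have hDs : HasCompactSupport D :=
    (HasCompactSupport.mul_left (hAc₁.deriv.mul_left.add hBc₁.deriv)).sub hAc₁.mul_left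
  simp only [e2]
  rw [hf.2 (fun τ => Real.exp (-((N + k) * ν * τ)) * D τ) (by fun_prop) hDs.mul_left,
    ← integral_const_mul]
  congr 1
  refine integral_congr_ae (Eventually.of_forall fun τ => ?_)
  have dA := (hA.differentiable (by simp) τ).hasDerivAt
  have dB := (hB.differentiable (by simp) τ).hasDerivAt
  have dw := (hws.differentiable (by simp) τ).hasDerivAt
  have d1 : deriv A₁ τ = _ := ((dw.mul dA).const_mul κ).deriv
  have d2 : deriv B₁ τ = _ := ((dw.mul ((dB.const_mul (p - 1)).add
    (dA.const_mul ((p - 2) * k)))).const_mul κ).deriv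
  have d3 : deriv (fun s => w s * (k * A s + B s)) τ = _ :=
    (dw.mul ((dA.const_mul (k : ℝ)).add dB)).deriv
  simp only [hD]
  rw [d1, d2, d3]
  simp only [hA₁]
  rw [← mul_assoc (Real.exp _) (Real.exp _), ← Real.exp_add, add_neg_cancel, Real.exp_zero]
  simp only [Pi.add_apply, one_mul]
  ring

/-- The coefficient `Λ` of the radial equation for the spherical harmonics of degree `k`. -/
noncomputable def modeEigenvalue (N : ℕ) (p α : ℝ) (k : ℕ) : ℝ :=
  k * (k + N - 2) * rate p α ^ 2 / (p - 1)

lemma IsModeCoeff.integral_linPotential_mul (hN : 1 ≤ N) (hp : 1 < p) (hpN : p < N)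
    (hα : 0 ≤ α) (hf : IsModeCoeff (rate p α) k H v f) {ψ : ℝ → ℝ} (hψ : Continuous ψ)
    (hψc : HasCompactSupport ψ) (c : ℝ) :
    ∫ x, linPotential p α x * v x *
        (radialLift (rate p α) c (fun τ => Real.exp (-(k * rate p α * τ)) * ψ τ) x * polyEval H x)
      = potentialConst N p α * weightConst N p α * ∫ τ, f τ *
          (modeWeight p (decay N p α) τ * (logistic τ * (1 - logistic τ)) * ψ τ) := by
  set ν := rate p α with hνd
  have hν : 0 < ν := rate_pos hp hα
  set χ : ℝ → ℝ := fun τ => potentialConst N p α * (linWeight N p α τ *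
    Real.exp (-(2 * ν * τ)) * (logistic τ * (1 - logistic τ))) *
      (Real.exp (-(k * ν * τ)) * ψ τ) with hχ
  have e : ∀ᵐ x : HenonSpace N, linPotential p α x * v x *
        (radialLift ν c (fun τ => Real.exp (-(k * ν * τ)) * ψ τ) x * polyEval H x)
      = (v x * polyEval H x) * χ (logNorm ν x) := by
    filter_upwards [ae_ne_zero hN] with x hx
    rw [linPotential_eq hp hpN hα hx, radialLift_of_ne hx, norm_sq_inv_eq_exp hν.ne' hx, hχ]
    ring
  have h1 := (contDiff_linWeight N p α).continuous
  have h2 := contDiff_logistic.continuous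
  rw [integral_congr_ae e, hf.2 χ (by fun_prop) hψc.mul_left.mul_left, ← integral_const_mul]
  refine integral_congr_ae (Eventually.of_forall fun τ => ?_)
  have h3 : Real.exp ((N + k) * ν * τ) * (Real.exp (-((N - 2) * ν * τ)) *
      (Real.exp (-(2 * ν * τ)) * Real.exp (-(k * ν * τ)))) = 1 := by
    rw [← Real.exp_add, ← Real.exp_add, ← Real.exp_add, ← Real.exp_zero]
    ring_nf
  simp only [hχ, linWeight]
  linear_combination (f τ * potentialConst N p α * weightConst N p α *
    modeWeight p (decay N p α) τ * (logistic τ * (1 - logistic τ)) * ψ τ) * h3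

lemma gradient_radialLift_exp_mul (hν : ν ≠ 0) {c : ℝ} {ψ : ℝ → ℝ} (hψ : Differentiable ℝ ψ)
    {x : HenonSpace N} (hx : x ≠ 0) :
    gradient (fun y => radialLift ν c (fun τ => Real.exp (-(k * ν * τ)) * ψ τ) y * polyEval H y) x
      = scaledField ν k H ψ (fun τ => ν⁻¹ * deriv ψ τ - k * ψ τ) x := by
  have h1 : ∀ τ, HasDerivAt (fun s => Real.exp (-(k * ν * s)) * ψ s)
      (-(k * ν) * Real.exp (-(k * ν * τ)) * ψ τ + Real.exp (-(k * ν * τ)) * deriv ψ τ) τ :=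
    fun τ => by
      have h0 : HasDerivAt (fun s => Real.exp (-(k * ν * s)))
          (-(k * ν) * Real.exp (-(k * ν * τ))) τ := by
        simpa only [neg_mul] using hasDerivAt_exp_const_mul (-(k * ν)) τ
      exact h0.mul (hψ τ).hasDerivAt
  rw [gradient_radialLift_mul hν hx (h1 _).differentiableAt, scaledField]
  congr 1
  funext τ
  have h2 : Real.exp (-((k + 2) * ν * τ)) = Real.exp (-(k * ν * τ)) * Real.exp (-(2 * ν * τ)) := by
    rw [← Real.exp_add]; ring_nf
  rw [(h1 τ).deriv, h2]
  field_simp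
  ring

/-- The weak form of the radial equation. -/
lemma IsModeCoeff.weak_radial_equation (hN : 1 ≤ N) (hp : 1 < p) (hpN : p < N) (hα : 0 ≤ α)
    (hv : IsWeakGradient v G) (hs : SolvesLinearized p α v G) (hH : H ∈ harmonicPoly N k)
    (hf : IsModeCoeff (rate p α) k H v f) {ψ : ℝ → ℝ} (hψ : ContDiff ℝ ∞ ψ)
    (hψc : HasCompactSupport ψ) :
    ∫ τ, f τ * deriv (fun s => modeWeight p (decay N p α) s * deriv ψ s) τ
      = ∫ τ, modeWeight p (decay N p α) τ * (modeEigenvalue N p α k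
          - (decay N p α ^ 2 * (p - 1) + decay N p α) * (logistic τ * (1 - logistic τ)))
          * f τ * ψ τ := by
  have hν := rate_pos hp hα
  have hψ' := (contDiff_infty_iff_deriv.1 hψ).2
  have hws := contDiff_modeWeight p (decay N p α)
  have hexp : ContDiff ℝ ∞ fun τ => Real.exp (-(k * rate p α * τ)) := by
    simpa only [neg_mul] using contDiff_exp_const_mul (-(k * rate p α))
  obtain ⟨R, hbot, htop⟩ := exists_eq_zero_ends hψc
  have ht := isTest_radialLift_mul hν (hexp.mul hψ)
    (fun τ hτ => by rw [hbot τ hτ, mul_zero] : ∀ τ ≤ -R, _ = (0 : ℝ))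
    (fun τ hτ => by rw [htop τ hτ, mul_zero] : ∀ τ, R ≤ τ → _ = (0 : ℝ)) H
  obtain ⟨-, -, h⟩ := hs _ ht
  obtain ⟨-, h2⟩ := hf.integral_linForm_scaledField hN hp hpN hα hv hH hψ hψc
    ((contDiff_const (c := (rate p α)⁻¹)).mul hψ' |>.sub ((contDiff_const (c := (k : ℝ))).mul hψ))
    (hψc.deriv.mul_left.sub hψc.mul_left)
  rw [hf.integral_linPotential_mul hN hp hpN hα hψ.continuous hψc] at h
  have e : ∀ᵐ x : HenonSpace N, linForm p α x (G x) (gradient (fun y => radialLift (rate p α) 0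
        (fun τ => Real.exp (-(k * rate p α * τ)) * ψ τ) y * polyEval H y) x)
      = linForm p α x (G x) (scaledField (rate p α) k H ψ
          (fun τ => (rate p α)⁻¹ * deriv ψ τ - k * ψ τ) x) := by
    filter_upwards [ae_ne_zero hN] with x hx
    rw [gradient_radialLift_exp_mul hν.ne' (hψ.differentiable (by simp)) hx]
  rw [integral_congr_ae e, h2] at h
  set w := modeWeight p (decay N p α) with hw
  have hκ := weightConst_pos hp hpN hα
  have mulint : ∀ {χ : ℝ → ℝ}, Continuous χ → HasCompactSupport χ →
      Integrable fun τ => f τ * χ τ := fun {χ} h1 h2 => by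
    simpa using hf.1.integrable_smul_right_of_hasCompactSupport h1 h2
  have hd := (contDiff_infty_iff_deriv.1 (hws.mul hψ')).2
  have i1 : Integrable fun τ => f τ * deriv (fun s => w s * deriv ψ s) τ :=
    mulint hd.continuous (hψc.deriv.mul_left (f := w)).deriv
  have i2 : Integrable fun τ => f τ * (w τ * ψ τ) :=
    mulint (hws.continuous.mul hψ.continuous) hψc.mul_left
  have hlc := contDiff_logistic.continuous
  have hwc := hws.continuous
  have hψ0 := hψ.continuous
  have i3 : Integrable fun τ => f τ * (w τ * (logistic τ * (1 - logistic τ)) * ψ τ) :=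
    mulint (by fun_prop) hψc.mul_left
  have e1 : (fun τ => f τ * ((rate p α)⁻¹ * (p - 1) *
      deriv (fun s => w s * (k * ψ s + ((rate p α)⁻¹ * deriv ψ s - k * ψ s))) τ
        - k * (k + N - 2) * (w τ * ψ τ)))
      = fun τ => ((rate p α)⁻¹ ^ 2 * (p - 1)) * (f τ * deriv (fun s => w s * deriv ψ s) τ)
        - k * (k + N - 2) * (f τ * (w τ * ψ τ)) := by
    funext τ
    have e0 : (fun s => w s * (k * ψ s + ((rate p α)⁻¹ * deriv ψ s - k * ψ s)))
        = fun s => (rate p α)⁻¹ * (w s * deriv ψ s) := by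
      funext s; ring
    rw [e0, deriv_const_mul_field]
    ring
  have e2 : (fun τ => w τ * (modeEigenvalue N p α k
          - (decay N p α ^ 2 * (p - 1) + decay N p α) * (logistic τ * (1 - logistic τ)))
          * f τ * ψ τ) = fun τ => modeEigenvalue N p α k * (f τ * (w τ * ψ τ))
        - (decay N p α ^ 2 * (p - 1) + decay N p α)
          * (f τ * (w τ * (logistic τ * (1 - logistic τ)) * ψ τ)) := by
    funext τ; ring
  rw [e2, integral_sub (i2.const_mul _) (i3.const_mul _), integral_const_mul, integral_const_mul]
  rw [e1, integral_sub (i1.const_mul _) (i2.const_mul _), integral_const_mul,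
    integral_const_mul] at h
  have hp1 : p - 1 ≠ 0 := by linarith
  have hν0 := hν.ne'
  rw [modeEigenvalue]
  rw [potentialConst] at h
  field_simp at h ⊢
  linear_combination -h

/-- The coefficients of a solution along the spherical harmonics solve the radial equation. -/
theorem exists_isModeSolution (hN : 1 ≤ N) (hp : 1 < p) (hpN : p < N) (hα : 0 ≤ α)
    (hv : IsWeakGradient v G) (hs : SolvesLinearized p α v G) (hH : H ∈ harmonicPoly N k) :
    ∃ f g, IsModeCoeff (rate p α) k H v f ∧
      IsModeSolution p (decay N p α) (modeEigenvalue N p α k) f g := by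
  obtain ⟨f₀, hf₀⟩ := exists_isModeCoeff hN (rate_pos hp hα) hv.1 k H
  have hlc := contDiff_logistic.continuous
  have hwc := (contDiff_modeWeight p (decay N p α)).continuous
  obtain ⟨f, g, hfe, hf, hg⟩ := exists_classical_of_weak
    (P := modeWeight p (decay N p α)) (q := fun τ => modeWeight p (decay N p α) τ *
      (modeEigenvalue N p α k
        - (decay N p α ^ 2 * (p - 1) + decay N p α) * (logistic τ * (1 - logistic τ))))
    (contDiff_modeWeight p (decay N p α)) (fun τ => modeWeight_pos _ _ τ) (by fun_prop) hf₀.1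
    (fun χ hχ hχc => hf₀.weak_radial_equation hN hp hpN hα hv hs hH hχ hχc)
  refine ⟨f, g, hf₀.congr hfe, hf, fun τ => ?_⟩
  have hw := modeWeight_pos p (decay N p α)
  have h1 := (hg τ).div (hasDerivAt_modeWeight p (decay N p α) τ) (hw τ).ne'
  have e : (fun s => modeWeight p (decay N p α) s * g s) / modeWeight p (decay N p α) = g := by
    funext s
    simp only [Pi.div_apply]
    rw [mul_div_cancel_left₀ _ (hw s).ne']
  rw [e] at h1
  refine h1.congr_deriv ?_
  have := (hw τ).ne'
  field_simp
  ring

end Modes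

/-! ### Behaviour of a solution at the origin and at infinity -/

section Cutoff

/-- A smooth function equal to `1` on `(-∞, -1]` and to `0` on `[1, ∞)`, with derivative
`-bumpFn`. -/
noncomputable def cutoffFn (t : ℝ) : ℝ := ∫ s in t..1, bumpFn s

lemma hasDerivAt_cutoffFn (t : ℝ) : HasDerivAt cutoffFn (-bumpFn t) t := by
  have h := (contDiff_bumpFn.continuous.integral_hasStrictDerivAt 1 t).hasDerivAt.neg
  refine h.congr_of_eventuallyEq (Eventually.of_forall fun s => ?_)
  simp only [cutoffFn, Pi.neg_apply]
  rw [intervalIntegral.integral_symm]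

lemma contDiff_cutoffFn : ContDiff ℝ ∞ cutoffFn := by
  rw [contDiff_infty_iff_deriv]
  refine ⟨fun t => (hasDerivAt_cutoffFn t).differentiableAt, ?_⟩
  rw [show deriv cutoffFn = fun t => -bumpFn t from funext fun t => (hasDerivAt_cutoffFn t).deriv]
  exact contDiff_bumpFn.neg

lemma cutoffFn_eq_zero {t : ℝ} (h : 1 ≤ t) : cutoffFn t = 0 := by
  rw [cutoffFn, intervalIntegral.integral_symm, neg_eq_zero]
  have : ∀ s ∈ Set.uIcc 1 t, bumpFn s = 0 := fun s hs => by
    rw [Set.uIcc_of_le h] at hs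
    exact bumpFn_eq_zero (hs.1.trans (le_abs_self s))
  rw [intervalIntegral.integral_congr this]
  simp

lemma cutoffFn_eq_one {t : ℝ} (h : t ≤ -1) : cutoffFn t = 1 := by
  rw [← integral_bumpFn]
  refine intervalIntegral.integral_eq_integral_of_support_subset fun s hs => ?_
  by_contra hc
  refine hs (bumpFn_eq_zero ?_)
  rw [Set.mem_Ioc, not_and_or, not_lt, not_le] at hc
  rcases hc with hc | hc
  · exact le_abs.2 (Or.inr (by linarith))
  · exact le_abs.2 (Or.inl hc.le)

lemma abs_cutoffFn_le (t : ℝ) : |cutoffFn t| ≤ 1 := by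
  have anti : Antitone cutoffFn := antitone_of_hasDerivAt_nonpos hasDerivAt_cutoffFn
    fun t => neg_nonpos.2 (bumpFn_nonneg t)
  have h0 : 0 ≤ cutoffFn t := by
    rw [← cutoffFn_eq_zero (le_max_right t 1)]
    exact anti (le_max_left t 1)
  rw [abs_of_nonneg h0, ← cutoffFn_eq_one (min_le_right t (-1))]
  exact anti (min_le_left t (-1))

lemma contDiff_cutoffFn_add (σ : ℝ) : ContDiff ℝ ∞ fun τ => cutoffFn (τ + σ) :=
  contDiff_cutoffFn.comp (contDiff_id.add contDiff_const)

lemma hasDerivAt_cutoffFn_add (σ τ : ℝ) :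
    HasDerivAt (fun τ => cutoffFn (τ + σ)) (-bumpFn (τ + σ)) τ := by
  simpa using (hasDerivAt_cutoffFn (τ + σ)).comp_add_const τ σ

end Cutoff

section Limits

variable {N : ℕ} {ν p α : ℝ} {k : ℕ} {v : HenonSpace N → ℝ} {G : HenonSpace N → HenonSpace N}
  {H : MvPolynomial (Fin N) ℝ} {f g : ℝ → ℝ}

lemma linForm_comm (x g h : HenonSpace N) : linForm p α x g h = linForm p α x h g := by
  simp only [linForm, real_inner_comm g h]
  ring

lemma linForm_add_right (x g h₁ h₂ : HenonSpace N) :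
    linForm p α x g (h₁ + h₂) = linForm p α x g h₁ + linForm p α x g h₂ := by
  rw [linForm_comm, linForm_add, linForm_comm x h₁, linForm_comm x h₂]

lemma linForm_smul_right (c : ℝ) (x g h : HenonSpace N) :
    linForm p α x g (c • h) = c * linForm p α x g h := by
  rw [linForm_comm, linForm_smul, linForm_comm x h]

/-- The integral of the form against `scaledField` in terms of `f` and `f'`, by a second
integration by parts in `τ` and the radial equation. -/
lemma IsModeCoeff.integral_linForm_scaledField_eq (hN : 1 ≤ N) (hp : 1 < p) (hpN : p < N)
    (hα : 0 ≤ α) (hv : IsWeakGradient v G) (hH : H ∈ harmonicPoly N k)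
    (hf : IsModeCoeff (rate p α) k H v f)
    (hs : IsModeSolution p (decay N p α) (modeEigenvalue N p α k) f g) {A B : ℝ → ℝ}
    (hA : ContDiff ℝ ∞ A) (hAc : HasCompactSupport A) (hB : ContDiff ℝ ∞ B)
    (hBc : HasCompactSupport B) :
    ∫ x, linForm p α x (G x) (scaledField (rate p α) k H A B x)
      = weightConst N p α * ((rate p α)⁻¹ ^ 2 * (p - 1)) * ∫ τ, modeWeight p (decay N p α) τ *
          (rate p α * g τ * (k * A τ + B τ) + modeEigenvalue N p α k * f τ * A τ) := by
  rw [(hf.integral_linForm_scaledField hN hp hpN hα hv hH hA hAc hB hBc).2]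
  have hν := rate_pos hp hα
  set ν := rate p α with hνd
  set w := modeWeight p (decay N p α) with hw
  have hws : ContDiff ℝ ∞ w := contDiff_modeWeight _ _
  have hwA : ContDiff ℝ ∞ fun s => w s * (k * A s + B s) :=
    hws.mul ((contDiff_const.mul hA).add hB)
  have hwAc : HasCompactSupport fun s => w s * (k * A s + B s) :=
    (hAc.mul_left.add hBc).mul_left
  have hwA' := (contDiff_infty_iff_deriv.1 hwA).2.continuous
  have hfc := hs.continuous
  have hgc := hs.continuous_deriv
  have hAc0 := hA.continuous
  have hwc := hws.continuous
  have i1 : Integrable fun τ => f τ * deriv (fun s => w s * (k * A s + B s)) τ :=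
    (hfc.mul hwA').integrable_of_hasCompactSupport hwAc.deriv.mul_left
  have i2 : Integrable fun τ => g τ * (w τ * (k * A τ + B τ)) :=
    (hgc.mul hwA.continuous).integrable_of_hasCompactSupport hwAc.mul_left
  have i3 : Integrable fun τ => f τ * (w τ * (k * A τ + B τ)) :=
    (hfc.mul hwA.continuous).integrable_of_hasCompactSupport hwAc.mul_left
  have i4 : Integrable fun τ => f τ * (w τ * A τ) :=
    (hfc.mul (hwc.mul hAc0)).integrable_of_hasCompactSupport hAc.mul_left.mul_left
  have ibp := integral_mul_deriv_eq_deriv_mul_of_integrable (fun τ _ => hs.1 τ)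
    (fun τ _ => (hwA.differentiable (by simp) τ).hasDerivAt) i1 i2 i3
  have e1 : (fun τ => f τ * (ν⁻¹ * (p - 1) * deriv (fun s => w s * (k * A s + B s)) τ
      - k * (k + N - 2) * (w τ * A τ)))
      = fun τ => ν⁻¹ * (p - 1) * (f τ * deriv (fun s => w s * (k * A s + B s)) τ)
        - k * (k + N - 2) * (f τ * (w τ * A τ)) := by
    funext τ; ring
  have e2 : (fun τ => w τ * (ν * g τ * (k * A τ + B τ) + modeEigenvalue N p α k * f τ * A τ))
      = fun τ => ν * (g τ * (w τ * (k * A τ + B τ)))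
        + modeEigenvalue N p α k * (f τ * (w τ * A τ)) := by
    funext τ; ring
  rw [e1, e2, integral_sub (i1.const_mul _) (i4.const_mul _), integral_const_mul,
    integral_const_mul, integral_add (i2.const_mul _) (i4.const_mul _), integral_const_mul,
    integral_const_mul, ibp, modeEigenvalue, ← hνd]
  have hp1 : p - 1 ≠ 0 := by linarith
  have hν0 := hν.ne'
  field_simp
  ring

/-- The mass of an integrable function in small balls around the origin tends to zero. -/
lemma tendsto_integral_mul_comp_logNorm_add {E : HenonSpace N → ℝ}
    (hE : Integrable E) {ζ : ℝ → ℝ} (hζ : Continuous ζ) {M : ℝ} (hM : ∀ t, |ζ t| ≤ M)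
    (h0 : ∀ t, 1 ≤ t → ζ t = 0) :
    Tendsto (fun σ => ∫ x, E x * ζ (logNorm ν x + σ)) atTop (𝓝 0) := by
  rw [← integral_zero (HenonSpace N) ℝ]
  have hm : Measurable (logNorm (N := N) ν) := measurable_logNorm ν
  refine tendsto_integral_filter_of_dominated_convergence (fun x => ‖E x‖ * M)
    (Eventually.of_forall fun σ => hE.aestronglyMeasurable.mul
      (hζ.measurable.comp (hm.add_const σ)).aestronglyMeasurable)
    (Eventually.of_forall fun σ => Eventually.of_forall fun x => ?_) (hE.norm.mul_const M) ?_
  · rw [norm_mul]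
    exact mul_le_mul_of_nonneg_left (hM _) (norm_nonneg _)
  · refine Eventually.of_forall fun x => tendsto_const_nhds.congr' ?_
    filter_upwards [eventually_ge_atTop (1 - logNorm ν x)] with σ hσ
    rw [h0 _ (by linarith), mul_zero]

/-- The test function equal to `H` near the origin, cut off at `|x| = e^{-νσ}`. -/
noncomputable def originTest (ν : ℝ) (H : MvPolynomial (Fin N) ℝ) (σ : ℝ) (x : HenonSpace N) : ℝ :=
  radialLift ν 1 (fun τ => cutoffFn (τ + σ)) x * polyEval H x

lemma isTest_originTest (hν : 0 < ν) (H : MvPolynomial (Fin N) ℝ) (σ : ℝ) :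
    IsTest (originTest ν H σ) :=
  isTest_radialLift_mul hν (contDiff_cutoffFn_add σ) (T := -σ - 1) (R := 1 - σ)
    (fun τ hτ => cutoffFn_eq_one (by linarith)) (fun τ hτ => cutoffFn_eq_zero (by linarith)) H

lemma scaledField_exp_bump_zero (x : HenonSpace N) (σ : ℝ) :
    scaledField ν k H (fun τ => Real.exp (k * ν * τ) * bumpFn (τ + σ)) 0 x
      = bumpFn (logNorm ν x + σ) • polyGrad H x := by
  simp only [scaledField, modeField, ← mul_assoc, ← Real.exp_add]
  simp

lemma scaledField_zero_exp_bump (x : HenonSpace N) (σ : ℝ) :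
    scaledField ν k H 0 (fun τ => Real.exp (k * ν * τ) * bumpFn (τ + σ)) x
      = (Real.exp (-(2 * ν * logNorm ν x)) * bumpFn (logNorm ν x + σ) * polyEval H x) • x := by
  simp only [scaledField, modeField, ← mul_assoc, ← Real.exp_add]
  simp only [Pi.zero_apply, mul_zero, zero_smul, zero_add]
  congr 4
  ring

lemma gradient_originTest (hν : 0 < ν) {x : HenonSpace N} (hx : x ≠ 0) (σ : ℝ) :
    gradient (originTest ν H σ) x = cutoffFn (logNorm ν x + σ) • polyGrad H x
      + (-ν⁻¹) • scaledField ν k H 0 (fun τ => Real.exp (k * ν * τ) * bumpFn (τ + σ)) x := by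
  have h := gradient_radialLift_mul (c := 1) hν.ne' hx
    (hasDerivAt_cutoffFn_add σ (logNorm ν x)).differentiableAt H
  rw [show gradient (originTest ν H σ) x = _ from h, modeField,
    (hasDerivAt_cutoffFn_add σ (logNorm ν x)).deriv, scaledField_zero_exp_bump, smul_smul]
  congr 2
  ring

lemma gradient_originTest_of_le (hν : 0 < ν) {x : HenonSpace N} (hx : x ≠ 0)
    (h : logNorm ν x ≤ -1) : gradient (originTest ν H 0) x = polyGrad H x := by
  rw [gradient_originTest (k := 0) hν hx, scaledField_zero_exp_bump, add_zero, cutoffFn_eq_one h,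
    bumpFn_eq_zero (le_abs.2 (Or.inr (by linarith)))]
  simp

lemma contDiff_exp_mul_bump (c σ : ℝ) :
    ContDiff ℝ ∞ fun τ => Real.exp (c * τ) * bumpFn (τ + σ) :=
  (contDiff_exp_const_mul c).mul (contDiff_bumpFn_add σ)

lemma hasCompactSupport_exp_mul_bump (c σ : ℝ) :
    HasCompactSupport fun τ => Real.exp (c * τ) * bumpFn (τ + σ) :=
  (hasCompactSupport_bumpFn_add σ).mul_left

/-- The flux of a solution through small spheres tends to zero, by the equation tested with
functions equal to `H` near the origin. -/
lemma IsModeCoeff.tendsto_flux (hN : 1 ≤ N) (hp : 1 < p) (hpN : p < N) (hα : 0 ≤ α)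
    (hv : IsWeakGradient v G) (hs : SolvesLinearized p α v G) (hH : H ∈ harmonicPoly N k)
    (hf : IsModeCoeff (rate p α) k H v f)
    (hm : IsModeSolution p (decay N p α) (modeEigenvalue N p α k) f g) :
    Tendsto (fun σ => ∫ τ, bumpFn (τ + σ) *
      (modeWeight p (decay N p α) τ * Real.exp (k * rate p α * τ) * g τ)) atTop (𝓝 0) := by
  have hν := rate_pos hp hα
  set ν := rate p α with hνd
  set E : HenonSpace N → ℝ := fun x => linForm p α x (G x) (gradient (originTest ν H 0) x) with hE
  set P : HenonSpace N → ℝ := fun x => linPotential p α x * v x * originTest ν H 0 x with hP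
  obtain ⟨iE, iP, -⟩ := hs _ (isTest_originTest hν H 0)
  have t1 := tendsto_integral_mul_comp_logNorm_add (ν := ν) (E := E) iE
    contDiff_cutoffFn.continuous abs_cutoffFn_le (fun t => cutoffFn_eq_zero)
  have t2 := tendsto_integral_mul_comp_logNorm_add (ν := ν) (E := P) iP
    contDiff_cutoffFn.continuous abs_cutoffFn_le (fun t => cutoffFn_eq_zero)
  have hκ := weightConst_pos hp hpN hα
  have hp1 : p - 1 ≠ 0 := by linarith
  have t3 := ((t1.sub t2).const_mul ν).const_mul
    (weightConst N p α * (ν⁻¹ ^ 2 * (p - 1)) * ν)⁻¹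
  simp only [sub_zero, mul_zero] at t3
  refine t3.congr' ?_
  filter_upwards [eventually_ge_atTop 2] with σ hσ
  set X := scaledField ν k H 0 (fun τ => Real.exp (k * ν * τ) * bumpFn (τ + σ)) with hX
  obtain ⟨iX, -⟩ := hf.integral_linForm_scaledField hN hp hpN hα hv hH
    (A := 0) contDiff_const HasCompactSupport.zero (contDiff_exp_mul_bump (k * ν) σ)
    (hasCompactSupport_exp_mul_bump _ σ)
  have eX := hf.integral_linForm_scaledField_eq hN hp hpN hα hv hH hm
    (A := 0) contDiff_const HasCompactSupport.zero (contDiff_exp_mul_bump (k * ν) σ)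
    (hasCompactSupport_exp_mul_bump _ σ)
  obtain ⟨i1, -, e1⟩ := hs _ (isTest_originTest hν H σ)
  have a1 : ∀ᵐ x : HenonSpace N, linForm p α x (G x) (gradient (originTest ν H σ) x)
      + ν⁻¹ * linForm p α x (G x) (X x) = E x * cutoffFn (logNorm ν x + σ) := by
    filter_upwards [ae_ne_zero hN] with x hx
    rw [gradient_originTest (k := k) hν hx, linForm_add_right, linForm_smul_right,
      linForm_smul_right]
    by_cases hc : logNorm ν x ≤ -1
    · simp only [hE]
      rw [gradient_originTest_of_le hν hx hc]
      ring
    · rw [cutoffFn_eq_zero (by linarith)]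
      ring
  have a2 : ∀ᵐ x : HenonSpace N, linPotential p α x * v x * originTest ν H σ x
      = P x * cutoffFn (logNorm ν x + σ) := by
    filter_upwards [ae_ne_zero hN] with x hx
    simp only [hP, originTest, radialLift_of_ne hx]
    by_cases hc : logNorm ν x ≤ -1
    · rw [cutoffFn_eq_one (t := logNorm ν x + 0) (by linarith)]
      ring
    · rw [cutoffFn_eq_zero (t := logNorm ν x + σ) (by linarith)]
      ring
  rw [← integral_congr_ae a1, ← integral_congr_ae a2, integral_add i1 (iX.const_mul _), e1,
    integral_const_mul, eX]
  have e2 : (fun τ => bumpFn (τ + σ) *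
      (modeWeight p (decay N p α) τ * Real.exp (k * ν * τ) * g τ))
      = fun τ => ν⁻¹ * (modeWeight p (decay N p α) τ *
        (ν * g τ * (k * (0 : ℝ → ℝ) τ + Real.exp (k * ν * τ) * bumpFn (τ + σ))
          + modeEigenvalue N p α k * f τ * (0 : ℝ → ℝ) τ)) := by
    funext τ
    simp only [Pi.zero_apply]
    field_simp
    ring
  rw [e2, integral_const_mul, ← hνd]
  generalize ∫ τ, modeWeight p (decay N p α) τ *
        (ν * g τ * (k * (0 : ℝ → ℝ) τ + Real.exp (k * ν * τ) * bumpFn (τ + σ))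
          + modeEigenvalue N p α k * f τ * (0 : ℝ → ℝ) τ) = I
  field_simp
  ring

/-- Besides the flux, the form against `∇H` near the origin tends to zero, since it is integrable
by the definition of a weak solution. -/
lemma IsModeCoeff.vanishesAtOrigin (hN : 1 ≤ N) (hp : 1 < p) (hpN : p < N) (hα : 0 ≤ α)
    (hv : IsWeakGradient v G) (hs : SolvesLinearized p α v G) (hH : H ∈ harmonicPoly N k)
    (hf : IsModeCoeff (rate p α) k H v f)
    (hm : IsModeSolution p (decay N p α) (modeEigenvalue N p α k) f g) :
    VanishesAtOrigin p (decay N p α) (modeEigenvalue N p α k) (k * rate p α) f g := by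
  refine ⟨hf.tendsto_flux hN hp hpN hα hv hs hH hm, ?_⟩
  have hν := rate_pos hp hα
  set ν := rate p α with hνd
  obtain ⟨iE, -, -⟩ := hs _ (isTest_originTest hν H 0)
  obtain ⟨M, -, hM⟩ := exists_bumpFn_le
  have t1 := tendsto_integral_mul_comp_logNorm_add (ν := ν) iE contDiff_bumpFn.continuous
    (fun t => (abs_of_nonneg (bumpFn_nonneg t)).trans_le (hM t))
    (fun t ht => bumpFn_eq_zero (ht.trans (le_abs_self t)))
  have hκ := weightConst_pos hp hpN hα
  have hp1 : p - 1 ≠ 0 := by linarith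
  have t2 := t1.const_mul (weightConst N p α * (ν⁻¹ ^ 2 * (p - 1)))⁻¹
  rw [mul_zero] at t2
  refine t2.congr' ?_
  filter_upwards [eventually_ge_atTop 2] with σ hσ
  have eX := hf.integral_linForm_scaledField_eq hN hp hpN hα hv hH hm
    (B := 0) (contDiff_exp_mul_bump (k * ν) σ) (hasCompactSupport_exp_mul_bump _ σ)
    contDiff_const HasCompactSupport.zero
  have a1 : ∀ᵐ x : HenonSpace N, linForm p α x (G x) (gradient (originTest ν H 0) x) *
      bumpFn (logNorm ν x + σ) = linForm p α x (G x) (scaledField ν k H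
        (fun τ => Real.exp (k * ν * τ) * bumpFn (τ + σ)) 0 x) := by
    filter_upwards [ae_ne_zero hN] with x hx
    rw [scaledField_exp_bump_zero, linForm_smul_right]
    by_cases hc : logNorm ν x ≤ -1
    · rw [gradient_originTest_of_le hν hx hc]
      ring
    · rw [bumpFn_eq_zero (le_abs.2 (Or.inl (by linarith)))]
      ring
  rw [integral_congr_ae a1, eX, ← mul_assoc, inv_mul_cancel₀, one_mul]
  · congr 1
    funext τ
    simp only [Pi.zero_apply]
    ring
  · exact mul_ne_zero hκ.ne' (mul_ne_zero (pow_ne_zero 2 (inv_ne_zero hν.ne')) hp1)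

end Limits

section Growth

variable {N : ℕ} {ν p α : ℝ} {k : ℕ} {v : HenonSpace N → ℝ} {G : HenonSpace N → HenonSpace N}
  {H : MvPolynomial (Fin N) ℝ} {f g : ℝ → ℝ}

/-- Hölder's inequality for the mean of `v ∈ L^{Np/(N-p)}` over a ball. -/
lemma exists_setIntegral_abs_le (hN : 1 ≤ N) (hp : 1 < p) (hpN : p < N)
    (hv : MemLp v (ENNReal.ofReal (N * p / (N - p))) volume) :
    ∃ C, 0 ≤ C ∧ ∀ R : ℝ, 0 < R →
      ∫ x in Metric.closedBall 0 R, |v x| ≤ C * R ^ ((N : ℝ) + 1 - N / p) := by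
  set q : ℝ := N * p / (N - p) with hq
  have hNp : (0 : ℝ) < N - p := by linarith
  have hN0 : (0 : ℝ) < N := by linarith
  have hq1 : 1 ≤ q := by
    rw [hq, le_div_iff₀ hNp]
    nlinarith
  have hqE : 1 ≤ ENNReal.ofReal q := by
    rw [← ENNReal.ofReal_one]
    exact ENNReal.ofReal_le_ofReal hq1
  set b := (volume : Measure (HenonSpace N)).real (Metric.ball 0 1) with hb
  have hexp : (N : ℝ) * (1 - 1 / q) = N + 1 - N / p := by
    rw [hq]
    field_simp
    ring
  refine ⟨(eLpNorm v (ENNReal.ofReal q) volume).toReal * b ^ (1 - 1 / q), by positivity,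
    fun R hR => ?_⟩
  set B := Metric.closedBall (0 : HenonSpace N) R with hB
  have h1 := eLpNorm_le_eLpNorm_mul_rpow_measure_univ (μ := volume.restrict B) hqE
    hv.1.restrict
  have h2 : eLpNorm v (ENNReal.ofReal q) (volume.restrict B)
      ≤ eLpNorm v (ENNReal.ofReal q) volume := eLpNorm_mono_measure v Measure.restrict_le_self
  have hvB : (volume.restrict B) Set.univ ≠ ⊤ := by
    rw [Measure.restrict_apply_univ]
    exact (isCompact_closedBall _ _).measure_ne_top
  have h3 : ∫ x in B, |v x| = (eLpNorm v 1 (volume.restrict B)).toReal := by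
    rw [eLpNorm_one_eq_lintegral_enorm, integral_eq_lintegral_of_nonneg_ae
      (Eventually.of_forall fun x => abs_nonneg _) hv.1.restrict.norm]
    congr 2
    funext x
    rw [← Real.norm_eq_abs, ofReal_norm]
  have h4 : ((volume.restrict B) Set.univ).toReal = R ^ N * b := by
    rw [Measure.restrict_apply_univ, ← measureReal_def, hB,
      Measure.addHaar_real_closedBall _ _ hR.le]
    simp [hb]
  have h5 : ((volume.restrict B) Set.univ ^ (1 / (1 : ENNReal).toReal
      - 1 / (ENNReal.ofReal q).toReal)).toReal = b ^ (1 - 1 / q) * R ^ ((N : ℝ) + 1 - N / p) := by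
    rw [← ENNReal.toReal_rpow, h4, ENNReal.toReal_ofReal (by linarith), ENNReal.toReal_one,
      Real.mul_rpow (by positivity) (by positivity), ← Real.rpow_natCast, ← Real.rpow_mul hR.le,
      div_one, hexp, mul_comm]
  rw [h3, mul_assoc, ← h5, ← ENNReal.toReal_mul]
  refine ENNReal.toReal_mono (ENNReal.mul_ne_top hv.2.ne ?_) (h1.trans (by gcongr))
  exact ENNReal.rpow_ne_top_of_nonneg (by
    rw [ENNReal.toReal_ofReal (by linarith), ENNReal.toReal_one, div_one, sub_nonneg,
      div_le_one (by linarith)]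
    exact hq1) hvB

/-- The means of the coefficients of `v ∈ L^{Np/(N-p)}` over the shells `|x| ≈ r` are bounded by a
multiple of `r^{1 - N/p}`. -/
lemma IsModeCoeff.meanBound (hN : 1 ≤ N) (hp : 1 < p) (hpN : p < N) (hν : 0 < ν)
    (hv : MemLp v (ENNReal.ofReal (N * p / (N - p))) volume) (hH : H.IsHomogeneous k)
    (hf : IsModeCoeff ν k H v f) : MeanBound ((N / p - 1) * ν) f := by
  obtain ⟨C, hC, hb⟩ := exists_setIntegral_abs_le hN hp hpN hv
  obtain ⟨D, hD, hbH⟩ := exists_abs_polyEval_le hH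
  have hN0 : (0 : ℝ) < N := by linarith
  have hq1 : 1 ≤ ENNReal.ofReal (N * p / (N - p)) := by
    rw [← ENNReal.ofReal_one]
    refine ENNReal.ofReal_le_ofReal ?_
    rw [le_div_iff₀ (by linarith)]
    nlinarith
  refine ⟨C * D * Real.exp (ν * (2 * N + 1 - N / p)), by positivity, fun σ M η hη hM h0 => ?_⟩
  have hc : HasCompactSupport η := HasCompactSupport.intro isCompact_Icc (fun τ hτ => h0 τ hτ)
  have e := hf.2 (fun τ => Real.exp (-((N + k) * ν * τ)) * η τ) (by fun_prop) hc.mul_left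
  simp only [← mul_assoc, ← Real.exp_add, add_neg_cancel, Real.exp_zero, one_mul] at e
  have hM0 : 0 ≤ M := (abs_nonneg _).trans (hM 0)
  set R := Real.exp (ν * (1 - σ)) with hR
  set B := Metric.closedBall (0 : HenonSpace N) R with hB
  have iv : IntegrableOn (fun x => |v x|) B :=
    ((hv.locallyIntegrable hq1).integrableOn_isCompact (isCompact_closedBall _ _)).abs
  set K := D * Real.exp (N * ν * (σ + 1)) * M with hK
  have hb2 : ∀ᵐ x : HenonSpace N, ‖v x * polyEval H x *
      Real.exp (-((N + k) * ν * logNorm ν x)) * η (logNorm ν x)‖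
        ≤ B.indicator (fun x => |v x| * K) x := by
    filter_upwards [ae_ne_zero hN] with x hx
    by_cases hτ : logNorm ν x ∈ Set.Icc (-σ - 1) (-σ + 1)
    · have hxB : x ∈ B := by
        rw [hB, mem_closedBall_zero_iff, hR, ← Real.rpow_one ‖x‖, ← exp_mul_logNorm hν.ne' hx]
        refine Real.exp_le_exp.2 ?_
        have := mul_le_mul_of_nonneg_left hτ.2 hν.le
        linarith
      rw [Set.indicator_of_mem hxB, norm_mul, norm_mul, norm_mul, Real.norm_eq_abs,
        Real.norm_eq_abs, Real.norm_eq_abs, Real.norm_eq_abs, Real.abs_exp, mul_assoc, mul_assoc]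
      refine mul_le_mul_of_nonneg_left ?_ (abs_nonneg _)
      have h1 : |polyEval H x| ≤ D * Real.exp (k * ν * logNorm ν x) := by
        rw [exp_mul_logNorm hν.ne' hx, Real.rpow_natCast]
        exact hbH x
      have h2 : Real.exp (k * ν * logNorm ν x) * Real.exp (-((N + k) * ν * logNorm ν x))
          ≤ Real.exp (N * ν * (σ + 1)) := by
        rw [← Real.exp_add]
        refine Real.exp_le_exp.2 ?_
        have := mul_le_mul_of_nonneg_left hτ.1 (mul_nonneg hN0.le hν.le)
        linarith
      calc |polyEval H x| * (Real.exp (-((N + k) * ν * logNorm ν x)) * |η (logNorm ν x)|)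
          ≤ D * Real.exp (k * ν * logNorm ν x) *
              (Real.exp (-((N + k) * ν * logNorm ν x)) * M) := by
            gcongr
            exact hM _
        _ = D * (Real.exp (k * ν * logNorm ν x) * Real.exp (-((N + k) * ν * logNorm ν x))) * M := by
            ring
        _ ≤ K := by
            rw [hK]
            gcongr
    · rw [h0 _ hτ, mul_zero, norm_zero]
      exact Set.indicator_nonneg (fun x _ => by positivity) x
  have h3 := norm_integral_le_of_norm_le
    ((integrable_indicator_iff measurableSet_closedBall).2 (iv.mul_const K)) hb2
  rw [e, Real.norm_eq_abs, integral_indicator measurableSet_closedBall, integral_mul_const] at h3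
  have hRpos : 0 < R := Real.exp_pos _
  refine h3.trans ((mul_le_mul_of_nonneg_right (hb R hRpos) (by positivity)).trans (le_of_eq ?_))
  have h4 : R ^ ((N : ℝ) + 1 - N / p) * Real.exp (N * ν * (σ + 1))
      = Real.exp (ν * (2 * N + 1 - N / p)) * Real.exp ((N / p - 1) * ν * σ) := by
    rw [hR, ← Real.exp_mul, ← Real.exp_add, ← Real.exp_add]
    congr 1
    ring
  rw [hK]
  linear_combination (C * D * M) * h4

end Growth

/-! ### Classification of the coefficients of a solution -/

section Classification

variable {N : ℕ} {p α : ℝ} {k : ℕ} {v : HenonSpace N → ℝ} {G : HenonSpace N → HenonSpace N}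
  {H : MvPolynomial (Fin N) ℝ}

/-- In terms of `s = (p+α)/p`, the radial equation of degree `k` has a positive decaying solution
when `k (k + N - 2) = s (N - p + (p - 1) s)`. -/
lemma modeEigenvalue_eq_iff (hp : 1 < p) (hα : 0 ≤ α) :
    modeEigenvalue N p α k = (p - 1) / p * (decay N p α - 1 / p) ↔
      (k : ℝ) * (k + N - 2) = (p + α) / p * (N - p + (p - 1) * ((p + α) / p)) := by
  have h1 : p - 1 ≠ 0 := by linarith
  have h2 : p + α ≠ 0 := by linarith
  have h3 : p ≠ 0 := by linarith
  have e1 : modeEigenvalue N p α k = (p - 1) / (p + α) ^ 2 * ((k : ℝ) * (k + N - 2)) := by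
    rw [modeEigenvalue, rate]
    field_simp
  have e2 : (p - 1) / p * (decay N p α - 1 / p) = (p - 1) / (p + α) ^ 2 *
      ((p + α) / p * (N - p + (p - 1) * ((p + α) / p))) := by
    rw [decay]
    field_simp
    ring
  rw [e1, e2]
  exact mul_right_inj' (div_ne_zero h1 (pow_ne_zero 2 h2))

/-- The number `α(k)` is obtained from the nonnegative root `s = (p+α)/p` of the quadratic equation
`s (N - p + (p - 1) s) = k (k + N - 2)`. -/
lemma eq_alphaCrit_iff (hp : 1 < p) (hpN : p < N) (hα : 0 ≤ α) :
    α = alphaCrit N p k ↔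
      (k : ℝ) * (k + N - 2) = (p + α) / p * (N - p + (p - 1) * ((p + α) / p)) := by
  have h1 : p - 1 ≠ 0 := by linarith
  have h3 : p ≠ 0 := by linarith
  set s := (p + α) / p with hs
  have hαs : α = p * s - p := by rw [hs]; field_simp; ring
  have hs0 : 0 < s := div_pos (by linarith) (by linarith)
  set D := ((N : ℝ) + p - 2) ^ 2 + 4 * ((k : ℝ) - 1) * (p - 1) * ((k : ℝ) + N - 1) with hD
  have eD : D = (N - p) ^ 2 + 4 * (p - 1) * (k * (k + N - 2)) := by rw [hD]; ring
  have hpos : 0 ≤ 2 * (p - 1) * s + (N - p) := by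
    have : 0 ≤ (p - 1) * s := mul_nonneg (by linarith) hs0.le
    linarith
  have e1 : α = alphaCrit N p k ↔ √D = 2 * (p - 1) * s + (N - p) := by
    rw [alphaCrit, ← hD, eq_div_iff (by simpa using h1), hαs]
    constructor
    · intro h
      have : p * (√D - (2 * (p - 1) * s + (N - p))) = 0 := by linear_combination -h
      linarith [(mul_eq_zero.1 this).resolve_left h3]
    · intro h
      rw [h]
      ring
  rw [e1]
  constructor
  · intro h
    have hD0 : 0 ≤ D := by
      have h0 : (0 : ℝ) ≤ k * (k + N - 2) ∨ k = 0 := by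
        rcases Nat.eq_zero_or_pos k with h0 | h0
        · exact Or.inr h0
        · left
          have : (1 : ℝ) ≤ k := by exact_mod_cast h0
          exact mul_nonneg (by linarith) (by linarith)
      rw [eD]
      rcases h0 with h0 | h0
      · have : 0 ≤ 4 * (p - 1) * (k * (k + N - 2)) := mul_nonneg (by linarith) h0
        positivity
      · subst h0
        simp only [Nat.cast_zero, zero_mul, mul_zero, add_zero]
        positivity
    have h2 := Real.sq_sqrt hD0
    rw [h, eD] at h2
    have : 4 * (p - 1) * ((k : ℝ) * (k + N - 2) - s * (N - p + (p - 1) * s)) = 0 := by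
      linear_combination -h2
    have h5 : 4 * (p - 1) ≠ 0 := by simpa using h1
    linarith [(mul_eq_zero.1 this).resolve_left h5]
  · intro h
    rw [Real.sqrt_eq_iff_mul_self_eq_of_pos, eD, h]
    · ring
    · have : 0 < (p - 1) * s := mul_pos (by linarith) hs0
      linarith

/-- The modulus of the coefficient of a solution along a spherical harmonic of positive degree is
eventually monotone at both ends. It does not increase towards the origin, nor towards infinity,
and this forces `modeQuot` to vanish. -/
lemma exists_modeQuot_eq_zero (hN : 1 ≤ N) (hp : 1 < p) (hpN : p < N) (hα : 0 ≤ α)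
    (hD : MemD1p p v G) (hs : SolvesLinearized p α v G) (hk : 1 ≤ k)
    (hH : H ∈ harmonicPoly N k) :
    ∃ f g, IsModeCoeff (rate p α) k H v f ∧
      IsModeSolution p (decay N p α) (modeEigenvalue N p α k) f g ∧
      ∀ τ, modeQuot p (decay N p α) f g τ = 0 := by
  obtain ⟨f, g, hf, hm⟩ := exists_isModeSolution hN hp hpN hα hD.isWeakGradient hs hH
  refine ⟨f, g, hf, hm, ?_⟩
  have hν := rate_pos hp hα
  have hk1 : (1 : ℝ) ≤ k := by exact_mod_cast hk
  have hN1 : (1 : ℝ) ≤ N := by exact_mod_cast hN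
  have hΛ : 0 < modeEigenvalue N p α k := by
    unfold modeEigenvalue
    have : 0 < p - 1 := by linarith
    have : (0 : ℝ) < k + N - 2 := by linarith
    positivity
  have hB := hf.meanBound hN hp hpN hν hD.memLp hH.1
  have hδ : 0 < ((N : ℝ) / p - 1) * rate p α :=
    mul_pos (by rw [sub_pos, one_lt_div (by linarith)]; exact hpN) hν
  have hpα : 0 < p + α := by linarith
  refine hm.quot_eq_zero (by linarith) hΛ ((hm.sign_atBot hΛ).resolve_right ?_)
    ((hm.sign_atTop hΛ).resolve_right (hm.not_growing_atTop hδ hB))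
  have hβ := one_lt_decay hp hpN hα
  -- For `p ≥ 2` the integrability of `v` excludes growth at the origin; for `p < 2` it does not,
  -- but then `|x|^k` is a subsolution and the equation at the origin can be used.
  rcases le_or_gt 2 p with h2 | h2
  · refine hm.not_decreasing_atBot_of_two_le hΛ (by linarith) h2 ?_ hδ.le hB
    have e : decay N p α * (p - 1) - 1 - ((N : ℝ) / p - 1) * rate p α
        = (N * (p - 1) ^ 2 / p + α * (p - 2) - 1) / (p + α) := by
      rw [decay, rate]
      field_simp
      ring
    have h3 : (p - 1) ^ 2 < N * (p - 1) ^ 2 / p := by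
      rw [lt_div_iff₀ (by linarith), mul_comm (N : ℝ)]
      exact mul_lt_mul_of_pos_left hpN (by have : 0 < p - 1 := by linarith
                                           positivity)
    have h4 : 0 ≤ α * (p - 2) := mul_nonneg hα (by linarith)
    have h5 : 0 < (N * (p - 1) ^ 2 / p + α * (p - 2) - 1) / (p + α) :=
      div_pos (by nlinarith) hpα
    linarith
  · refine hm.not_decreasing_atBot_of_vanishes hΛ (ε := k * rate p α) (by positivity) ?_
      (hf.vanishesAtOrigin hN hp hpN hα hD.isWeakGradient hs hH hm)
    have hp1 : p - 1 ≠ 0 := by linarith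
    have e : modeEigenvalue N p α k - ((k * rate p α) ^ 2
        + (decay N p α * (p - 1) - 1) * (k * rate p α))
        = k * rate p α * ((2 - p) * (k + N + α - 1)) / (p + α) := by
      rw [modeEigenvalue, decay, rate]
      field_simp
      ring
    have h5 : 0 < k * rate p α * ((2 - p) * (k + N + α - 1)) / (p + α) := by
      have : 0 < 2 - p := by linarith
      have : 0 < k + N + α - 1 := by linarith
      positivity
    linarith

/-- A solution has no component along the spherical harmonics of degree `k ≥ 1` unless
`α = α(k)`. -/
lemma integral_mode_eq_zero (hN : 1 ≤ N) (hp : 1 < p) (hpN : p < N) (hα : 0 ≤ α)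
    (hD : MemD1p p v G) (hs : SolvesLinearized p α v G) (hk : 1 ≤ k)
    (hαk : α ≠ alphaCrit N p k) (hH : H ∈ harmonicPoly N k) {η : ℝ → ℝ} (hη : Continuous η)
    (hηc : HasCompactSupport η) :
    ∫ x, (v x * polyEval H x) * η (logNorm (rate p α) x) = 0 := by
  obtain ⟨f, g, hf, hm, hq⟩ := exists_modeQuot_eq_zero hN hp hpN hα hD hs hk hH
  have h0 := hm.eq_zero_of_ne (by linarith) hq (fun h => hαk
    ((eq_alphaCrit_iff hp hpN hα).2 ((modeEigenvalue_eq_iff hp hα).1 h)))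
  rw [hf.2 η hη hηc]
  simp [h0]

/-- The component of a solution along a spherical harmonic of positive degree is a multiple of the
explicit positive solution of the radial equation. -/
lemma exists_integral_mode_eq (hN : 1 ≤ N) (hp : 1 < p) (hpN : p < N) (hα : 0 ≤ α)
    (hD : MemD1p p v G) (hs : SolvesLinearized p α v G) (hk : 1 ≤ k)
    (hH : H ∈ harmonicPoly N k) :
    ∃ c, ∀ η : ℝ → ℝ, Continuous η → HasCompactSupport η →
      ∫ x, (v x * polyEval H x) * η (logNorm (rate p α) x) = c * ∫ τ,
        groundMode p (decay N p α) τ * (Real.exp ((N + k) * rate p α * τ) * η τ) := by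
  obtain ⟨f, g, hf, hm, hq⟩ := exists_modeQuot_eq_zero hN hp hpN hα hD hs hk hH
  obtain ⟨c, hc⟩ := hm.eq_groundMode hq
  refine ⟨c, fun η hη hηc => ?_⟩
  rw [hf.2 η hη hηc, ← integral_const_mul]
  simp only [hc, mul_assoc]

/-- The radial component of a solution is a multiple of the explicit radial one. -/
lemma exists_integral_radial_eq (hN : 1 ≤ N) (hp : 1 < p) (hpN : p < N) (hα : 0 ≤ α)
    (hD : MemD1p p v G) (hs : SolvesLinearized p α v G) (hH : H ∈ harmonicPoly N 0) :
    ∃ c, ∀ η : ℝ → ℝ, Continuous η → HasCompactSupport η →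
      ∫ x, (v x * polyEval H x) * η (logNorm (rate p α) x) = c * ∫ τ,
        radialMode p (decay N p α) τ * (Real.exp (N * rate p α * τ) * η τ) := by
  obtain ⟨f, g, hf, hm⟩ := exists_isModeSolution hN hp hpN hα hD.isWeakGradient hs hH
  have hΛ : modeEigenvalue N p α 0 = 0 := by simp [modeEigenvalue]
  have hflux := hf.tendsto_flux hN hp hpN hα hD.isWeakGradient hs hH hm
  rw [hΛ] at hm
  simp only [Nat.cast_zero, zero_mul, Real.exp_zero, mul_one] at hflux
  have hp0 : 0 < p := by linarith
  have hpα : 0 < p + α := by linarith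
  have hδ : ((N : ℝ) / p - 1) * rate p α < decay N p α * (p - 1) := by
    have e : decay N p α * (p - 1) - ((N : ℝ) / p - 1) * rate p α
        = (p - 1) * (N * (1 - 1 / p) + α + 1) / (p + α) := by
      rw [decay, rate]
      field_simp
      ring
    have h1 : 1 / p < 1 := by rw [div_lt_one hp0]; exact hp
    have h2 : 0 ≤ (N : ℝ) * (1 - 1 / p) := mul_nonneg (by linarith) (by linarith)
    have h3 : 0 < (p - 1) * (N * (1 - 1 / p) + α + 1) / (p + α) :=
      div_pos (mul_pos (by linarith) (by linarith)) hpα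
    linarith
  obtain ⟨c, hc⟩ := hm.exists_eq_radialMode hp (one_lt_decay hp hpN hα).le hδ
    (hf.meanBound hN hp hpN (rate_pos hp hα) hD.memLp hH.1) hflux
  refine ⟨c, fun η hη hηc => ?_⟩
  rw [hf.2 η hη hηc, ← integral_const_mul]
  simp only [hc, mul_assoc, Nat.cast_zero, add_zero]

end Classification

/-! ### Completeness of the spherical harmonics -/

section Completeness

variable {N : ℕ} {ν : ℝ} {v : HenonSpace N → ℝ}

lemma integrable_mul_polyEval_mul (hν : 0 < ν) (hv : LocallyIntegrable v)
    (q : MvPolynomial (Fin N) ℝ) {η : ℝ → ℝ} (hη : Continuous η) (hηc : HasCompactSupport η) :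
    Integrable fun x => (v x * polyEval q x) * η (logNorm ν x) := by
  obtain ⟨M, hM⟩ := hηc.exists_bound_of_continuous hη
  obtain ⟨R, -, hR⟩ := exists_eq_zero_ends hηc
  exact integrable_mul_comp_log hν (locallyIntegrable_mul_polyEval hv q) hη.measurable hM hR

/-- If `v` has no component along the spherical harmonics, then it is orthogonal to all products
of polynomials with radial functions. -/
lemma integral_mul_polyEval_eq_zero (hN : 1 ≤ N) (hν : 0 < ν) (hv : LocallyIntegrable v)
    (h : ∀ k : ℕ, ∀ H ∈ harmonicPoly N k, ∀ η : ℝ → ℝ, Continuous η → HasCompactSupport η →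
      ∫ x, (v x * polyEval H x) * η (logNorm ν x) = 0)
    (q : MvPolynomial (Fin N) ℝ) {η : ℝ → ℝ} (hη : Continuous η) (hηc : HasCompactSupport η) :
    ∫ x, (v x * polyEval q x) * η (logNorm ν x) = 0 := by
  have hi := fun r => integrable_mul_polyEval_mul hν hv r hη hηc
  have hadd : ∀ r s, ∫ x, (v x * polyEval r x) * η (logNorm ν x) = 0 →
      ∫ x, (v x * polyEval s x) * η (logNorm ν x) = 0 →
      ∫ x, (v x * polyEval (r + s) x) * η (logNorm ν x) = 0 := fun r s hr hs => by
    simp only [polyEval_add, mul_add, add_mul]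
    rw [integral_add (hi r) (hi s), hr, hs, add_zero]
  have hhom : ∀ k, ∀ r ∈ harmonicSpan N k, ∫ x, (v x * polyEval r x) * η (logNorm ν x) = 0 := by
    intro k r hr
    induction hr using Submodule.span_induction with
    | mem r hr =>
      obtain ⟨j, m, H, hH, -, rfl⟩ := hr
      rw [← h m H hH (fun τ => Real.exp ((2 * j : ℕ) * ν * τ) * η τ) (by fun_prop) hηc.mul_left]
      refine integral_congr_ae ?_
      filter_upwards [ae_ne_zero hN] with x hx
      rw [exp_mul_logNorm hν.ne' hx, Real.rpow_natCast, polyEval_mul, pow_mul, ← polyEval_normSq]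
      simp only [polyEval, map_pow]
      ring
    | zero => simp [polyEval]
    | add r s _ _ hr hs => exact hadd r s hr hs
    | smul c r _ hr =>
      have e : (fun x => (v x * polyEval (c • r) x) * η (logNorm ν x))
          = fun x => c * ((v x * polyEval r x) * η (logNorm ν x)) := by
        funext x
        rw [polyEval_smul]
        ring
      rw [e, integral_const_mul, hr, mul_zero]
  rw [← MvPolynomial.sum_homogeneousComponent q]
  refine Finset.sum_induction _
    (fun r => ∫ x, (v x * polyEval r x) * η (logNorm ν x) = 0) hadd (by simp [polyEval]) ?_
  intro k _
  exact hhom k _ (homogeneous_le_harmonicSpan hN k (MvPolynomial.homogeneousComponent_mem k q))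

/-- Polynomials are dense in the continuous functions on compact sets. -/
lemma exists_polyEval_near {g : HenonSpace N → ℝ} (hg : Continuous g) {K : Set (HenonSpace N)}
    (hK : IsCompact K) {ε : ℝ} (hε : 0 < ε) :
    ∃ q : MvPolynomial (Fin N) ℝ, ∀ x ∈ K, |polyEval q x - g x| < ε := by
  let X : Fin N → C(HenonSpace N, ℝ) := fun i => ⟨fun x => x i, by fun_prop⟩
  have hX : ∀ (q : MvPolynomial (Fin N) ℝ) (x : HenonSpace N),
      MvPolynomial.aeval X q x = polyEval q x := fun q x => by
    induction q using MvPolynomial.induction_on with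
    | C c => simp [Algebra.algebraMap_eq_smul_one]
    | add q r hq hr => simp [hq, hr]
    | mul_X q i hq => simp [hq, X]
  have hsep : (MvPolynomial.aeval (R := ℝ) X).range.SeparatesPoints := by
    intro x y hxy
    obtain ⟨i, hi⟩ : ∃ i, x i ≠ y i := by
      by_contra! hc
      exact hxy (PiLp.ext hc)
    refine ⟨_, ⟨X i, ⟨MvPolynomial.X i, by simp⟩, rfl⟩, hi⟩
  obtain ⟨_, ⟨q, rfl⟩, h⟩ :=
    ContinuousMap.exists_mem_subalgebra_near_continuous_of_isCompact_of_separatesPoints hsep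
      ⟨g, hg⟩ hK hε
  refine ⟨q, fun x hx => ?_⟩
  rw [← hX]
  exact h x hx

/-- A function without components along the spherical harmonics vanishes almost everywhere. -/
theorem ae_eq_zero_of_forall_mode_eq_zero (hN : 1 ≤ N) (hν : 0 < ν) (hv : LocallyIntegrable v)
    (h : ∀ k : ℕ, ∀ H ∈ harmonicPoly N k, ∀ η : ℝ → ℝ, Continuous η → HasCompactSupport η →
      ∫ x, (v x * polyEval H x) * η (logNorm ν x) = 0) : ∀ᵐ x, v x = 0 := by
  -- Cutoffs to annuli that exhaust the complement of the origin.
  let ζ : ℕ → ℝ → ℝ := fun n τ => max 0 (min 1 (n + 1 - |τ|))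
  have hζ : ∀ n, Continuous (ζ n) := fun n => by fun_prop
  have hζ0 : ∀ (n : ℕ) τ, (n + 1 : ℝ) ≤ |τ| → ζ n τ = 0 := fun n τ hτ =>
    max_eq_left ((min_le_right _ _).trans (by linarith))
  have hζc : ∀ n, HasCompactSupport (ζ n) := fun n =>
    HasCompactSupport.intro (isCompact_Icc (a := -(n + 1 : ℝ)) (b := n + 1)) fun τ hτ =>
      hζ0 n τ (by
        by_contra! hc
        rw [abs_lt] at hc
        exact hτ ⟨hc.1.le, hc.2.le⟩)
  have key : ∀ n, ∀ᵐ x, v x * ζ n (logNorm ν x) = 0 := by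
    intro n
    have hi : Integrable fun x => v x * ζ n (logNorm ν x) := by
      simpa [polyEval] using integrable_mul_polyEval_mul hν hv 1 (hζ n) (hζc n)
    refine ae_eq_zero_of_integral_contDiff_smul_eq_zero hi.locallyIntegrable fun g hg hgc => ?_
    set I := ∫ x, ‖v x * ζ n (logNorm ν x)‖ with hI
    have hI0 : 0 ≤ I := integral_nonneg fun x => norm_nonneg _
    set K := Metric.closedBall (0 : HenonSpace N) (Real.exp (ν * (n + 1))) with hK
    have hout : ∀ x ∉ K, v x * ζ n (logNorm ν x) = 0 := fun x hx => by
      rw [hK, mem_closedBall_zero_iff, not_le] at hx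
      rw [hζ0 n _ ((le_logNorm_of_le_norm hν hx.le).trans (le_abs_self _)), mul_zero]
    have hle : ∀ ε > 0, |∫ x, g x • (v x * ζ n (logNorm ν x))| ≤ ε * I := by
      intro ε hε
      obtain ⟨q, hq⟩ := exists_polyEval_near hg.continuous (isCompact_closedBall 0 _ : IsCompact K)
        hε
      have h1 := integral_mul_polyEval_eq_zero hN hν hv h q (hζ n) (hζc n)
      have i1 := integrable_mul_polyEval_mul hν hv q (hζ n) (hζc n)
      obtain ⟨M, hM⟩ := hgc.exists_bound_of_continuous hg.continuous
      have i2 : Integrable fun x => g x • (v x * ζ n (logNorm ν x)) :=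
        hi.bdd_mul hg.continuous.aestronglyMeasurable (Eventually.of_forall hM)
      rw [← sub_zero (∫ x, g x • _), ← h1, ← integral_sub i2 i1, ← Real.norm_eq_abs, hI,
        ← integral_const_mul]
      refine norm_integral_le_of_norm_le (hi.norm.const_mul ε) (Eventually.of_forall fun x => ?_)
      have e : g x • (v x * ζ n (logNorm ν x)) - v x * polyEval q x * ζ n (logNorm ν x)
          = (g x - polyEval q x) * (v x * ζ n (logNorm ν x)) := by
        rw [smul_eq_mul]
        ring
      rw [e, norm_mul]
      by_cases hx : x ∈ K
      · refine mul_le_mul_of_nonneg_right ?_ (norm_nonneg _)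
        rw [Real.norm_eq_abs, abs_sub_comm]
        exact (hq x hx).le
      · rw [hout x hx]
        simp
    by_contra h0
    have h2 := hle (|∫ x, g x • (v x * ζ n (logNorm ν x))| / (2 * (I + 1))) (by positivity)
    have h3 : 0 < |∫ x, g x • (v x * ζ n (logNorm ν x))| := abs_pos.2 h0
    rw [div_mul_eq_mul_div, le_div_iff₀ (by positivity)] at h2
    nlinarith
  filter_upwards [ae_all_iff.2 key] with x hx
  obtain ⟨n, hn⟩ := exists_nat_ge |logNorm ν x|
  have h1 := hx n
  have h2 : ζ n (logNorm ν x) = 1 := by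
    have : min (1 : ℝ) (n + 1 - |logNorm ν x|) = 1 := min_eq_left (by linarith)
    simp [ζ, this]
  rwa [h2, mul_one] at h1

end Completeness

/-! ### Functions with a singularity at the origin -/

section Singular

variable {N : ℕ} {ν : ℝ}

lemma integrable_mul_comp_logNorm_add {E : HenonSpace N → ℝ} (hE : Integrable E) {ζ : ℝ → ℝ}
    (hζ : Continuous ζ) {M : ℝ} (hM : ∀ t, |ζ t| ≤ M) (σ : ℝ) :
    Integrable fun x => E x * ζ (logNorm ν x + σ) := by
  have hm : Measurable (logNorm (N := N) ν) := measurable_logNorm ν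
  exact hE.mul_bdd (hζ.measurable.comp (hm.add_const σ)).aestronglyMeasurable
    (Eventually.of_forall fun x => hM _)

/-- The divergence theorem for a vector field `X` which is smooth away from the origin and such
that `X / |x|` and the divergence of `X` are locally integrable. -/
theorem integral_inner_gradient_of_singular (hN : 1 ≤ N) {X : HenonSpace N → HenonSpace N}
    {D : HenonSpace N → ℝ} (hX : ∀ i, ∀ x ≠ 0, ContDiffAt ℝ ∞ (fun y => X y i) x)
    (hD : ∀ x ≠ 0, ∑ i, gradient (fun y => X y i) x i = D x)
    (hXi : LocallyIntegrable fun x => ‖x‖⁻¹ • X x) (hDi : LocallyIntegrable D)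
    {η : HenonSpace N → ℝ} (hη : IsTest η) :
    Integrable (fun x => inner ℝ (X x) (gradient η x)) ∧
      ∫ x, inner ℝ (X x) (gradient η x) = -∫ x, D x * η x := by
  set E₁ : HenonSpace N → ℝ := fun x => inner ℝ (X x) (gradient η x) with hE₁
  set E₂ : HenonSpace N → ℝ := fun x => D x * η x with hE₂
  set E₃ : HenonSpace N → ℝ := fun x => (‖x‖ ^ 2)⁻¹ * inner ℝ (X x) x * η x with hE₃
  have hηc := hη.1.continuous
  have hXm : AEStronglyMeasurable X volume := by
    have h1 : AEStronglyMeasurable (fun x => ‖x‖ • (‖x‖⁻¹ • X x)) volume :=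
      continuous_norm.aestronglyMeasurable.smul hXi.aestronglyMeasurable
    refine h1.congr ?_
    filter_upwards [ae_ne_zero hN] with x hx
    rw [smul_smul, mul_inv_cancel₀ (norm_ne_zero_iff.2 hx), one_smul]
  have i₁ : Integrable E₁ := by
    have h1 : Integrable fun x => (‖x‖ * ‖gradient η x‖) • (‖x‖⁻¹ • X x) :=
      hXi.integrable_smul_left_of_hasCompactSupport
        (continuous_norm.mul hη.gradient_continuous.norm)
        (hη.gradient_hasCompactSupport.norm.mul_left)
    refine h1.mono (hXm.inner hη.gradient_continuous.aestronglyMeasurable) ?_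
    filter_upwards [ae_ne_zero hN] with x hx
    have hx' := norm_ne_zero_iff.2 hx
    refine (norm_inner_le_norm _ _).trans (le_of_eq ?_)
    rw [norm_smul, norm_smul, norm_mul, norm_norm, norm_norm, norm_inv, norm_norm]
    field_simp
  have i₂ : Integrable E₂ := hDi.integrable_smul_right_of_hasCompactSupport hηc hη.2
  have i₃ : Integrable E₃ := by
    have h1 : Integrable fun x => η x • (‖x‖⁻¹ • X x) :=
      hXi.integrable_smul_left_of_hasCompactSupport hηc hη.2
    refine h1.mono (((by fun_prop : Measurable fun x : HenonSpace N =>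
      (‖x‖ ^ 2)⁻¹).aestronglyMeasurable.mul (hXm.inner aestronglyMeasurable_id)).mul
        hηc.aestronglyMeasurable) ?_
    filter_upwards [ae_ne_zero hN] with x hx
    have hx' := norm_ne_zero_iff.2 hx
    rw [norm_mul, norm_mul, norm_inv, norm_pow, norm_norm, norm_smul, norm_smul, norm_inv,
      norm_norm]
    have h2 := norm_inner_le_norm (𝕜 := ℝ) (X x) x
    calc (‖x‖ ^ 2)⁻¹ * ‖inner ℝ (X x) x‖ * ‖η x‖
        ≤ (‖x‖ ^ 2)⁻¹ * (‖X x‖ * ‖x‖) * ‖η x‖ := by gcongr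
      _ = ‖η x‖ * (‖x‖⁻¹ * ‖X x‖) := by field_simp
  refine ⟨i₁, ?_⟩
  obtain ⟨M, -, hM⟩ := exists_bumpFn_le
  have hbM : ∀ t, |bumpFn t| ≤ M := fun t => (abs_of_nonneg (bumpFn_nonneg t)).trans_le (hM t)
  have hcc := contDiff_cutoffFn.continuous
  -- The classical theorem for `X` cut off in the ball of radius `e^{-σ}`. The terms on the left are
  -- the errors due to the cutoff, and they vanish as `σ → ∞`.
  have key : ∀ σ, (∫ x, E₁ x * cutoffFn (logNorm 1 x + σ))
      + (∫ x, E₂ x * cutoffFn (logNorm 1 x + σ)) - (∫ x, E₃ x * bumpFn (logNorm 1 x + σ))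
      = (∫ x, E₁ x) + ∫ x, E₂ x := by
    intro σ
    have j₁ := integrable_mul_comp_logNorm_add (ν := 1) i₁ hcc abs_cutoffFn_le σ
    have j₂ := integrable_mul_comp_logNorm_add (ν := 1) i₂ hcc abs_cutoffFn_le σ
    have j₃ := integrable_mul_comp_logNorm_add (ν := 1) i₃ contDiff_bumpFn.continuous hbM σ
    set χ : ℝ → ℝ := fun τ => 1 - cutoffFn (τ + σ) with hχ
    have hχs : ContDiff ℝ ∞ χ := contDiff_const.sub (contDiff_cutoffFn_add σ)
    have hχ0 : ∀ τ ≤ -σ - 1, χ τ = 0 := fun τ hτ => by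
      simp only [hχ]
      rw [cutoffFn_eq_one (by linarith), sub_self]
    have hχd : ∀ τ, deriv χ τ = bumpFn (τ + σ) := fun τ => by
      rw [((hasDerivAt_cutoffFn_add σ τ).const_sub 1).deriv, neg_neg]
    set ζ := radialLift (N := N) 1 0 χ with hζ
    have hζs : ContDiff ℝ ∞ ζ := contDiff_radialLift one_pos hχs hχ0
    set w : Fin N → HenonSpace N → ℝ := fun i x => ζ x * X x i with hw
    have hws : ∀ i, ContDiff ℝ ∞ (w i) := fun i => by
      rw [contDiff_iff_contDiffAt]
      intro x
      by_cases hx : x = 0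
      · subst hx
        refine (contDiffAt_const (c := (0 : ℝ))).congr_of_eventuallyEq ?_
        filter_upwards [radialLift_eventuallyEq_const (N := N) one_pos hχ0] with y hy
        simp only [hw, hζ]
        rw [hy, zero_mul]
      · exact hζs.contDiffAt.mul (hX i x hx)
    have k₁ : ∀ i, Integrable fun x => w i x * gradient η x i := fun i => by
      have h1 : Continuous fun x => gradient η x i :=
        (EuclideanSpace.proj (𝕜 := ℝ) i).continuous.comp hη.gradient_continuous
      refine ((hws i).continuous.mul h1).integrable_of_hasCompactSupport ?_
      exact (hη.gradient_hasCompactSupport.comp_left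
        (g := fun y : HenonSpace N => y i) rfl).mul_left
    have k₂ : ∀ i, Integrable fun x => gradient (w i) x i * η x := fun i => by
      have h1 : Continuous fun x => gradient (w i) x i := by
        simp only [gradient_apply]
        exact ((hws i).continuous_fderiv (by simp)).clm_apply continuous_const
      exact (h1.mul hηc).integrable_of_hasCompactSupport hη.2.mul_left
    have ibp : ∀ i, ∫ x, w i x * gradient η x i = -∫ x, gradient (w i) x i * η x := fun i => by
      simp only [gradient_apply]
      refine integral_mul_fderiv_eq_neg_fderiv_mul_of_integrable ?_ ?_ ?_
        (fun x _ => (hws i).differentiable (by simp) x)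
        (fun x _ => hη.1.differentiable (by simp) x)
      · simpa only [gradient_apply] using k₂ i
      · simpa only [gradient_apply] using k₁ i
      · exact ((hws i).continuous.mul hηc).integrable_of_hasCompactSupport hη.2.mul_left
    have hsum : ∫ x, ∑ i, w i x * gradient η x i = -∫ x, ∑ i, gradient (w i) x i * η x := by
      rw [integral_finsetSum _ fun i _ => k₁ i, integral_finsetSum _ fun i _ => k₂ i,
        ← Finset.sum_neg_distrib]
      exact Finset.sum_congr rfl fun i _ => ibp i
    have a₁ : ∀ᵐ x : HenonSpace N, ∑ i, w i x * gradient η x i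
        = E₁ x - E₁ x * cutoffFn (logNorm 1 x + σ) := by
      filter_upwards [ae_ne_zero hN] with x hx
      simp only [hw, hζ, radialLift_of_ne hx, hE₁, inner_eq_sum, hχ, mul_assoc]
      rw [← Finset.mul_sum]
      ring
    have a₂ : ∀ᵐ x : HenonSpace N, ∑ i, gradient (w i) x i * η x
        = E₂ x - E₂ x * cutoffFn (logNorm 1 x + σ) + E₃ x * bumpFn (logNorm 1 x + σ) := by
      filter_upwards [ae_ne_zero hN] with x hx
      have hg : ∀ i, gradient (w i) x i = ζ x * gradient (fun y => X y i) x i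
          + bumpFn (logNorm 1 x + σ) * (‖x‖ ^ 2)⁻¹ * (X x i * x i) := fun i => by
        have h1 : HasGradientAt ζ _ x := (hasGradientAt_comp_logNorm hx
          (hχs.differentiable (by simp) (logNorm 1 x)).hasDerivAt).congr_of_eventuallyEq
            (radialLift_eventuallyEq hx)
        have h2 := ((hX i x hx).differentiableAt (by simp)).hasGradientAt
        rw [show gradient (w i) x = _ from (hasGradientAt_mul h1 h2).gradient, hχd]
        simp
        ring
      have e₁ : inner ℝ (X x) x = ∑ i, X x i * x i := inner_eq_sum _ _
      rw [← Finset.sum_mul, Finset.sum_congr rfl fun i _ => hg i, Finset.sum_add_distrib,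
        ← Finset.mul_sum, ← Finset.mul_sum, hD x hx, ← e₁]
      simp only [hE₂, hE₃, hζ, radialLift_of_ne hx, hχ]
      ring
    have j₄ : Integrable fun x => E₂ x - E₂ x * cutoffFn (logNorm 1 x + σ) := i₂.sub j₂
    rw [integral_congr_ae a₁, integral_congr_ae a₂, integral_sub i₁ j₁, integral_add j₄ j₃,
      integral_sub i₂ j₂] at hsum
    linarith
  have t₁ := tendsto_integral_mul_comp_logNorm_add (ν := 1) i₁ hcc abs_cutoffFn_le
    fun t => cutoffFn_eq_zero
  have t₂ := tendsto_integral_mul_comp_logNorm_add (ν := 1) i₂ hcc abs_cutoffFn_le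
    fun t => cutoffFn_eq_zero
  have t₃ := tendsto_integral_mul_comp_logNorm_add (ν := 1) i₃ contDiff_bumpFn.continuous hbM
    fun t ht => bumpFn_eq_zero (ht.trans (le_abs_self t))
  have t := (t₁.add t₂).sub t₃
  simp only [key, add_zero, sub_zero] at t
  linarith [tendsto_nhds_unique t tendsto_const_nhds]

lemma locallyIntegrable_inv_norm (hN : 2 ≤ N) :
    LocallyIntegrable fun x : HenonSpace N => ‖x‖⁻¹ := by
  have h2 : (2 : ℝ) ≤ N := by exact_mod_cast hN
  refine locallyIntegrable_of_norm_le_rpow (C := 1) (α := 1) (by simp; omega)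
    (by simp; linarith) (Eventually.of_forall fun x => ?_) (by fun_prop)
  rw [norm_inv, norm_norm, one_mul, Real.rpow_neg_one]

/-- A function with power-type bounds at the origin and at infinity belongs to `L^q`. -/
lemma memLp_of_norm_le_rpow (hN : 1 ≤ N) {F : Type*} [NormedAddCommGroup F]
    {w : HenonSpace N → F} (hw : AEStronglyMeasurable w volume) {C a b q : ℝ} (hC : 0 ≤ C)
    (hq : 0 < q) (ha : a * q < N) (hb : N < b * q)
    (h0 : ∀ x ≠ 0, ‖w x‖ ≤ C * ‖x‖ ^ (-a)) (h1 : ∀ x ≠ 0, ‖w x‖ ≤ C * ‖x‖ ^ (-b)) :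
    MemLp w (ENNReal.ofReal q) volume := by
  rw [← integrable_norm_rpow_iff hw (by simpa using hq) ENNReal.ofReal_ne_top,
    ENNReal.toReal_ofReal hq.le]
  have hm : AEStronglyMeasurable (fun x => ‖w x‖ ^ q) volume :=
    (hw.norm.aemeasurable.pow_const q).aestronglyMeasurable
  have hpow : ∀ c x, x ≠ 0 → ‖w x‖ ≤ C * ‖x‖ ^ (-c) → ‖w x‖ ^ q ≤ C ^ q * ‖x‖ ^ (-(c * q)) :=
    fun c x hx h => by
      refine (Real.rpow_le_rpow (norm_nonneg _) h hq.le).trans (le_of_eq ?_)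
      rw [Real.mul_rpow hC (by positivity), ← Real.rpow_mul (norm_nonneg _), neg_mul]
  have hn : ∀ x, ‖‖w x‖ ^ q‖ = ‖w x‖ ^ q := fun x => by
    rw [Real.norm_eq_abs, abs_of_nonneg (by positivity)]
  have i0 : IntegrableOn (fun x => ‖w x‖ ^ q) (Metric.ball 0 1) := by
    refine integrableOn_ball_of_norm_le_rpow (C := C ^ q) (α := a * q) (by simpa using hN)
      (by simpa using ha) ?_ hm
    refine ae_restrict_of_ae ?_
    filter_upwards [ae_ne_zero hN] with x hx
    rw [hn]
    exact hpow a x hx (h0 x hx)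
  have i1 : IntegrableOn (fun x => ‖w x‖ ^ q) (Metric.ball 0 1)ᶜ := by
    have hi := (integrable_one_add_norm (μ := (volume : Measure (HenonSpace N))) (r := b * q)
      (by simpa using hb)).const_mul (C ^ q * 2 ^ (b * q))
    refine hi.integrableOn.mono' hm.restrict ?_
    refine (ae_restrict_iff' measurableSet_ball.compl).2 (Eventually.of_forall fun x hx => ?_)
    rw [Set.mem_compl_iff, mem_ball_zero_iff, not_lt] at hx
    have hx0 : 0 < ‖x‖ := by linarith
    have hbq : 0 < b * q := by linarith [(Nat.cast_nonneg N : (0 : ℝ) ≤ N)]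
    rw [hn]
    refine (hpow b x (norm_pos_iff.1 hx0) (h1 x (norm_pos_iff.1 hx0))).trans ?_
    rw [mul_assoc]
    refine mul_le_mul_of_nonneg_left ?_ (by positivity)
    rw [Real.rpow_neg hx0.le, Real.rpow_neg (by positivity), ← div_eq_mul_inv,
      ← Real.div_rpow (by norm_num) (by positivity), ← Real.inv_rpow hx0.le]
    refine Real.rpow_le_rpow (by positivity) ?_ hbq.le
    rw [inv_eq_one_div, div_le_div_iff₀ hx0 (by positivity)]
    linarith
  have := i0.union i1
  rwa [Set.union_compl_self, integrableOn_univ] at this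

end Singular

/-! ### Solutions built from the radial equations -/

section Existence

variable {N : ℕ} {ν p α b : ℝ} {k : ℕ} {H : MvPolynomial (Fin N) ℝ} {f g : ℝ → ℝ}

lemma exists_norm_polyGrad_le (hH : H.IsHomogeneous k) :
    ∃ C, 0 ≤ C ∧ ∀ x : HenonSpace N, x ≠ 0 → ‖polyGrad H x‖ ≤ C * k * ‖x‖ ^ k * ‖x‖⁻¹ := by
  rcases k with _ | d
  · refine ⟨0, le_rfl, fun x _ => ?_⟩
    have h0 : ∀ i, MvPolynomial.pderiv i H = 0 := fun i => by
      rw [MvPolynomial.totalDegree_eq_zero_iff_eq_C.1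
        (Nat.le_zero.1 hH.totalDegree_le), MvPolynomial.pderiv_C]
    have : polyGrad H x = 0 := by
      ext i
      simp [h0, polyEval]
    simp [this]
  · obtain ⟨C, hC⟩ := (isCompact_closedBall (0 : HenonSpace N) 1).exists_bound_of_continuousOn
      (continuous_polyGrad H).continuousOn
    refine ⟨|C|, abs_nonneg C, fun x hx => ?_⟩
    have hx' := norm_pos_iff.2 hx
    have e : polyGrad H x = ‖x‖ ^ d • polyGrad H (‖x‖⁻¹ • x) := by
      ext i
      have hd : (MvPolynomial.pderiv i H).IsHomogeneous d := hH.pderiv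
      have h1 := polyEval_smul_vector hd ‖x‖ (‖x‖⁻¹ • x)
      rw [smul_smul, mul_inv_cancel₀ hx'.ne', one_smul] at h1
      simpa using h1
    have h2 : ‖polyGrad H (‖x‖⁻¹ • x)‖ ≤ |C| := (hC _ (by
      rw [mem_closedBall_zero_iff, norm_smul, norm_inv, norm_norm, inv_mul_cancel₀ hx'.ne'])).trans
        (le_abs_self C)
    rw [e, norm_smul, norm_pow, norm_norm]
    calc ‖x‖ ^ d * ‖polyGrad H (‖x‖⁻¹ • x)‖ ≤ ‖x‖ ^ d * (|C| * (d + 1)) := by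
          gcongr
          exact h2.trans (le_mul_of_one_le_right (abs_nonneg C) (by
            have : (0 : ℝ) ≤ d := Nat.cast_nonneg d
            linarith))
      _ = |C| * ((d + 1 : ℕ) : ℝ) * ‖x‖ ^ (d + 1) * ‖x‖⁻¹ := by
          rw [pow_succ]
          push_cast
          field_simp

lemma exists_norm_scaledField_le (hν : ν ≠ 0) (hH : H.IsHomogeneous k) :
    ∃ C, 0 ≤ C ∧ ∀ (A B : ℝ → ℝ) (x : HenonSpace N), x ≠ 0 →
      ‖scaledField ν k H A B x‖ ≤ C * (k * |A (logNorm ν x)| + |B (logNorm ν x)|) * ‖x‖⁻¹ := by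
  obtain ⟨C, hC, hCb⟩ := exists_norm_polyGrad_le hH
  obtain ⟨D, hD, hDb⟩ := exists_abs_polyEval_le hH
  refine ⟨C + D, by positivity, fun A B x hx => ?_⟩
  have hx' := norm_pos_iff.2 hx
  have e1 : Real.exp (-(k * ν * logNorm ν x)) = (‖x‖ ^ k)⁻¹ := by
    rw [Real.exp_neg, exp_mul_logNorm hν hx, Real.rpow_natCast]
  have e2 : Real.exp (-((k + 2) * ν * logNorm ν x)) = (‖x‖ ^ (k + 2))⁻¹ := by
    rw [Real.exp_neg, exp_mul_logNorm hν hx, ← Real.rpow_natCast]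
    push_cast
    rfl
  rw [scaledField, modeField, e1, e2]
  refine (norm_add_le _ _).trans ?_
  rw [norm_smul, norm_smul, norm_mul, norm_mul, norm_mul, Real.norm_eq_abs, Real.norm_eq_abs,
    Real.norm_eq_abs, Real.norm_eq_abs, Real.norm_eq_abs, abs_of_pos (inv_pos.2 (pow_pos hx' k)),
    abs_of_pos (inv_pos.2 (pow_pos hx' (k + 2)))]
  calc (‖x‖ ^ k)⁻¹ * |A (logNorm ν x)| * ‖polyGrad H x‖
        + (‖x‖ ^ (k + 2))⁻¹ * |B (logNorm ν x)| * |polyEval H x| * ‖x‖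
      ≤ (‖x‖ ^ k)⁻¹ * |A (logNorm ν x)| * (C * k * ‖x‖ ^ k * ‖x‖⁻¹)
        + (‖x‖ ^ (k + 2))⁻¹ * |B (logNorm ν x)| * (D * ‖x‖ ^ k) * ‖x‖ := by
        gcongr
        · exact hCb x hx
        · exact hDb x
    _ = (C * (k * |A (logNorm ν x)|) + D * |B (logNorm ν x)|) * ‖x‖⁻¹ := by
        rw [pow_add]
        field_simp
    _ ≤ (C + D) * (k * |A (logNorm ν x)| + |B (logNorm ν x)|) * ‖x‖⁻¹ := by
        refine mul_le_mul_of_nonneg_right ?_ (by positivity)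
        have h1 : 0 ≤ (k : ℝ) * |A (logNorm ν x)| := by positivity
        have h2 : 0 ≤ |B (logNorm ν x)| := abs_nonneg _
        nlinarith [mul_nonneg hC h2, mul_nonneg hD h1]

lemma contDiffAt_modeField {A B : ℝ → ℝ} (hA : ContDiff ℝ ∞ A) (hB : ContDiff ℝ ∞ B) (i : Fin N)
    {x : HenonSpace N} (hx : x ≠ 0) : ContDiffAt ℝ ∞ (fun y => modeField ν H A B y i) x := by
  have e : (fun y => modeField ν H A B y i) = fun y => A (logNorm ν y) *
      polyEval (MvPolynomial.pderiv i H) y + B (logNorm ν y) *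
        polyEval (H * MvPolynomial.X i) y := by
    funext y
    simp [modeField]
    ring
  rw [e]
  have hs := contDiffAt_logNorm (ν := ν) hx
  exact ((hA.contDiffAt.comp x hs).mul (contDiff_polyEval _).contDiffAt).add
    ((hB.contDiffAt.comp x hs).mul (contDiff_polyEval _).contDiffAt)

lemma sum_gradient_modeField (hH : H ∈ harmonicPoly N k) (hν : ν ≠ 0) {A B : ℝ → ℝ}
    (hA : ContDiff ℝ ∞ A) (hB : ContDiff ℝ ∞ B) {x : HenonSpace N} (hx : x ≠ 0) :
    ∑ i, gradient (fun y => modeField ν H A B y i) x i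
      = polyEval H x * modeDiv N k ν A B (logNorm ν x) := by
  rw [← sum_gradient_component hH hν A B hx]
  refine Finset.sum_congr rfl fun i _ => ?_
  have g1 := hasGradientAt_comp_logNorm_mul (ν := ν) hx
    (hA.differentiable (by simp) _) (MvPolynomial.pderiv i H)
  have g2 := hasGradientAt_comp_logNorm_mul (ν := ν) hx
    (hB.differentiable (by simp) _) (H * MvPolynomial.X i)
  have e : (fun y => modeField ν H A B y i) = fun y => A (logNorm ν y) *
      polyEval (MvPolynomial.pderiv i H) y + B (logNorm ν y) *
        polyEval (H * MvPolynomial.X i) y := by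
    funext y
    simp [modeField]
    ring
  rw [e, show gradient _ x = _ from (hasGradientAt_add g1 g2).gradient]
  rfl

lemma measurable_scaledField {A B : ℝ → ℝ} (hA : Continuous A) (hB : Continuous B) :
    Measurable (scaledField (N := N) ν k H A B) := by
  have hm : Measurable (logNorm (N := N) ν) := measurable_logNorm ν
  have h1 := hA.measurable.comp hm
  have h2 := hB.measurable.comp hm
  have h3 := (continuous_polyGrad H).measurable
  have h4 := (contDiff_polyEval H).continuous.measurable
  have h5 : ∀ c : ℝ, Measurable fun x : HenonSpace N => Real.exp (-(c * ν * logNorm ν x)) :=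
    fun c => Real.measurable_exp.comp (hm.const_mul _).neg
  exact (((h5 k).mul h1).smul h3).add ((((h5 (k + 2)).mul h2).mul h4).smul measurable_id)

/-- The function `f(τ) |x|^{-k} H(x)`, where `τ = ν⁻¹ log |x|`. -/
noncomputable def modeFn (ν : ℝ) (k : ℕ) (H : MvPolynomial (Fin N) ℝ) (f : ℝ → ℝ)
    (x : HenonSpace N) : ℝ :=
  radialLift ν 0 (fun τ => Real.exp (-(k * ν * τ)) * f τ) x * polyEval H x

lemma contDiff_exp_neg_mul (c : ℝ) : ContDiff ℝ ∞ fun τ => Real.exp (-(c * τ)) := by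
  simpa only [neg_mul] using contDiff_exp_const_mul (-c)

lemma contDiffAt_modeFn (hf : ContDiff ℝ ∞ f) {x : HenonSpace N} (hx : x ≠ 0) :
    ContDiffAt ℝ ∞ (modeFn ν k H f) x :=
  ((((contDiff_exp_neg_mul (k * ν)).mul hf).contDiffAt.comp x
    (contDiffAt_logNorm hx)).congr_of_eventuallyEq (radialLift_eventuallyEq hx)).mul
      (contDiff_polyEval H).contDiffAt

lemma measurable_modeFn (hf : Continuous f) : Measurable (modeFn (N := N) ν k H f) := by
  have hm : Measurable (logNorm (N := N) ν) := measurable_logNorm ν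
  have h2 : Measurable fun x : HenonSpace N => Real.exp (-(k * ν * logNorm ν x)) :=
    Real.measurable_exp.comp (hm.const_mul _).neg
  refine Measurable.mul ?_ (contDiff_polyEval H).continuous.measurable
  exact Measurable.ite (measurableSet_singleton 0) measurable_const
    (h2.mul (hf.measurable.comp hm))

lemma exists_abs_modeFn_le (hν : ν ≠ 0) (hH : H.IsHomogeneous k) :
    ∃ C, 0 ≤ C ∧ ∀ (f : ℝ → ℝ) (x : HenonSpace N), x ≠ 0 →
      |modeFn ν k H f x| ≤ C * |f (logNorm ν x)| := by
  obtain ⟨D, hD, hDb⟩ := exists_abs_polyEval_le hH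
  refine ⟨D, hD, fun f x hx => ?_⟩
  have hx' := norm_pos_iff.2 hx
  have e1 : Real.exp (-(k * ν * logNorm ν x)) = (‖x‖ ^ k)⁻¹ := by
    rw [Real.exp_neg, exp_mul_logNorm hν hx, Real.rpow_natCast]
  rw [modeFn, radialLift_of_ne hx, e1, abs_mul, abs_mul, abs_of_pos (by positivity)]
  calc (‖x‖ ^ k)⁻¹ * |f (logNorm ν x)| * |polyEval H x|
      ≤ (‖x‖ ^ k)⁻¹ * |f (logNorm ν x)| * (D * ‖x‖ ^ k) := by
        gcongr
        exact hDb x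
    _ = D * |f (logNorm ν x)| := by field_simp

/-- The integration by parts formula for a function which is smooth away from the origin. -/
lemma isWeakGradient_of_singular (hN : 1 ≤ N) {u : HenonSpace N → ℝ}
    {U : HenonSpace N → HenonSpace N} (hu : ∀ x ≠ 0, ContDiffAt ℝ ∞ u x)
    (hU : ∀ x ≠ 0, gradient u x = U x) (hui : LocallyIntegrable u)
    (hui' : LocallyIntegrable fun x => ‖x‖⁻¹ * u x) (hUi : LocallyIntegrable U) :
    IsWeakGradient u U := by
  refine ⟨hui, hUi, fun η hη => ?_⟩
  have i1 : Integrable fun x => u x • gradient η x :=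
    hui.integrable_smul_right_of_hasCompactSupport hη.gradient_continuous
      hη.gradient_hasCompactSupport
  have i2 : Integrable fun x => η x • U x :=
    hUi.integrable_smul_left_of_hasCompactSupport hη.1.continuous hη.2
  ext i
  have e1 := ContinuousLinearMap.integral_comp_comm (EuclideanSpace.proj (𝕜 := ℝ) i) i1
  have e2 := ContinuousLinearMap.integral_comp_comm (EuclideanSpace.proj (𝕜 := ℝ) i) i2
  rw [PiLp.neg_apply]
  refine e1.symm.trans (Eq.trans ?_ (congrArg Neg.neg e2))
  have hUi' : LocallyIntegrable fun x => U x i := by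
    refine hUi.mono ((EuclideanSpace.proj (𝕜 := ℝ) i).continuous.comp_aestronglyMeasurable
      hUi.aestronglyMeasurable) (Eventually.of_forall fun x => ?_)
    exact PiLp.norm_apply_le (U x) i
  have h := (integral_inner_gradient_of_singular hN
    (X := fun x => u x • EuclideanSpace.single i (1 : ℝ)) (D := fun x => U x i)
    (fun j x hx => ?_) (fun x hx => ?_) ?_ hUi' hη).2
  · simpa [gradient_apply, real_inner_smul_left, EuclideanSpace.inner_single_left, mul_comm] using h
  · exact (hu x hx).mul contDiffAt_const
  · have e : ∀ j, gradient (fun y => (u y • EuclideanSpace.single i (1 : ℝ)) j) x j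
        = if j = i then U x j else 0 := fun j => by
      have h1 : (fun y => (u y • EuclideanSpace.single i (1 : ℝ)) j)
          = fun y => u y * (EuclideanSpace.single i (1 : ℝ)) j := rfl
      rw [h1, gradient_apply, fderiv_mul_const ((hu x hx).differentiableAt (by simp))]
      simp only [smul_apply, ← gradient_apply, hU x hx]
      simp
    simp only [e]
    simp
  · simp only [smul_smul]
    refine hui'.mono (hui'.aestronglyMeasurable.smul aestronglyMeasurable_const)
      (Eventually.of_forall fun x => ?_)
    rw [norm_smul]
    simp

lemma gradient_modeFn (hν : ν ≠ 0) (hf : ∀ τ, HasDerivAt f (g τ) τ) {x : HenonSpace N}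
    (hx : x ≠ 0) :
    gradient (modeFn ν k H f) x = scaledField ν k H f (fun τ => ν⁻¹ * g τ - k * f τ) x := by
  have h := gradient_radialLift_exp_mul (k := k) (H := H) (c := 0) hν
    (fun τ => (hf τ).differentiableAt) hx
  simp only [(hf _).deriv] at h
  exact h

/-- Bounds for a solution `f` of the radial equation, with derivative `g`, under which
`f(τ) |x|^{-k} H(x)` solves the linearized equation: `f` is bounded near `-∞`, its derivative
(and `f` itself if `k ≠ 0`) is bounded by `e^{τ/p}` there, and both are bounded by `e^{-bτ}` near
`∞`. -/
structure HasModeBounds (p b : ℝ) (k : ℕ) (f g : ℝ → ℝ) (C : ℝ) : Prop where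
  le_const : ∀ τ, |f τ| ≤ C
  deriv_le_const : ∀ τ, |g τ| ≤ C
  le_exp : ∀ τ, |f τ| ≤ C * Real.exp (-(b * τ))
  deriv_le_exp : ∀ τ, |g τ| ≤ C * Real.exp (-(b * τ))
  deriv_le_exp_atBot : ∀ τ, |g τ| ≤ C * Real.exp (1 / p * τ)
  le_exp_atBot : ∀ τ, k * |f τ| ≤ C * Real.exp (1 / p * τ)

lemma HasModeBounds.nonneg {C : ℝ} (h : HasModeBounds p b k f g C) : 0 ≤ C :=
  (abs_nonneg _).trans (h.le_const 0)

lemma memLp_modeFn (hN : 1 ≤ N) (hp : 1 < p) (hpN : p < N) (hν : 0 < ν) (hH : H.IsHomogeneous k)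
    (hf : Continuous f) {C : ℝ} (hb : HasModeBounds p b k f g C)
    (hbν : (N - p) / p * ν < b) :
    MemLp (modeFn ν k H f) (ENNReal.ofReal (N * p / (N - p))) volume := by
  obtain ⟨D, hD, hDb⟩ := exists_abs_modeFn_le (ν := ν) hν.ne' hH
  have hNp : (0 : ℝ) < N - p := by linarith
  have hN0 : (0 : ℝ) < N := by linarith
  have hC := hb.nonneg
  refine memLp_of_norm_le_rpow hN (C := D * C) (a := 0) (b := b / ν)
    (measurable_modeFn hf).aestronglyMeasurable (by positivity) (by positivity) (by simpa)
    ?_ (fun x hx => ?_) fun x hx => ?_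
  · have : (N - p) / p < b / ν := by rwa [lt_div_iff₀ hν]
    calc (N : ℝ) = (N - p) / p * (N * p / (N - p)) := by field_simp
      _ < b / ν * (N * p / (N - p)) := by gcongr
  · rw [neg_zero, Real.rpow_zero, mul_one]
    exact (hDb f x hx).trans (mul_le_mul_of_nonneg_left (hb.le_const _) hD)
  · rw [← exp_mul_logNorm hν.ne' hx, neg_mul, div_mul_cancel₀ _ hν.ne', neg_mul, mul_assoc]
    exact (hDb f x hx).trans (mul_le_mul_of_nonneg_left (hb.le_exp _) hD)

lemma memLp_scaledField (hN : 1 ≤ N) (hp : 1 < p) (hpN : p < N) (hν : 0 < ν)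
    (hH : H.IsHomogeneous k) (hf : Continuous f) (hg : Continuous g) {C : ℝ}
    (hb : HasModeBounds p b k f g C) (hbν : (N - p) / p * ν < b) :
    MemLp (scaledField (N := N) ν k H f (fun τ => ν⁻¹ * g τ - k * f τ)) (ENNReal.ofReal p)
      volume := by
  obtain ⟨D, hD, hDb⟩ := exists_norm_scaledField_le (ν := ν) hν.ne' hH
  have hp0 : 0 < p := by linarith
  have hC := hb.nonneg
  set K := D * ((2 * k + ν⁻¹) * C) with hK
  have hle : ∀ m : ℝ, (∀ τ, |f τ| ≤ C * Real.exp (-(m * τ))) →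
      (∀ τ, |g τ| ≤ C * Real.exp (-(m * τ))) → ∀ x : HenonSpace N, x ≠ 0 →
      ‖scaledField (N := N) ν k H f (fun τ => ν⁻¹ * g τ - k * f τ) x‖
        ≤ K * ‖x‖ ^ (-(m / ν + 1)) := by
    intro m h1 h2 x hx
    have hx' := norm_pos_iff.2 hx
    refine (hDb _ _ x hx).trans ?_
    have e : ‖x‖ ^ (-(m / ν + 1)) = Real.exp (-(m * logNorm ν x)) * ‖x‖⁻¹ := by
      rw [neg_add, Real.rpow_add hx', Real.rpow_neg_one, ← exp_mul_logNorm hν.ne' hx, neg_mul,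
        div_mul_cancel₀ _ hν.ne', neg_mul]
    rw [e, ← mul_assoc]
    refine mul_le_mul_of_nonneg_right ?_ (by positivity)
    have h3 : |ν⁻¹ * g (logNorm ν x) - k * f (logNorm ν x)|
        ≤ ν⁻¹ * |g (logNorm ν x)| + k * |f (logNorm ν x)| := by
      refine (abs_sub _ _).trans (le_of_eq ?_)
      rw [abs_mul, abs_mul, abs_of_pos (inv_pos.2 hν), Nat.abs_cast]
    calc D * (k * |f (logNorm ν x)| + |ν⁻¹ * g (logNorm ν x) - k * f (logNorm ν x)|)
        ≤ D * (k * |f (logNorm ν x)| + (ν⁻¹ * |g (logNorm ν x)| + k * |f (logNorm ν x)|)) := by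
          gcongr
      _ ≤ D * (k * (C * Real.exp (-(m * logNorm ν x))) + (ν⁻¹ * (C * Real.exp
            (-(m * logNorm ν x))) + k * (C * Real.exp (-(m * logNorm ν x))))) := by
          gcongr
          · exact h1 _
          · exact h2 _
          · exact h1 _
      _ = K * Real.exp (-(m * logNorm ν x)) := by rw [hK]; ring
  have hbν' : (N - p) / p < b / ν := by rwa [lt_div_iff₀ hν]
  refine memLp_of_norm_le_rpow hN (C := K) (a := 0 / ν + 1) (b := b / ν + 1)
    (measurable_scaledField hf (by fun_prop)).aestronglyMeasurable (by positivity) hp0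
    (by simpa) ?_ (hle 0 (by simpa using hb.le_const) (by simpa using hb.deriv_le_const))
    (hle b hb.le_exp hb.deriv_le_exp)
  calc (N : ℝ) = ((N - p) / p + 1) * p := by field_simp; ring
    _ < (b / ν + 1) * p := by gcongr

lemma memD1p_modeFn (hN : 2 ≤ N) (hp : 1 < p) (hpN : p < N) (hν : 0 < ν)
    (hH : H.IsHomogeneous k) (hf : ContDiff ℝ ∞ f) (hg : Continuous g)
    (hfg : ∀ τ, HasDerivAt f (g τ) τ) {C : ℝ}
    (hb : HasModeBounds p b k f g C) (hbν : (N - p) / p * ν < b) :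
    MemD1p p (modeFn (N := N) ν k H f) (scaledField ν k H f (fun τ => ν⁻¹ * g τ - k * f τ)) := by
  have hN1 : 1 ≤ N := by omega
  have m1 := memLp_modeFn hN1 hp hpN hν hH hf.continuous hb hbν
  have m2 := memLp_scaledField hN1 hp hpN hν hH hf.continuous hg hb hbν
  obtain ⟨D, hD, hDb⟩ := exists_abs_modeFn_le (ν := ν) hν.ne' hH
  have one_le : ∀ q : ℝ, 1 ≤ q → 1 ≤ ENNReal.ofReal q := fun q hq => by
    rw [← ENNReal.ofReal_one]
    exact ENNReal.ofReal_le_ofReal hq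
  refine ⟨m1, m2, isWeakGradient_of_singular hN1 (fun x hx => contDiffAt_modeFn hf hx)
    (fun x hx => gradient_modeFn hν.ne' hfg hx) (m1.locallyIntegrable (one_le _ ?_)) ?_
    (m2.locallyIntegrable (one_le _ hp.le))⟩
  · rw [le_div_iff₀ (by linarith)]
    nlinarith
  · refine ((locallyIntegrable_inv_norm hN).smul (D * C)).mono
      ((by fun_prop : Measurable fun x : HenonSpace N => ‖x‖⁻¹).aestronglyMeasurable.mul
        (measurable_modeFn hf.continuous).aestronglyMeasurable) ?_
    filter_upwards [ae_ne_zero hN1] with x hx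
    simp only [Pi.smul_apply, smul_eq_mul]
    rw [norm_mul, norm_mul, mul_comm]
    refine mul_le_mul_of_nonneg_right ?_ (norm_nonneg _)
    refine ((hDb f x hx).trans (mul_le_mul_of_nonneg_left (hb.le_const _) hD)).trans
      (le_abs_self _)

end Existence

section Solutions

variable {N : ℕ} {p α b : ℝ} {k : ℕ} {H : MvPolynomial (Fin N) ℝ} {f g : ℝ → ℝ}

lemma one_add_norm_rpow_pos (c : ℝ) (x : HenonSpace N) : 0 < 1 + ‖x‖ ^ c := by positivity

lemma continuous_linPotential (hp : 1 < p) (hpN : p < N) (hα : 0 ≤ α) :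
    Continuous (linPotential (N := N) p α) := by
  have h1 : Continuous fun x : HenonSpace N => ‖x‖ ^ ((p + α) / (p - 1)) :=
    continuous_norm.rpow_const fun x => Or.inr (div_nonneg (by linarith) (by linarith))
  have h2 := one_add_norm_rpow_pos (N := N) ((p + α) / (p - 1))
  have h3 : Continuous fun x : HenonSpace N =>
      (1 + ‖x‖ ^ ((p + α) / (p - 1))) ^ (((N : ℝ) - p) / (p + α)) :=
    (continuous_const.add h1).rpow_const fun x => Or.inl (h2 x).ne'
  have h4 : ∀ x : HenonSpace N,
      0 < (1 + ‖x‖ ^ ((p + α) / (p - 1))) ^ (((N : ℝ) - p) / (p + α)) := fun x =>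
    Real.rpow_pos_of_pos (h2 x) _
  have h5 : Continuous (bubble N p α) := continuous_const.div h3 fun x => (h4 x).ne'
  have h6 : ∀ x : HenonSpace N, bubble N p α x ≠ 0 := fun x =>
    (div_pos (bubbleConst_pos hp hpN hα) (h4 x)).ne'
  exact (continuous_const.mul (continuous_norm.rpow_const fun x => Or.inr hα)).mul
    (h5.rpow_const fun x => Or.inl (h6 x))

lemma linWeight_mul_exp (hp : 1 < p) (hα : 0 ≤ α) {x : HenonSpace N} (hx : x ≠ 0) :
    linWeight N p α (logNorm (rate p α) x) * Real.exp (1 / p * logNorm (rate p α) x) * ‖x‖⁻¹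
      = weightConst N p α * (‖x‖ ^ (α * (1 - 1 / p)) *
        (1 + ‖x‖ ^ ((p + α) / (p - 1))) ^ (-(decay N p α * (p - 2)))) := by
  have hp1 : p - 1 ≠ 0 := by linarith
  have hpa : p + α ≠ 0 := by linarith
  have hp0 : p ≠ 0 := by linarith
  rw [norm_rpow_eq_exp hp hα hx, ← Real.rpow_neg_one, rpow_eq_exp_rate hp hα hx (-1),
    rpow_eq_exp_rate hp hα hx, linWeight, modeWeight]
  set τ := logNorm (rate p α) x with hτ
  have e : Real.exp ((decay N p α * (p - 1) - 1) * τ) * (Real.exp (-((N - 2) * rate p α * τ)) *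
      (Real.exp (1 / p * τ) * Real.exp (-1 * rate p α * τ)))
      = Real.exp (α * (1 - 1 / p) * rate p α * τ) := by
    rw [← Real.exp_add, ← Real.exp_add, ← Real.exp_add]
    congr 1
    rw [decay, rate]
    field_simp
    ring
  rw [← e]
  ring

/-- The vector field `|∇U|^{p-2} ∇v + (p-2) |∇U|^{p-4} (∇U · ∇v) ∇U` under the divergence in the
linearized equation, for `v = f(τ) |x|^{-k} H(x)` and `g = f'`. -/
noncomputable def fluxField (N : ℕ) (p α : ℝ) (k : ℕ) (H : MvPolynomial (Fin N) ℝ)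
    (f g : ℝ → ℝ) : HenonSpace N → HenonSpace N :=
  modeField (rate p α) H
    (fun τ => Real.exp (-((N - 2 + k) * rate p α * τ)) *
      (weightConst N p α * (modeWeight p (decay N p α) τ * f τ)))
    (fun τ => Real.exp (-((N + k) * rate p α * τ)) * (weightConst N p α *
      (modeWeight p (decay N p α) τ *
        ((p - 1) * ((rate p α)⁻¹ * g τ - k * f τ) + (p - 2) * k * f τ))))

lemma linForm_eq_inner_fluxField (hp : 1 < p) (hpN : p < N) (hα : 0 ≤ α) {x : HenonSpace N}
    (hx : x ≠ 0) (hH : H.IsHomogeneous k) (y : HenonSpace N) :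
    linForm p α x (scaledField (rate p α) k H f (fun τ => (rate p α)⁻¹ * g τ - k * f τ) x) y
      = inner ℝ (fluxField N p α k H f g x) y := by
  rw [linForm_comm, linForm_scaledField hp hpN hα hx y hH, real_inner_comm]
  rfl

/-- The flux field of a solution of the radial equation has the divergence prescribed by the
linearized equation. -/
lemma sum_gradient_fluxField (hp : 1 < p) (hpN : p < N) (hα : 0 ≤ α) (hH : H ∈ harmonicPoly N k)
    (hm : IsModeSolution p (decay N p α) (modeEigenvalue N p α k) f g)
    (hf : ContDiff ℝ ∞ f) (hg : ContDiff ℝ ∞ g) {x : HenonSpace N} (hx : x ≠ 0) :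
    ∑ i, gradient (fun y => fluxField N p α k H f g y i) x i
      = -(linPotential p α x * modeFn (rate p α) k H f x) := by
  have hν := rate_pos hp hα
  have hws := contDiff_modeWeight p (decay N p α)
  have hA : ContDiff ℝ ∞ fun τ => weightConst N p α * (modeWeight p (decay N p α) τ * f τ) :=
    contDiff_const.mul (hws.mul hf)
  have hB : ContDiff ℝ ∞ fun τ => weightConst N p α * (modeWeight p (decay N p α) τ *
        ((p - 1) * ((rate p α)⁻¹ * g τ - k * f τ) + (p - 2) * k * f τ)) :=
    contDiff_const.mul (hws.mul ((contDiff_const.mul ((contDiff_const.mul hg).sub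
      (contDiff_const.mul hf))).add (contDiff_const.mul hf)))
  unfold fluxField
  rw [sum_gradient_modeField hH hν.ne' ((contDiff_exp_neg_mul _).mul hA)
    ((contDiff_exp_neg_mul _).mul hB) hx, modeDiv_exp_mul hν.ne' (hA.differentiable (by simp) _)
    (hB.differentiable (by simp) _), linPotential_eq hp hpN hα hx, modeFn, radialLift_of_ne hx,
    norm_sq_inv_eq_exp hν.ne' hx]
  set ν := rate p α with hνd
  set τ := logNorm ν x with hτ
  have dw := hasDerivAt_modeWeight p (decay N p α) τ
  have dA := ((dw.mul (hm.1 τ)).const_mul (weightConst N p α)).deriv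
  have dB := ((dw.mul (((((hm.2 τ).const_mul ν⁻¹).sub ((hm.1 τ).const_mul (k : ℝ))).const_mul
    (p - 1)).add ((hm.1 τ).const_mul ((p - 2) * k)))).const_mul (weightConst N p α)).deriv
  have dA' : deriv (fun τ => weightConst N p α * (modeWeight p (decay N p α) τ * f τ)) τ = _ := dA
  have dB' : deriv (fun τ => weightConst N p α * (modeWeight p (decay N p α) τ *
        ((p - 1) * (ν⁻¹ * g τ - k * f τ) + (p - 2) * k * f τ))) τ = _ := dB
  have e : Real.exp (-((N - 2) * ν * τ)) * (Real.exp (-(2 * ν * τ)) * Real.exp (-(k * ν * τ)))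
      = Real.exp (-((N + k) * ν * τ)) := by
    rw [← Real.exp_add, ← Real.exp_add]
    ring_nf
  rw [dA', dB', ← e, linWeight, modeEigenvalue, potentialConst, ← hνd]
  simp only [Pi.add_apply, Pi.sub_apply]
  have hp1 : p - 1 ≠ 0 := by linarith
  have hν0 := hν.ne'
  field_simp
  ring

lemma locallyIntegrable_fluxField (hN : 2 ≤ N) (hp : 1 < p) (hpN : p < N) (hα : 0 ≤ α)
    (hH : H.IsHomogeneous k) (hf : Continuous f) (hg : Continuous g) {C : ℝ}
    (hb : HasModeBounds p b k f g C) :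
    LocallyIntegrable fun x => ‖x‖⁻¹ • fluxField N p α k H f g x := by
  have hN1 : 1 ≤ N := by omega
  have hν := rate_pos hp hα
  obtain ⟨D, hD, hDb⟩ := exists_norm_scaledField_le (N := N) (ν := rate p α) hν.ne' hH
  have hwc : Continuous (linWeight N p α) := (contDiff_linWeight N p α).continuous
  set B : ℝ → ℝ := fun τ => (p - 1) * ((rate p α)⁻¹ * g τ - k * f τ) + (p - 2) * k * f τ with hB
  have hBc : Continuous B := by fun_prop
  have e : fluxField N p α k H f g = scaledField (rate p α) k H
      (fun τ => linWeight N p α τ * f τ) (fun τ => linWeight N p α τ * B τ) := by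
    unfold fluxField scaledField
    congr 1
    · funext τ
      have : Real.exp (-((N - 2 + k) * rate p α * τ))
          = Real.exp (-((N - 2) * rate p α * τ)) * Real.exp (-(k * rate p α * τ)) := by
        rw [← Real.exp_add]; ring_nf
      simp only [this, linWeight]
      ring
    · funext τ
      have : Real.exp (-((N + k) * rate p α * τ))
          = Real.exp (-((N - 2) * rate p α * τ)) * Real.exp (-((k + 2) * rate p α * τ)) := by
        rw [← Real.exp_add]; ring_nf
      simp only [this, linWeight, hB]
      ring
  set Q : HenonSpace N → ℝ := fun x => D * (2 + (p - 1) * (rate p α)⁻¹) * C * (weightConst N p α *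
    (‖x‖ ^ (α * (1 - 1 / p)) *
      (1 + ‖x‖ ^ ((p + α) / (p - 1))) ^ (-(decay N p α * (p - 2))))) with hQ
  have hp1 : 1 / p ≤ 1 := by rw [div_le_one (by linarith)]; exact hp.le
  have hQc : Continuous Q := by
    have h1 : Continuous fun x : HenonSpace N => ‖x‖ ^ ((p + α) / (p - 1)) :=
      continuous_norm.rpow_const fun x => Or.inr (div_nonneg (by linarith) (by linarith))
    have h2 : Continuous fun x : HenonSpace N => ‖x‖ ^ (α * (1 - 1 / p)) :=
      continuous_norm.rpow_const fun x => Or.inr (mul_nonneg hα (by linarith))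
    have h3 : Continuous fun x : HenonSpace N =>
        (1 + ‖x‖ ^ ((p + α) / (p - 1))) ^ (-(decay N p α * (p - 2))) :=
      (continuous_const.add h1).rpow_const fun x => Or.inl (one_add_norm_rpow_pos _ x).ne'
    fun_prop
  have hQi : LocallyIntegrable fun x => Q x * ‖x‖⁻¹ := by
    have h := locallyIntegrable_inv_norm hN
    rw [locallyIntegrable_iff] at h ⊢
    exact fun K hK => (h K hK).continuousOn_mul hQc.continuousOn hK
  refine hQi.mono ((by fun_prop : Measurable fun x : HenonSpace N => ‖x‖⁻¹).smul
    (e ▸ measurable_scaledField (hwc.mul hf) (hwc.mul hBc))).aestronglyMeasurable ?_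
  filter_upwards [ae_ne_zero hN1] with x hx
  have hx' := norm_pos_iff.2 hx
  set τ := logNorm (rate p α) x with hτ
  rw [norm_smul, norm_inv, norm_norm, mul_comm, norm_mul, norm_inv, norm_norm]
  refine mul_le_mul_of_nonneg_right ?_ (by positivity)
  refine le_trans ?_ (le_abs_self (Q x))
  rw [e]
  refine (hDb _ _ x hx).trans ?_
  rw [← hτ]
  have hw := linWeight_pos hp hpN hα τ
  have h1 : k * |f τ| + |B τ| ≤ (2 + (p - 1) * (rate p α)⁻¹) * C * Real.exp (1 / p * τ) := by
    have e1 : B τ = (p - 1) * (rate p α)⁻¹ * g τ - k * f τ := by rw [hB]; ring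
    have hc : 0 ≤ (p - 1) * (rate p α)⁻¹ := mul_nonneg (by linarith) (inv_pos.2 hν).le
    have h2 : |B τ| ≤ (p - 1) * (rate p α)⁻¹ * |g τ| + k * |f τ| := by
      rw [e1]
      refine (abs_sub _ _).trans (le_of_eq ?_)
      rw [abs_mul _ (g τ), abs_mul _ (f τ), abs_of_nonneg hc, Nat.abs_cast]
    have h3 := mul_le_mul_of_nonneg_left (hb.deriv_le_exp_atBot τ) hc
    have h4 := hb.le_exp_atBot τ
    linarith
  have h2 : Q x = D * ((2 + (p - 1) * (rate p α)⁻¹) * C * Real.exp (1 / p * τ)) *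
      (linWeight N p α τ * ‖x‖⁻¹) := by
    simp only [hQ]
    rw [← linWeight_mul_exp hp hα hx, ← hτ]
    ring
  rw [h2, abs_mul, abs_mul, abs_of_pos hw]
  calc D * (k * (linWeight N p α τ * |f τ|) + linWeight N p α τ * |B τ|) * ‖x‖⁻¹
      = D * (k * |f τ| + |B τ|) * (linWeight N p α τ * ‖x‖⁻¹) := by ring
    _ ≤ _ := by gcongr

/-- A solution of the radial equation with suitable bounds gives a solution of the linearized
equation. -/
theorem solvesLinearized_modeFn (hN : 2 ≤ N) (hp : 1 < p) (hpN : p < N) (hα : 0 ≤ α)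
    (hH : H ∈ harmonicPoly N k)
    (hm : IsModeSolution p (decay N p α) (modeEigenvalue N p α k) f g)
    (hf : ContDiff ℝ ∞ f) (hg : ContDiff ℝ ∞ g) {C : ℝ} (hb : HasModeBounds p b k f g C)
    (hv : LocallyIntegrable (modeFn (N := N) (rate p α) k H f)) :
    SolvesLinearized p α (modeFn (N := N) (rate p α) k H f)
      (scaledField (rate p α) k H f (fun τ => (rate p α)⁻¹ * g τ - k * f τ)) := by
  intro η hη
  have hN1 : 1 ≤ N := by omega
  have hPi : LocallyIntegrable fun x =>
      linPotential p α x * modeFn (N := N) (rate p α) k H f x := by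
    rw [locallyIntegrable_iff] at hv ⊢
    exact fun K hK => (hv K hK).continuousOn_mul
      (continuous_linPotential hp hpN hα).continuousOn hK
  have hws := contDiff_modeWeight p (decay N p α)
  obtain ⟨i, e⟩ := integral_inner_gradient_of_singular hN1 (X := fluxField N p α k H f g)
    (fun i x hx => contDiffAt_modeField
      ((contDiff_exp_neg_mul _).mul (contDiff_const.mul (hws.mul hf)))
      ((contDiff_exp_neg_mul _).mul (contDiff_const.mul (hws.mul ((contDiff_const.mul
        ((contDiff_const.mul hg).sub (contDiff_const.mul hf))).add (contDiff_const.mul hf))))) i hx)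
    (fun x hx => sum_gradient_fluxField hp hpN hα hH hm hf hg hx)
    (locallyIntegrable_fluxField hN hp hpN hα hH.1 hf.continuous hg.continuous hb) hPi.neg hη
  have a : ∀ᵐ x : HenonSpace N, inner ℝ (fluxField N p α k H f g x) (gradient η x)
      = linForm p α x (scaledField (rate p α) k H f
          (fun τ => (rate p α)⁻¹ * g τ - k * f τ) x) (gradient η x) := by
    filter_upwards [ae_ne_zero hN1] with x hx
    rw [linForm_eq_inner_fluxField hp hpN hα hx hH.1]
  refine ⟨i.congr a, hPi.integrable_smul_right_of_hasCompactSupport hη.1.continuous hη.2, ?_⟩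
  rw [← integral_congr_ae a, e, ← integral_neg]
  simp

end Solutions

section Membership

variable {N : ℕ} {p α : ℝ} {k : ℕ}

lemma one_add_exp_rpow_neg_le_one {c : ℝ} (hc : 0 ≤ c) (τ : ℝ) :
    (1 + Real.exp τ) ^ (-c) ≤ 1 :=
  Real.rpow_le_one_of_one_le_of_nonpos (by linarith [Real.exp_pos τ]) (by linarith)

lemma one_add_exp_rpow_neg_le_exp {c : ℝ} (hc : 0 ≤ c) (τ : ℝ) :
    (1 + Real.exp τ) ^ (-c) ≤ Real.exp (-(c * τ)) := by
  have h : Real.exp (-(c * τ)) = Real.exp τ ^ (-c) := by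
    rw [← Real.exp_mul]
    ring_nf
  rw [h]
  exact Real.rpow_le_rpow_of_nonpos (Real.exp_pos τ) (by linarith) (by linarith)

lemma contDiff_groundMode (p β : ℝ) : ContDiff ℝ ∞ (groundMode p β) :=
  (contDiff_exp_const_mul _).mul (contDiff_one_add_exp_rpow _)

lemma contDiff_radialMode (p β : ℝ) : ContDiff ℝ ∞ (radialMode p β) :=
  (contDiff_const.sub Real.contDiff_exp).mul (contDiff_one_add_exp_rpow _)

lemma contDiff_radialModeDeriv (p β : ℝ) : ContDiff ℝ ∞ (radialModeDeriv p β) :=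
  ((Real.contDiff_exp.mul (contDiff_one_add_exp_rpow _)).neg).sub
    ((contDiff_const.mul contDiff_logistic).mul (contDiff_radialMode p β))

lemma hasModeBounds_groundMode {β : ℝ} (hp : 1 < p) (hβ : 1 < β) (k : ℕ) :
    HasModeBounds p (β - 1 / p) k (groundMode p β)
      (fun τ => (1 / p - β * logistic τ) * groundMode p β τ) (1 + 1 / p + β + k) := by
  have hp0 : 0 < 1 / p := by positivity
  have hp1 : 1 / p < 1 := by rw [div_lt_one (by linarith)]; exact hp
  have hk : (0 : ℝ) ≤ k := Nat.cast_nonneg k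
  have hf := groundMode_pos p β
  have F1 : ∀ τ, groundMode p β τ ≤ Real.exp (1 / p * τ) := fun τ =>
    mul_le_of_le_one_right (Real.exp_pos _).le (one_add_exp_rpow_neg_le_one (by linarith) τ)
  have F2 : ∀ τ, groundMode p β τ ≤ Real.exp (-((β - 1 / p) * τ)) := fun τ => by
    have e : Real.exp (-((β - 1 / p) * τ)) = Real.exp (1 / p * τ) * Real.exp (-(β * τ)) := by
      rw [← Real.exp_add]; ring_nf
    rw [e]
    exact mul_le_mul_of_nonneg_left (one_add_exp_rpow_neg_le_exp (by linarith) τ)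
      (Real.exp_pos _).le
  have F3 : ∀ τ, groundMode p β τ ≤ 1 := fun τ => by
    rcases le_total τ 0 with h | h
    · exact (F1 τ).trans (Real.exp_le_one_iff.2 (mul_nonpos_of_nonneg_of_nonpos hp0.le h))
    · exact (F2 τ).trans (Real.exp_le_one_iff.2
        (neg_nonpos.2 (mul_nonneg (by linarith) h)))
  have G : ∀ τ, |(1 / p - β * logistic τ) * groundMode p β τ| ≤ (1 / p + β) * groundMode p β τ :=
    fun τ => by
      rw [abs_mul, abs_of_pos (hf τ)]
      refine mul_le_mul_of_nonneg_right ?_ (hf τ).le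
      have h1 := logistic_pos τ
      have h2 := logistic_lt_one τ
      rw [abs_le]
      constructor <;> nlinarith
  have step : ∀ {c X m : ℝ}, 0 ≤ X → m ≤ X → 0 ≤ c → c ≤ 1 + 1 / p + β + k →
      c * m ≤ (1 + 1 / p + β + k) * X := fun {c X m} hX hm hc0 hc =>
    (mul_le_mul_of_nonneg_left hm hc0).trans (mul_le_mul_of_nonneg_right hc hX)
  refine ⟨fun τ => ?_, fun τ => ?_, fun τ => ?_, fun τ => ?_, fun τ => ?_, fun τ => ?_⟩
  · rw [abs_of_pos (hf τ)]
    linarith [F3 τ]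
  · refine (G τ).trans ?_
    have := step (c := 1 / p + β) zero_le_one (F3 τ) (by linarith) (by linarith)
    linarith
  · rw [abs_of_pos (hf τ)]
    have := step (c := 1) (Real.exp_pos _).le (F2 τ) zero_le_one (by linarith)
    linarith
  · exact (G τ).trans (step (Real.exp_pos _).le (F2 τ) (by linarith) (by linarith))
  · exact (G τ).trans (step (Real.exp_pos _).le (F1 τ) (by linarith) (by linarith))
  · rw [abs_of_pos (hf τ)]
    exact step (Real.exp_pos _).le (F1 τ) hk (by linarith)

lemma hasModeBounds_radialMode {β : ℝ} (hp : 1 < p) (hβ : 1 < β) :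
    HasModeBounds p (β - 1) 0 (radialMode p β) (radialModeDeriv p β) (p + 1 + β * p) := by
  have hp0 : 0 < 1 / p := by positivity
  have hp1 : 1 / p < 1 := by rw [div_lt_one (by linarith)]; exact hp
  have hβp : 0 < β * p := by positivity
  set m : ℝ → ℝ := fun τ => (1 + Real.exp τ) ^ (-(β - 1)) with hm
  set n : ℝ → ℝ := fun τ => Real.exp τ * (1 + Real.exp τ) ^ (-β) with hn
  have em : ∀ τ, m τ = (1 + Real.exp τ) * (1 + Real.exp τ) ^ (-β) := fun τ => by
    have h1 : 0 < 1 + Real.exp τ := by positivity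
    simp only [hm]
    rw [neg_sub, sub_eq_add_neg, Real.rpow_add h1, Real.rpow_one]
  have hn0 : ∀ τ, 0 ≤ n τ := fun τ => by positivity
  have hnm : ∀ τ, n τ ≤ m τ := fun τ => by
    rw [em]
    exact mul_le_mul_of_nonneg_right (by linarith) (by positivity)
  have M1 : ∀ τ, m τ ≤ 1 := one_add_exp_rpow_neg_le_one (by linarith)
  have M2 : ∀ τ, m τ ≤ Real.exp (-((β - 1) * τ)) := one_add_exp_rpow_neg_le_exp (by linarith)
  have N1 : ∀ τ, n τ ≤ Real.exp (1 / p * τ) := fun τ => by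
    rcases le_total τ 0 with h | h
    · refine (mul_le_of_le_one_right (Real.exp_pos _).le
        (one_add_exp_rpow_neg_le_one (by linarith) τ)).trans (Real.exp_le_exp.2 ?_)
      nlinarith
    · exact ((hnm τ).trans (M1 τ)).trans (Real.one_le_exp (by positivity))
  have F : ∀ τ, |radialMode p β τ| ≤ p * m τ := fun τ => by
    rw [em, radialMode, abs_mul, abs_of_pos (by positivity : 0 < (1 + Real.exp τ) ^ (-β)),
      ← mul_assoc]
    refine mul_le_mul_of_nonneg_right ?_ (by positivity)
    have := Real.exp_pos τ
    rw [abs_le]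
    constructor <;> nlinarith
  have G : ∀ τ, |radialModeDeriv p β τ| ≤ (1 + β * p) * n τ := fun τ => by
    have h1 : |β * logistic τ * radialMode p β τ| ≤ β * p * n τ := by
      have h2 := logistic_pos τ
      rw [abs_mul, abs_of_pos (by positivity)]
      calc β * logistic τ * |radialMode p β τ| ≤ β * logistic τ * (p * m τ) := by
            gcongr
            exact F τ
        _ = β * p * n τ := by
            rw [em]
            simp only [hn, logistic]
            field_simp
    have h3 : radialModeDeriv p β τ = -(n τ) - β * logistic τ * radialMode p β τ := rfl
    rw [h3]
    refine (abs_sub _ _).trans ?_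
    rw [abs_neg, abs_of_nonneg (hn0 τ)]
    linarith
  have step : ∀ {c X y : ℝ}, 0 ≤ X → y ≤ X → 0 ≤ c → c ≤ p + 1 + β * p →
      c * y ≤ (p + 1 + β * p) * X := fun {c X y} hX hy hc0 hc =>
    (mul_le_mul_of_nonneg_left hy hc0).trans (mul_le_mul_of_nonneg_right hc hX)
  refine ⟨fun τ => ?_, fun τ => ?_, fun τ => ?_, fun τ => ?_, fun τ => ?_, fun τ => ?_⟩
  · have := step zero_le_one (M1 τ) (by linarith) (by linarith : p ≤ _)
    linarith [F τ]
  · have := step zero_le_one ((hnm τ).trans (M1 τ)) (by linarith) (by linarith : 1 + β * p ≤ _)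
    linarith [G τ]
  · exact (F τ).trans (step (Real.exp_pos _).le (M2 τ) (by linarith) (by linarith))
  · exact (G τ).trans (step (Real.exp_pos _).le ((hnm τ).trans (M2 τ)) (by linarith) (by linarith))
  · exact (G τ).trans (step (Real.exp_pos _).le (N1 τ) (by linarith) (by linarith))
  · rw [Nat.cast_zero, zero_mul]
    positivity

/-- Membership in the solution space can be tested on any representative. -/
lemma mk_mem_solutionSpace {u w : HenonSpace N → ℝ} {G : HenonSpace N → HenonSpace N}
    (hD : MemD1p p u G) (hs : SolvesLinearized p α u G) (hw : AEStronglyMeasurable w volume)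
    (e : u =ᵐ[volume] w) : AEEqFun.mk w hw ∈ solutionSpace N p α := by
  have e' := e.trans (AEEqFun.coeFn_mk w hw).symm
  exact ⟨G, hD.congr e', hs.congr e'⟩

lemma one_mem_harmonicPoly (N : ℕ) : (1 : MvPolynomial (Fin N) ℝ) ∈ harmonicPoly N 0 := by
  rw [mem_harmonicPoly]
  exact ⟨MvPolynomial.isHomogeneous_one _ _, by simp [polyLaplacian_apply]⟩

/-- The function `radialZ` is the mode of degree zero with coefficient `radialMode`. -/
lemma radialZ_eq (hp : 1 < p) (hα : 0 ≤ α) {x : HenonSpace N} (hx : x ≠ 0) :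
    radialZ N p α x = modeFn (rate p α) 0 1 (radialMode p (decay N p α)) x := by
  rw [radialZ, modeFn, radialLift_of_ne hx, norm_rpow_eq_exp hp hα hx, radialMode,
    Real.rpow_neg (by positivity), ← div_eq_mul_inv]
  simp [polyEval, decay]

/-- The function `angularZ` is the mode of degree `k` with coefficient `groundMode`. -/
lemma angularZ_eq (hp : 1 < p) (hα : 0 ≤ α) {Φ : MvPolynomial (Fin N) ℝ}
    (hΦ : Φ.IsHomogeneous k) {x : HenonSpace N} (hx : x ≠ 0) :
    angularZ N p α Φ x = modeFn (rate p α) k Φ (groundMode p (decay N p α)) x := by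
  have hν := (rate_pos hp hα).ne'
  have h1 : MvPolynomial.eval (fun i => x i / ‖x‖) Φ
      = Real.exp (-(k * rate p α * logNorm (rate p α) x)) * polyEval Φ x := by
    have h2 := polyEval_smul_vector hΦ ‖x‖⁻¹ x
    rw [Real.exp_neg, exp_mul_logNorm hν hx, Real.rpow_natCast, ← inv_pow, ← h2]
    simp only [polyEval, PiLp.smul_apply, smul_eq_mul, div_eq_mul_inv, mul_comm]
  have h3 : ‖x‖ ^ ((p + α) / (p * (p - 1))) = Real.exp (1 / p * logNorm (rate p α) x) := by
    rw [rpow_eq_exp_rate hp hα hx]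
    congr 2
    have : p - 1 ≠ 0 := by linarith
    have : p + α ≠ 0 := by linarith
    rw [rate]
    field_simp
  rw [angularZ, modeFn, radialLift_of_ne hx, norm_rpow_eq_exp hp hα hx, groundMode, h1, h3,
    Real.rpow_neg (by positivity), decay]
  ring

lemma radialZClass_mem (hN : 2 ≤ N) (hp : 1 < p) (hpN : p < N) (hα : 0 ≤ α) :
    radialZClass N p α ∈ solutionSpace N p α := by
  have hN1 : 1 ≤ N := by omega
  have hβ := one_lt_decay hp hpN hα
  have hm := radialMode_isModeSolution p (decay N p α)
  have hb := hasModeBounds_radialMode hp hβ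
  have hD := memD1p_modeFn (H := 1) hN hp hpN (rate_pos hp hα) (one_mem_harmonicPoly N).1
    (contDiff_radialMode p (decay N p α)) (contDiff_radialModeDeriv p _).continuous hm.1 hb (by
      have hpα : 0 < p + α := by linarith
      have e : decay N p α - 1 - (N - p) / p * rate p α = (N - p) / (p * (p + α)) := by
        rw [decay, rate]
        field_simp
        ring
      have : 0 < (N - p) / (p * (p + α)) := div_pos (by linarith) (by positivity)
      linarith)
  refine mk_mem_solutionSpace hD (solvesLinearized_modeFn hN hp hpN hα (one_mem_harmonicPoly N) ?_
    (contDiff_radialMode p _) (contDiff_radialModeDeriv p _) hb hD.isWeakGradient.1) _ ?_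
  · simpa [modeEigenvalue] using hm
  · filter_upwards [ae_ne_zero hN1] with x hx using (radialZ_eq hp hα hx).symm

lemma angularZClass_mem (hN : 2 ≤ N) (hp : 1 < p) (hpN : p < N) (hα : 0 ≤ α)
    (hαk : α = alphaCrit N p k) {Φ : MvPolynomial (Fin N) ℝ} (hΦ : Φ ∈ harmonicPoly N k) :
    angularZClass N p α Φ ∈ solutionSpace N p α := by
  have hN1 : 1 ≤ N := by omega
  have hβ := one_lt_decay hp hpN hα
  have hm := groundMode_isModeSolution (β := decay N p α) (by linarith : p ≠ 0)
  rw [← (modeEigenvalue_eq_iff hp hα).2 ((eq_alphaCrit_iff hp hpN hα).1 hαk)] at hm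
  have hb := hasModeBounds_groundMode hp hβ k
  have hg : ContDiff ℝ ∞ fun τ => (1 / p - decay N p α * logistic τ) *
      groundMode p (decay N p α) τ :=
    (contDiff_const.sub (contDiff_const.mul contDiff_logistic)).mul (contDiff_groundMode p _)
  have hD := memD1p_modeFn hN hp hpN (rate_pos hp hα) hΦ.1
    (contDiff_groundMode p (decay N p α)) hg.continuous hm.1 hb (by
      have hpα : 0 < p + α := by linarith
      have hp0 : 0 < p := by linarith
      have e : decay N p α - 1 / p - (N - p) / p * rate p α
          = (α * (p - 1) + (N - p) + p * (p - 1)) / (p * (p + α)) := by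
        rw [decay, rate]
        field_simp
        ring
      have : 0 < (α * (p - 1) + (N - p) + p * (p - 1)) / (p * (p + α)) := by
        have : 0 ≤ α * (p - 1) := mul_nonneg hα (by linarith)
        have : 0 < p * (p - 1) := mul_pos hp0 (by linarith)
        exact div_pos (by linarith) (by positivity)
      linarith)
  refine mk_mem_solutionSpace hD (solvesLinearized_modeFn hN hp hpN hα hΦ hm
    (contDiff_groundMode p _) hg hb hD.isWeakGradient.1) _ ?_
  filter_upwards [ae_ne_zero hN1] with x hx using (angularZ_eq hp hα hΦ.1 hx).symm

end Membership

/-! ### The solution space -/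

section Space

variable {N : ℕ} {p α ν : ℝ} {k : ℕ}

lemma locallyIntegrable_of_mem_solutionSpace {v : HenonSpace N →ₘ[volume] ℝ}
    (hv : v ∈ solutionSpace N p α) : LocallyIntegrable v := by
  obtain ⟨G, hG, -⟩ := hv
  exact hG.isWeakGradient.1

/-- The coefficients of a solution along the harmonic polynomials of degree `k`, averaged in the
radial direction with the weight `bumpFn (· + σ)`. -/
noncomputable def modePairing (N : ℕ) (p α : ℝ) (hν : 0 < ν) (k : ℕ) (σ : ℝ) :
    solutionSpace N p α →ₗ[ℝ] harmonicPoly N k →ₗ[ℝ] ℝ :=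
  LinearMap.mk₂ ℝ (fun v H => ∫ x, ((v : HenonSpace N →ₘ[volume] ℝ) x * polyEval H.1 x) *
      bumpFn (logNorm ν x + σ))
    (fun v w H => by
      have hi := fun u : solutionSpace N p α => integrable_mul_polyEval_mul hν
        (locallyIntegrable_of_mem_solutionSpace u.2) H.1 (contDiff_bumpFn_add σ).continuous
        (hasCompactSupport_bumpFn_add σ)
      rw [← integral_add (hi v) (hi w)]
      refine integral_congr_ae ?_
      filter_upwards [AEEqFun.coeFn_add v.1 w.1] with x hx
      rw [Submodule.coe_add, hx, Pi.add_apply]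
      ring)
    (fun c v H => by
      rw [smul_eq_mul, ← integral_const_mul]
      refine integral_congr_ae ?_
      filter_upwards [AEEqFun.coeFn_smul c v.1] with x hx
      rw [Submodule.coe_smul, hx, Pi.smul_apply, smul_eq_mul]
      ring)
    (fun v H K => by
      have hi := fun Q : harmonicPoly N k => integrable_mul_polyEval_mul hν
        (locallyIntegrable_of_mem_solutionSpace v.2) Q.1 (contDiff_bumpFn_add σ).continuous
        (hasCompactSupport_bumpFn_add σ)
      rw [← integral_add (hi H) (hi K)]
      refine integral_congr_ae (Eventually.of_forall fun x => ?_)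
      simp only [Submodule.coe_add, polyEval_add]
      ring)
    (fun c v H => by
      rw [smul_eq_mul, ← integral_const_mul]
      refine integral_congr_ae (Eventually.of_forall fun x => ?_)
      simp only [Submodule.coe_smul, polyEval_smul]
      ring)

lemma modePairing_apply (hν : 0 < ν) (σ : ℝ) (v : solutionSpace N p α) (H : harmonicPoly N k) :
    modePairing N p α hν k σ v H = ∫ x, ((v : HenonSpace N →ₘ[volume] ℝ) x * polyEval H.1 x) *
      bumpFn (logNorm ν x + σ) := rfl

lemma integral_bumpFn_add_mul_pos {σ : ℝ} {F : ℝ → ℝ} (hF : Continuous F)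
    (h : ∀ τ ∈ Set.Icc (-σ - 1) (-σ + 1), 0 < F τ) : 0 < ∫ τ, bumpFn (τ + σ) * F τ := by
  obtain ⟨m, hm, hmin⟩ := (isCompact_Icc (a := -σ - 1) (b := -σ + 1)).exists_isMinOn
    ⟨-σ, by constructor <;> linarith⟩ hF.continuousOn
  exact (h m hm).trans_le (le_integral_bumpFn_add_mul hF fun τ hτ => hmin hτ)

/-- A solution without component along the constants and, if `α = α(k)`, along the harmonic
polynomials of degree `k`, vanishes. -/
lemma exists_modePairing_injective (hN : 2 ≤ N) (hp : 1 < p) (hpN : p < N) (hα : 0 ≤ α) :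
    ∃ σ, ∀ v : solutionSpace N p α,
      modePairing N p α (rate_pos hp hα) 0 σ v ⟨1, one_mem_harmonicPoly N⟩ = 0 →
      (∀ k, 1 ≤ k → α = alphaCrit N p k →
        modePairing N p α (rate_pos hp hα) k σ v = 0) → v = 0 := by
  have hN1 : 1 ≤ N := by omega
  have hν := rate_pos hp hα
  -- The weight is placed where the radial solution is positive.
  refine ⟨1 - Real.log (p - 1) + 1, fun v h0 hk => ?_⟩
  set σ := 1 - Real.log (p - 1) + 1 with hσ
  obtain ⟨G, hD, hs⟩ := v.2
  have hR : 0 < ∫ τ, bumpFn (τ + σ) *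
      (radialMode p (decay N p α) τ * Real.exp (N * rate p α * τ)) := by
    refine integral_bumpFn_add_mul_pos ((contDiff_radialMode p _).continuous.mul (by fun_prop))
      fun τ hτ => mul_pos (mul_pos ?_ (by positivity)) (Real.exp_pos _)
    rw [sub_pos, ← Real.lt_log_iff_exp_lt (by linarith)]
    linarith [hτ.2]
  have hM : ∀ k : ℕ, 0 < ∫ τ, bumpFn (τ + σ) *
      (groundMode p (decay N p α) τ * Real.exp ((N + k) * rate p α * τ)) := fun k =>
    integral_bumpFn_add_mul_pos ((contDiff_groundMode p _).continuous.mul (by fun_prop))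
      fun τ _ => mul_pos (groundMode_pos _ _ _) (Real.exp_pos _)
  have hbc := (contDiff_bumpFn_add σ).continuous
  have hbs := hasCompactSupport_bumpFn_add σ
  have key : ∀ᵐ x, (v : HenonSpace N →ₘ[volume] ℝ) x = 0 := by
    refine ae_eq_zero_of_forall_mode_eq_zero hN1 hν hD.isWeakGradient.1
      fun k H hH η hη hηc => ?_
    rcases Nat.eq_zero_or_pos k with rfl | hk1
    · obtain ⟨c, hc⟩ := exists_integral_radial_eq hN1 hp hpN hα hD hs (one_mem_harmonicPoly N)
      have hc0 : c = 0 := by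
        rw [modePairing_apply, hc _ hbc hbs] at h0
        refine (mul_eq_zero.1 h0).resolve_right ?_
        convert hR.ne' using 2
        refine integral_congr_ae (Eventually.of_forall fun τ => ?_)
        simp only
        ring
      have hH1 : H = MvPolynomial.C (MvPolynomial.coeff 0 H) :=
        MvPolynomial.totalDegree_eq_zero_iff_eq_C.1 (Nat.le_zero.1 hH.1.totalDegree_le)
      have h1 := hc η hη hηc
      rw [hc0, zero_mul] at h1
      have e : ∀ x, (v : HenonSpace N →ₘ[volume] ℝ) x * polyEval H x * η (logNorm (rate p α) x)
          = MvPolynomial.coeff 0 H * ((v : HenonSpace N →ₘ[volume] ℝ) x * polyEval 1 x *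
            η (logNorm (rate p α) x)) := fun x => by
        have h2 : polyEval H x = MvPolynomial.coeff 0 H := by
          conv_lhs => rw [hH1]
          simp
        have h3 : polyEval 1 x = 1 := by simp [polyEval]
        rw [h2, h3]
        ring
      simp only [e]
      rw [integral_const_mul, h1, mul_zero]
    · by_cases hαk : α = alphaCrit N p k
      · obtain ⟨c, hc⟩ := exists_integral_mode_eq hN1 hp hpN hα hD hs hk1 hH
        have hc0 : c = 0 := by
          have h1 := LinearMap.congr_fun (hk k hk1 hαk) ⟨H, hH⟩
          rw [modePairing_apply, hc _ hbc hbs, LinearMap.zero_apply] at h1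
          refine (mul_eq_zero.1 h1).resolve_right ?_
          convert (hM k).ne' using 2
          refine integral_congr_ae (Eventually.of_forall fun τ => ?_)
          simp only
          ring
        rw [hc η hη hηc, hc0, zero_mul]
      · exact integral_mode_eq_zero hN1 hp hpN hα hD hs hk1 hαk hH hη hηc
  refine Subtype.ext (AEEqFun.ext ?_)
  filter_upwards [key, AEEqFun.coeFn_zero (α := HenonSpace N) (β := ℝ) (μ := volume)] with x h1 h2
  rw [h1, Submodule.coe_zero, h2]
  rfl

lemma alphaCrit_injective (hN : 2 ≤ N) (hp : 1 < p) (hpN : p < N) (hα : 0 ≤ α) {j : ℕ}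
    (hk : α = alphaCrit N p k) (hj : α = alphaCrit N p j) : j = k := by
  have h1 := (eq_alphaCrit_iff hp hpN hα).1 hk
  rw [← (eq_alphaCrit_iff hp hpN hα).1 hj] at h1
  have hN2 : (2 : ℝ) ≤ N := by exact_mod_cast hN
  have h2 : ((k : ℝ) - j) * (k + j + N - 2) = 0 := by linear_combination h1
  rcases mul_eq_zero.1 h2 with h3 | h3
  · exact_mod_cast (sub_eq_zero.1 h3).symm
  · have hj0 : (0 : ℝ) ≤ j := Nat.cast_nonneg j
    have hk0 : (0 : ℝ) ≤ k := Nat.cast_nonneg k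
    have h4 : (j : ℝ) = k := by linarith
    exact_mod_cast h4

/-- The linear map that sends a harmonic polynomial `Φ` to the class of the function `angularZ`
given by `Φ`. -/
noncomputable def angularZMap (N : ℕ) (p α : ℝ) (k : ℕ) :
    harmonicPoly N k →ₗ[ℝ] HenonSpace N →ₘ[volume] ℝ where
  toFun Φ := angularZClass N p α Φ.1
  map_add' Φ Ψ := by
    refine Eq.trans ?_ (AEEqFun.mk_add_mk _ _
      (measurable_angularZ N p α Φ.1).aestronglyMeasurable
      (measurable_angularZ N p α Ψ.1).aestronglyMeasurable).symm
    refine AEEqFun.mk_eq_mk.2 (Eventually.of_forall fun x => ?_)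
    simp only [angularZ, Pi.add_apply, Submodule.coe_add, map_add]
    ring
  map_smul' c Φ := by
    refine Eq.trans ?_ (AEEqFun.smul_mk c _
      (measurable_angularZ N p α Φ.1).aestronglyMeasurable)
    refine AEEqFun.mk_eq_mk.2 (Eventually.of_forall fun x => ?_)
    simp only [angularZ, Function.comp_apply, Submodule.coe_smul,
      MvPolynomial.smul_eval, smul_eq_mul]
    ring

/-- A vanishing combination of the radial solution and of a mode has vanishing terms: on the
sphere where the radial solution vanishes, so does the harmonic polynomial. -/
lemma eq_zero_of_radialZ_add_angularZ_eq_zero (hN : 2 ≤ N) (hp : 1 < p) (hα : 0 ≤ α) {c : ℝ}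
    {Φ : MvPolynomial (Fin N) ℝ} (hΦ : Φ ∈ harmonicPoly N k)
    (h : c • radialZClass N p α + angularZClass N p α Φ = 0) : c = 0 ∧ Φ = 0 := by
  have hN1 : 1 ≤ N := by omega
  have hν := rate_pos hp hα
  set u : HenonSpace N → ℝ := fun x => c * modeFn (rate p α) 0 1 (radialMode p (decay N p α)) x
    + modeFn (rate p α) k Φ (groundMode p (decay N p α)) x with hu
  have hae : ∀ᵐ x, u x = 0 := by
    have h1 : AEEqFun.mk (c • radialZ N p α + angularZ N p α Φ)
        (((measurable_radialZ N p α).const_smul c).add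
          (measurable_angularZ N p α Φ)).aestronglyMeasurable =
            (0 : HenonSpace N →ₘ[volume] ℝ) := by
      rw [← h]
      rfl
    filter_upwards [AEEqFun.coeFn_mk (c • radialZ N p α + angularZ N p α Φ)
      (((measurable_radialZ N p α).const_smul c).add
        (measurable_angularZ N p α Φ)).aestronglyMeasurable,
      AEEqFun.coeFn_zero (α := HenonSpace N) (β := ℝ) (μ := volume), ae_ne_zero hN1]
      with x h2 h3 hx
    rw [h1, h3] at h2
    simp only [hu]
    rw [← radialZ_eq hp hα hx, ← angularZ_eq hp hα hΦ.1 hx]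
    exact h2.symm
  have hcont : ContinuousOn u {0}ᶜ := fun x hx =>
    ((continuousAt_const.mul (contDiffAt_modeFn (contDiff_radialMode p _) hx).continuousAt).add
      (contDiffAt_modeFn (contDiff_groundMode p _) hx).continuousAt).continuousWithinAt
  have hall : ∀ x ≠ 0, u x = 0 := fun x hx =>
    Measure.eqOn_open_of_ae_eq (ae_restrict_of_ae hae) isOpen_compl_singleton hcont
      continuousOn_const hx
  have hval : ∀ x ≠ 0, c * radialMode p (decay N p α) (logNorm (rate p α) x)
      + Real.exp (-(k * rate p α * logNorm (rate p α) x)) *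
        groundMode p (decay N p α) (logNorm (rate p α) x) * polyEval Φ x = 0 := fun x hx => by
    have := hall x hx
    simp only [hu, modeFn, radialLift_of_ne hx] at this
    simpa [polyEval] using this
  have hlog : ∀ (x : HenonSpace N), x ≠ 0 → ∀ τ : ℝ,
      (Real.exp (rate p α * τ) * ‖x‖⁻¹) • x ≠ 0 ∧
      logNorm (rate p α) ((Real.exp (rate p α * τ) * ‖x‖⁻¹) • x) = τ := fun x hx τ => by
    have hx' := norm_pos_iff.2 hx
    refine ⟨smul_ne_zero (by positivity) hx, ?_⟩
    rw [logNorm, norm_smul, Real.norm_eq_abs, abs_of_pos (by positivity), mul_assoc,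
      inv_mul_cancel₀ hx'.ne', mul_one, Real.log_exp, ← mul_assoc, inv_mul_cancel₀ hν.ne', one_mul]
  have hΦ0 : ∀ x ≠ 0, polyEval Φ x = 0 := fun x hx => by
    obtain ⟨h1, h2⟩ := hlog x hx (Real.log (p - 1))
    have h3 := hval _ h1
    have hx' := norm_pos_iff.2 hx
    rw [h2, polyEval_smul_vector hΦ.1, radialMode, Real.exp_log (by linarith), sub_self, zero_mul,
      mul_zero, zero_add] at h3
    have h4 := groundMode_pos p (decay N p α) (Real.log (p - 1))
    have h5 := (mul_eq_zero.1 h3).resolve_left (mul_pos (Real.exp_pos _) h4).ne'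
    exact (mul_eq_zero.1 h5).resolve_left (by positivity)
  have : Nontrivial (HenonSpace N) := by
    have : Nonempty (Fin N) := ⟨⟨0, hN1⟩⟩
    infer_instance
  obtain ⟨y, hy⟩ := exists_ne (0 : HenonSpace N)
  constructor
  · obtain ⟨h1, h2⟩ := hlog y hy (Real.log (p - 1) + 1)
    have h3 := hval _ h1
    rw [hΦ0 _ h1, h2, mul_zero, add_zero, radialMode] at h3
    refine (mul_eq_zero.1 h3).resolve_right (mul_ne_zero (sub_ne_zero.2 ?_) (by positivity))
    have h4 := Real.exp_log (by linarith : 0 < p - 1)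
    have h5 : Real.exp (Real.log (p - 1)) < Real.exp (Real.log (p - 1) + 1) :=
      Real.exp_lt_exp.2 (by linarith)
    linarith
  · have hcl : Dense ({0}ᶜ : Set (HenonSpace N)) := dense_compl_singleton 0
    have hz : polyEval Φ = fun _ => 0 := (contDiff_polyEval Φ).continuous.ext_on hcl
      continuous_const fun x hx => hΦ0 x hx
    refine MvPolynomial.funext fun z => ?_
    have := congrFun hz (WithLp.toLp 2 z)
    simpa [polyEval] using this

lemma solutionSpace_eq_span_of_ne (hN : 2 ≤ N) (hp : 1 < p) (hpN : p < N) (hα : 0 ≤ α)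
    (h : ∀ k : ℕ, 1 ≤ k → α ≠ alphaCrit N p k) :
    Module.finrank ℝ (solutionSpace N p α) = 1 ∧
      solutionSpace N p α = Submodule.span ℝ {radialZClass N p α} := by
  obtain ⟨σ, hσ⟩ := exists_modePairing_injective hN hp hpN hα
  let T : solutionSpace N p α →ₗ[ℝ] ℝ :=
    (modePairing N p α (rate_pos hp hα) 0 σ).flip ⟨1, one_mem_harmonicPoly N⟩
  have hT : Function.Injective T := (injective_iff_map_eq_zero T).2 fun v hv =>
    hσ v hv fun k hk hαk => absurd hαk (h k hk)
  have : FiniteDimensional ℝ (solutionSpace N p α) := FiniteDimensional.of_injective T hT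
  have h1 : Module.finrank ℝ (solutionSpace N p α) ≤ 1 := by
    simpa using LinearMap.finrank_le_finrank_of_injective hT
  have hZ : radialZClass N p α ≠ 0 := fun h0 => by
    have := (eq_zero_of_radialZ_add_angularZ_eq_zero (k := 0) (Φ := 0) (c := 1) hN hp hα
      (Submodule.zero_mem _) (by
        rw [h0, smul_zero, zero_add]
        exact (angularZMap N p α 0).map_zero)).1
    exact one_ne_zero this
  have h2 : Submodule.span ℝ {radialZClass N p α} = solutionSpace N p α :=
    Submodule.eq_of_le_of_finrank_le (by
      rw [Submodule.span_singleton_le_iff_mem]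
      exact radialZClass_mem hN hp hpN hα) (by rwa [finrank_span_singleton hZ])
  exact ⟨by rw [← h2, finrank_span_singleton hZ], h2.symm⟩

/-- The two coefficients embed the solution space in a space of dimension `1 + dim H_k`, and the
explicit solutions already span a subspace of that dimension. -/
lemma solutionSpace_eq_sup (hN : 2 ≤ N) (hp : 1 < p) (hpN : p < N) (hα : 0 ≤ α)
    (hαk : α = alphaCrit N p k) :
    Module.finrank ℝ (solutionSpace N p α) = 1 + Module.finrank ℝ (harmonicPoly N k) ∧
      solutionSpace N p α = Submodule.span ℝ {radialZClass N p α} ⊔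
        LinearMap.range (angularZMap N p α k) := by
  obtain ⟨σ, hσ⟩ := exists_modePairing_injective hN hp hpN hα
  let T : solutionSpace N p α →ₗ[ℝ] ℝ × (harmonicPoly N k →ₗ[ℝ] ℝ) :=
    ((modePairing N p α (rate_pos hp hα) 0 σ).flip ⟨1, one_mem_harmonicPoly N⟩).prod
      (modePairing N p α (rate_pos hp hα) k σ)
  have hT : Function.Injective T := (injective_iff_map_eq_zero T).2 fun v hv =>
    hσ v (congrArg Prod.fst hv) fun j _ hj => by
      obtain rfl := alphaCrit_injective hN hp hpN hα hαk hj
      exact congrArg Prod.snd hv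
  have : FiniteDimensional ℝ (solutionSpace N p α) := FiniteDimensional.of_injective T hT
  have h1 : Module.finrank ℝ (solutionSpace N p α) ≤ 1 + Module.finrank ℝ (harmonicPoly N k) := by
    have := LinearMap.finrank_le_finrank_of_injective hT
    rwa [Module.finrank_prod, Module.finrank_self, Module.finrank_linearMap, Module.finrank_self,
      mul_one] at this
  let J : ℝ × harmonicPoly N k →ₗ[ℝ] HenonSpace N →ₘ[volume] ℝ :=
    (LinearMap.toSpanSingleton ℝ _ (radialZClass N p α)).coprod (angularZMap N p α k)
  have hJ : Function.Injective J := (injective_iff_map_eq_zero J).2 fun y hy => by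
    obtain ⟨e1, e2⟩ := eq_zero_of_radialZ_add_angularZ_eq_zero hN hp hα y.2.2 hy
    exact Prod.ext e1 (Subtype.ext e2)
  have hr : LinearMap.range J = Submodule.span ℝ {radialZClass N p α} ⊔
      LinearMap.range (angularZMap N p α k) := by
    rw [LinearMap.range_coprod, LinearMap.range_toSpanSingleton]
  have hJr : Module.finrank ℝ (LinearMap.range J) = 1 + Module.finrank ℝ (harmonicPoly N k) := by
    rw [LinearMap.finrank_range_of_inj hJ, Module.finrank_prod, Module.finrank_self]
  have h2 : LinearMap.range J = solutionSpace N p α := by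
    refine Submodule.eq_of_le_of_finrank_le ?_ (by rwa [hJr])
    rw [hr, sup_le_iff, Submodule.span_singleton_le_iff_mem]
    refine ⟨radialZClass_mem hN hp hpN hα, ?_⟩
    rintro _ ⟨Φ, rfl⟩
    exact angularZClass_mem hN hp hpN hα hαk Φ.2
  exact ⟨by rw [← h2, hJr], by rw [← hr, h2]⟩

end Space

end Henon

theorem theorem1p2 (N : ℕ) (hN : 2 ≤ N) (p : ℝ) (hp : 1 < p) (hpN : p < N)
    (α : ℝ) (hα : 0 ≤ α) :
    (0 < α → (∀ k : ℕ, 1 ≤ k → α ≠ Henon.alphaCrit N p k) →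
      Module.finrank ℝ (Henon.solutionSpace N p α) = 1 ∧
      Henon.solutionSpace N p α = Submodule.span ℝ {Henon.radialZClass N p α}) ∧
    (∀ k : ℕ, 1 ≤ k → α = Henon.alphaCrit N p k →
      Module.finrank ℝ (Henon.harmonicPoly N k) = Henon.harmonicDim N k ∧
      Module.finrank ℝ (Henon.solutionSpace N p α) = 1 + Henon.harmonicDim N k ∧
      ∀ Φ : Module.Basis (Fin (Henon.harmonicDim N k)) ℝ (Henon.harmonicPoly N k),
        Henon.solutionSpace N p α =
          Submodule.span ℝ ({Henon.radialZClass N p α} ∪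
            Set.range fun i => Henon.angularZClass N p α (Φ i : MvPolynomial (Fin N) ℝ))) := by
  refine ⟨fun _ h => Henon.solutionSpace_eq_span_of_ne hN hp hpN hα h, fun k hk hαk => ?_⟩
  obtain ⟨h1, h2⟩ := Henon.solutionSpace_eq_sup hN hp hpN hα hαk
  have h3 := Henon.finrank_harmonicPoly hN hk
  refine ⟨h3, by rw [h1, h3], fun Φ => ?_⟩
  rw [h2, Submodule.span_union, LinearMap.range_eq_map, ← Φ.span_eq, Submodule.map_span,
    ← Set.range_comp]
  rfl
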